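/- Let $N\ge 2$, $s\in(0,1)$, let $\Omega\subset\mathbb R^N$ be a bounded open set (in particular, any bounded domain), and let $\mu$ be a regular Borel measure on $\partial\Omega$, possibly with infinite mass. Put $$\Gamma_\mu^\infty=\{z\in\partial\Omega:\ \mu(B(z,r)\cap\partial\Omega)=\infty\ \ \forall r>0\},\qquad \Gamma_\mu=\partial\Omega\setminus\Gamma_\mu^\infty,\qquad K_s(x,y)=|x-y|^{-(N-1+2s)}.$$ Let $\mathcal W^{1,2}(\Omega)$ be the closure of $W^{1,2}(\Omega)\cap C(\overline\Omega)$ in $W^{1,2}(\Omega)$, and for $A\subset\overline\Omega$ let $$\mathrm{Cap}_{2,\Omega}(A)=\inf\{\|w\|^2_{W^{1,2}(\Omega)}:\ w\in\mathcal W^{1,2}(\Omega),\ w\ge 1\ \text{a.e. on }\Omega\cap O\text{ for some open }O\supset A\}.$$ Assume * $(H_\mu)$: $\mu(A)=0$ for every Borel set $A\subset\Gamma_\mu$ with $\mathrm{Cap}_{2,\Omega}(A)=0$; and $\mathrm{Cap}_{2,\Omega}(\Gamma_\mu^\infty)>0$ or $\mu(\Gamma_\mu)>0$; * (H2): $f\in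 C^1(\mathbb R)$ and there are $p>1$ and positive constants $c_1,c_2,c_3,c_4$ with $c_1|r|^p-c_2\le f(r)r\le c_3|r|^p+c_4$ for all $r\in\mathbb R$; * (H3): there is a constant $C_f>0$ with $f'(r)\ge -C_f$ for all $r\in\mathbb R$. Let $\mathcal V$ be the completion of the space of all $u\in W^{1,2}(\Omega)\cap C(\overline\Omega)$ with $\int_{\partial\Omega}|u|^2d\mu<\infty$ and $\iint_{\Gamma_\mu\times\Gamma_\mu}K_s(x,y)|u(x)-u(y)|^2d\mu_xd\mu_y<\infty$ in the norm $\|u\|_{\mathcal V}^2=\|u\|_{L^2(\Omega)}^2+\mathcal A(u,u)$, where $$\mathcal A(u,v)=\int_\Omega\nabla u\cdot\nabla v\,dx+\int_{\Gamma_\mu}uv\,d\mu+\iint_{\Gamma_\mu\times\Gamma_\mu}K_s(x,y)(u(x)-u(y))(v(x)-v(y))\,d\mu_xd\mu_y$$ is extended to $\mathcal V$ by continuity, and elements of $\mathcal V$ are viewed in $L^2(\Omega)$ through the extension of the inclusion. For $u_0\in L^2(\Omega)$, a *weak solution* with initial value $u_0$ of $$\partial_tu-\Delta u+f(u)=0\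 \text{ in }\Omega\times(0,\infty),\qquad \partial_\nu u\,d\sigma+(u+\Theta_\mu(u))\,d\mu=0\ \text{ on }\partial\Omega\times(0,\infty),\qquad u(0)=u_0$$ (with $\langle\Theta_\mu(u),v\rangle=\iint_{\Gamma_\mu\times\Gamma_\mu} K_s(x,y)(u(x)-u(y))(v(x)-v(y))d\mu_xd\mu_y$) is a weakly continuous function $u:[0,\infty)\to L^2(\Omega)$ with $u(0)=u_0$ such that, for all $T>0$ and with $p'=p/(p-1)$: 1. $u\in L^\infty(0,T;L^2(\Omega))\cap L^p((0,T)\times\Omega)\cap L^2(0,T;\mathcal V)$ and $\partial_tu\in L^2(0,T;\mathcal V^*)+L^{p'}((0,T)\times\Omega)$ in the distributional sense; 2. for a.e. $t\in(0,T)$ and all $\xi\in\mathcal V\cap L^p(\Omega)$: $\ \langle\partial_tu(t),\xi\rangle+\mathcal A(u(t),\xi)+\int_\Omega f(u(t))\,\xi\,dx=0$; 3. for all $t\in[0,T]$: $\ \frac12\|u(t)\|_{L^2(\Omega)}^2+\int_0^t\Big[\mathcal A(u(\tau),u(\tau))+\int_\Omega f(u(\tau))u(\tau)\,dx\Big]d\tau=\frac12\|u(0)\|_{L^2(\Omega)}^2.$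 Then for every $u_0\in L^2(\Omega)$ there is exactly one weak solution $u$ with initial value $u_0$, and $u\in C([0,\infty);L^2(\Omega))$. The solution depends Lipschitz-continuously on the initial data: if $u,w$ are weak solutions with initial values $u_0,w_0\in L^2(\Omega)$, then $$\|u(t)-w(t)\|_{L^2(\Omega)}\le e^{C_ft}\,\|u_0-w_0\|_{L^2(\Omega)}\qquad\text{for all }t\ge 0.$$ -/

import Mathlib

open MeasureTheory Set Filter Topology
open scoped ENNReal ContDiff RealInnerProductSpace

noncomputable section

namespace RoughRobin

/-- Euclidean space of dimension `N`. -/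
abbrev E (N : ℕ) := EuclideanSpace ℝ (Fin N)

/-- The space `L²(Ω)` of real-valued functions. -/
abbrev L2 {N : ℕ} (Ω : Set (E N)) := Lp ℝ 2 (volume.restrict Ω)

/-- The space `L²(Ω; ℝᴺ)` of vector fields. -/
abbrev L2vec {N : ℕ} (Ω : Set (E N)) := Lp (E N) 2 (volume.restrict Ω)

/-! ### Sobolev functions and relative capacity -/

/-- `g` is the weak gradient of `u` on `Ω`, tested against `C_c^∞(Ω)`. -/
def IsWeakGrad {N : ℕ} (Ω : Set (E N)) (u : L2 Ω) (g : L2vec Ω) : Prop :=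
  ∀ φ : E N → ℝ, ContDiff ℝ ∞ φ → HasCompactSupport φ → tsupport φ ⊆ Ω → ∀ v : E N,
    ∫ x in Ω, u x * fderiv ℝ φ x v = - ∫ x in Ω, ⟪g x, v⟫ * φ x

/-- The Hilbert space `L²(Ω) × L²(Ω; ℝᴺ)`; a Sobolev function `u` is represented by `(u, ∇u)`,
and the norm is the `W^{1,2}` norm, `‖(u, ∇u)‖² = ‖u‖² + ‖∇u‖²`. -/
abbrev SobAmbient {N : ℕ} (Ω : Set (E N)) := WithLp 2 (L2 Ω × L2vec Ω)

/-- `W^{1,2}(Ω) ∩ C(closure Ω)`. -/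
def contSobolev {N : ℕ} (Ω : Set (E N)) : Set (SobAmbient Ω) :=
  {w | IsWeakGrad Ω w.fst w.snd ∧
    ∃ u : E N → ℝ, ContinuousOn u (closure Ω) ∧ w.fst =ᵐ[volume.restrict Ω] u}

/-- The closure of `W^{1,2}(Ω) ∩ C(closure Ω)` in `W^{1,2}(Ω)`. -/
def calW {N : ℕ} (Ω : Set (E N)) : Set (SobAmbient Ω) := closure (contSobolev Ω)

/-- The relative capacity of `A` with respect to `Ω`. -/
def relCap {N : ℕ} (Ω : Set (E N)) (A : Set (E N)) : ℝ≥0∞ :=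
  ⨅ w ∈ {w : SobAmbient Ω | w ∈ calW Ω ∧ ∃ O : Set (E N), IsOpen O ∧ A ⊆ O ∧
    ∀ᵐ x ∂(volume.restrict (Ω ∩ O)), 1 ≤ w.fst x}, ENNReal.ofReal (‖w‖ ^ 2)

/-! ### The boundary measure -/

/-- The part of the boundary on which `μ` is locally infinite. -/
def GammaInf {N : ℕ} (Ω : Set (E N)) (μ : Measure (E N)) : Set (E N) :=
  {z | z ∈ frontier Ω ∧ ∀ r : ℝ, 0 < r → μ (Metric.ball z r ∩ frontier Ω) = ⊤}

/-- The part of the boundary on which `μ` is locally finite. -/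
def Gamma {N : ℕ} (Ω : Set (E N)) (μ : Measure (E N)) : Set (E N) :=
  frontier Ω \ GammaInf Ω μ

/-- The set `Γ` is `Cap_{2,Ω}`-admissible with respect to `μ`. -/
def CapAdmissible {N : ℕ} (Ω Γ : Set (E N)) (μ : Measure (E N)) : Prop :=
  ∀ A : Set (E N), A ⊆ Γ → MeasurableSet A → relCap Ω A = 0 → μ A = 0

/-- The hypothesis on the boundary measure. -/
def Hmu {N : ℕ} (Ω : Set (E N)) (μ : Measure (E N)) : Prop :=
  CapAdmissible Ω (Gamma Ω μ) μ ∧ (0 < relCap Ω (GammaInf Ω μ) ∨ 0 < μ (Gamma Ω μ))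

/-- The restriction of `μ` to its domain `Γ_μ`. -/
def bdry {N : ℕ} (Ω : Set (E N)) (μ : Measure (E N)) : Measure (E N) :=
  μ.restrict (Gamma Ω μ)

/-- The measure `K_s(x,y) dμ_x dμ_y` on `Γ_μ × Γ_μ`, with `K_s(x,y) = |x-y|^{-(N-1+2s)}`.
On the diagonal the real power takes the value `0`; the integrands `(u(x)-u(y))(v(x)-v(y))`
vanish there. -/
def bdryPair {N : ℕ} (Ω : Set (E N)) (μ : Measure (E N)) (s : ℝ) : Measure (E N × E N) :=
  ((bdry Ω μ).prod (bdry Ω μ)).withDensity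
    fun z => ENNReal.ofReal (‖z.1 - z.2‖ ^ (-((N : ℝ) - 1 + 2 * s)))

/-! ### The energy space -/

/-- The Hilbert space
`L²(Ω) × L²(Ω; ℝᴺ) × L²(Γ_μ, μ) × L²(Γ_μ × Γ_μ, K_s dμ dμ)`. -/
abbrev Ambient {N : ℕ} (Ω : Set (E N)) (μ : Measure (E N)) (s : ℝ) :=
  WithLp 2 (L2 Ω × WithLp 2 (L2vec Ω × WithLp 2 (Lp ℝ 2 (bdry Ω μ) × Lp ℝ 2 (bdryPair Ω μ s))))

/-- The tuple `w` is `(u, ∇u, u|_{Γ_μ}, u(x) - u(y))` for some function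
`u ∈ W^{1,2}(Ω) ∩ C(closure Ω)` with `∫_{∂Ω} |u|² dμ < ∞` and finite nonlocal energy
`∬ K_s |u(x)-u(y)|² dμ dμ` (finite because the last entry lies in `L²`). -/
def IsCore {N : ℕ} (Ω : Set (E N)) (μ : Measure (E N)) (s : ℝ) (w : Ambient Ω μ s) : Prop :=
  IsWeakGrad Ω w.fst w.snd.fst ∧
  ∃ u : E N → ℝ, ContinuousOn u (closure Ω) ∧
    w.fst =ᵐ[volume.restrict Ω] u ∧
    ∫⁻ x in frontier Ω, ‖u x‖ₑ ^ 2 ∂μ < ⊤ ∧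
    w.snd.snd.fst =ᵐ[bdry Ω μ] u ∧
    w.snd.snd.snd =ᵐ[bdryPair Ω μ s] fun z => u z.1 - u z.2

theorem IsWeakGrad.smul_add {N : ℕ} {Ω : Set (E N)} {u u' : L2 Ω} {g g' : L2vec Ω}
    (h : IsWeakGrad Ω u g) (h' : IsWeakGrad Ω u' g') (c : ℝ) :
    IsWeakGrad Ω (c • u + u') (c • g + g') := by
  intro φ hφ hc hs v
  have h1 := h φ hφ hc hs v
  have h2 := h' φ hφ hc hs v
  have hd : MemLp (fun x => fderiv ℝ φ x v) 2 (volume.restrict Ω) := by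
    apply Continuous.memLp_of_hasCompactSupport
    · exact (hφ.continuous_fderiv (by simp)).clm_apply continuous_const
    · exact hc.fderiv_apply ℝ v
  have hφ2 : MemLp φ 2 (volume.restrict Ω) := hφ.continuous.memLp_of_hasCompactSupport hc
  have i1 : ∀ a : L2 Ω, Integrable (fun x => a x * fderiv ℝ φ x v) (volume.restrict Ω) :=
    fun a => (Lp.memLp a).integrable_mul hd
  have i2 : ∀ b : L2vec Ω, Integrable (fun x => ⟪b x, v⟫ * φ x) (volume.restrict Ω) :=
    fun b => ((Lp.memLp b).inner_const v).integrable_mul hφ2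
  have e1 : ∫ x in Ω, (c • u + u' : L2 Ω) x * fderiv ℝ φ x v
      = c * (∫ x in Ω, u x * fderiv ℝ φ x v) + ∫ x in Ω, u' x * fderiv ℝ φ x v := by
    rw [← integral_const_mul, ← integral_add ((i1 u).const_mul c) (i1 u')]
    refine integral_congr_ae ?_
    filter_upwards [Lp.coeFn_add (c • u) u', Lp.coeFn_smul c u] with x hx hx'
    rw [hx, Pi.add_apply, hx', Pi.smul_apply, smul_eq_mul]; ring
  have e2 : ∫ x in Ω, ⟪(c • g + g' : L2vec Ω) x, v⟫ * φ x
      = c * (∫ x in Ω, ⟪g x, v⟫ * φ x) + ∫ x in Ω, ⟪g' x, v⟫ * φ x := by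
    rw [← integral_const_mul, ← integral_add ((i2 g).const_mul c) (i2 g')]
    refine integral_congr_ae ?_
    filter_upwards [Lp.coeFn_add (c • g) g', Lp.coeFn_smul c g] with x hx hx'
    rw [hx, Pi.add_apply, hx', Pi.smul_apply, inner_add_left, real_inner_smul_left]; ring
  rw [e1, e2, h1, h2]; ring

theorem IsCore.smul_add {N : ℕ} {Ω : Set (E N)} {μ : Measure (E N)} {s : ℝ}
    {w w' : Ambient Ω μ s} (h : IsCore Ω μ s w) (h' : IsCore Ω μ s w') (c : ℝ) :
    IsCore Ω μ s (c • w + w') := by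
  obtain ⟨hg, u, hu, ha, hf, hb, hn⟩ := h
  obtain ⟨hg', u', hu', ha', hf', hb', hn'⟩ := h'
  refine ⟨hg.smul_add hg' c, fun x => c * u x + u' x,
    (continuousOn_const.mul hu).add hu', ?_, ?_, ?_, ?_⟩
  · filter_upwards [ha, ha', Lp.coeFn_add (c • w.fst) w'.fst, Lp.coeFn_smul c w.fst]
      with x h1 h2 h3 h4
    change (c • w.fst + w'.fst : L2 Ω) x = _
    rw [h3, Pi.add_apply, h4, Pi.smul_apply, h1, h2, smul_eq_mul]
  · have hcl : frontier Ω ⊆ closure Ω := frontier_subset_closure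
    have key : ∀ a : E N → ℝ, ContinuousOn a (closure Ω) →
        ((∫⁻ x in frontier Ω, ‖a x‖ₑ ^ 2 ∂μ < ⊤) ↔ MemLp a 2 (μ.restrict (frontier Ω))) := by
      intro a hca
      have hm : AEStronglyMeasurable a (μ.restrict (frontier Ω)) :=
        (hca.mono hcl).aestronglyMeasurable isClosed_frontier.measurableSet
      rw [MemLp, and_iff_right hm, eLpNorm_lt_top_iff_lintegral_rpow_enorm_lt_top (by simp) (by simp)]
      simp
    rw [key _ hu] at hf
    rw [key _ hu'] at hf'
    exact (key _ ((continuousOn_const.mul hu).add hu')).2 ((hf.const_mul c).add hf')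
  · filter_upwards [hb, hb', Lp.coeFn_add (c • w.snd.snd.fst) w'.snd.snd.fst,
      Lp.coeFn_smul c w.snd.snd.fst] with x h1 h2 h3 h4
    change (c • w.snd.snd.fst + w'.snd.snd.fst : Lp ℝ 2 (bdry Ω μ)) x = _
    rw [h3, Pi.add_apply, h4, Pi.smul_apply, h1, h2, smul_eq_mul]
  · filter_upwards [hn, hn', Lp.coeFn_add (c • w.snd.snd.snd) w'.snd.snd.snd,
      Lp.coeFn_smul c w.snd.snd.snd] with x h1 h2 h3 h4
    change (c • w.snd.snd.snd + w'.snd.snd.snd : Lp ℝ 2 (bdryPair Ω μ s)) x = _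
    rw [h3, Pi.add_apply, h4, Pi.smul_apply, h1, h2, smul_eq_mul]; ring

theorem IsCore.zero {N : ℕ} (Ω : Set (E N)) (μ : Measure (E N)) (s : ℝ) :
    IsCore Ω μ s 0 := by
  refine ⟨?_, fun _ => 0, continuousOn_const, ?_, by simp, ?_, ?_⟩
  · intro φ _ _ _ v
    change ∫ x in Ω, (0 : L2 Ω) x * fderiv ℝ φ x v = - ∫ x in Ω, ⟪(0 : L2vec Ω) x, v⟫ * φ x
    have e1 : ∫ x in Ω, (0 : L2 Ω) x * fderiv ℝ φ x v = 0 := by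
      refine integral_eq_zero_of_ae ?_
      filter_upwards [Lp.coeFn_zero ℝ 2 (volume.restrict Ω)] with x hx
      rw [hx]; simp
    have e2 : ∫ x in Ω, ⟪(0 : L2vec Ω) x, v⟫ * φ x = 0 := by
      refine integral_eq_zero_of_ae ?_
      filter_upwards [Lp.coeFn_zero (E N) 2 (volume.restrict Ω)] with x hx
      rw [hx]; simp
    rw [e1, e2, neg_zero]
  · exact Lp.coeFn_zero ℝ 2 (volume.restrict Ω)
  · exact Lp.coeFn_zero ℝ 2 (bdry Ω μ)
  · filter_upwards [Lp.coeFn_zero ℝ 2 (bdryPair Ω μ s)] with x hx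
    change (0 : Lp ℝ 2 (bdryPair Ω μ s)) x = _
    rw [hx]; simp

/-- The pre-Hilbert space of the functions `u` as in `IsCore`, embedded isometrically by
`u ↦ (u, ∇u, u|_{Γ_μ}, u(x) - u(y))`: the squared norm of the tuple is
`‖u‖²_{W^{1,2}(Ω)} + ∫ |u|² dμ + ∬ K_s |u(x)-u(y)|² dμ dμ`. -/
def coreSpace {N : ℕ} (Ω : Set (E N)) (μ : Measure (E N)) (s : ℝ) :
    Submodule ℝ (Ambient Ω μ s) where
  carrier := {w | IsCore Ω μ s w}
  zero_mem' := IsCore.zero Ω μ s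
  add_mem' := by
    intro a b ha hb
    simpa using IsCore.smul_add ha hb 1
  smul_mem' := by
    intro c a ha
    simpa using IsCore.smul_add ha (IsCore.zero Ω μ s) c

/-- The energy space `V_Θ^{1,2}(Ω, ∂Ω, μ)`: the completion of the pre-Hilbert space `coreSpace`,
realised as its closure in the complete space `Ambient`. -/
abbrev V {N : ℕ} (Ω : Set (E N)) (μ : Measure (E N)) (s : ℝ) :=
  (coreSpace Ω μ s).topologicalClosure

/-- The function in `L²(Ω)` underlying an element of the energy space. -/
def toL2 {N : ℕ} {Ω : Set (E N)} {μ : Measure (E N)} {s : ℝ} (v : V Ω μ s) : L2 Ω :=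
  (v : Ambient Ω μ s).fst

/-- The bilinear form
`∫_Ω ∇u·∇v dx + ∫_{Γ_μ} u v dμ + ∬_{Γ_μ×Γ_μ} K_s(x,y)(u(x)-u(y))(v(x)-v(y)) dμ dμ`,
that is, the sum of the `L²` inner products of the last three entries. -/
def form {N : ℕ} {Ω : Set (E N)} {μ : Measure (E N)} {s : ℝ} (u v : V Ω μ s) : ℝ :=
  ⟪(u : Ambient Ω μ s).snd.fst, (v : Ambient Ω μ s).snd.fst⟫
    + ⟪(u : Ambient Ω μ s).snd.snd.fst, (v : Ambient Ω μ s).snd.snd.fst⟫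
    + ⟪(u : Ambient Ω μ s).snd.snd.snd, (v : Ambient Ω μ s).snd.snd.snd⟫

/-! ### The nonlinearity and weak solutions -/

/-- Growth and dissipativity of the nonlinearity, with exponent `p`. -/
def H2 (f : ℝ → ℝ) (p : ℝ) : Prop :=
  ContDiff ℝ 1 f ∧ ∃ C c C' c' : ℝ, 0 < C ∧ 0 < c ∧ 0 < C' ∧ 0 < c' ∧
    ∀ r : ℝ, C * |r| ^ p - c ≤ f r * r ∧ f r * r ≤ C' * |r| ^ p + c'

/-- One-sided bound on the derivative of the nonlinearity. -/
def H3 (f : ℝ → ℝ) (C : ℝ) : Prop :=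
  ContDiff ℝ 1 f ∧ 0 < C ∧ ∀ r : ℝ, -C ≤ deriv f r

/-- `u : [0,∞) → L²(Ω)` (values at negative times are irrelevant) is a global weak solution with
initial value `u₀`. Here `v` is `u` regarded as a function with values in the energy space, and
`z₁ + z₂` is the distributional time derivative of `u`, with `z₁ ∈ L²(0,T; V*)` and
`z₂ ∈ L^{p'}((0,T) × Ω)`, `p' = p/(p-1)`. -/
def IsWeakSolution {N : ℕ} (Ω : Set (E N)) (μ : Measure (E N)) (s : ℝ) (f : ℝ → ℝ) (p : ℝ)
    (u₀ : L2 Ω) (u : ℝ → L2 Ω) : Prop :=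
  -- the weakly continuous representative in time
  (∀ ξ : L2 Ω, ContinuousOn (fun t => ⟪u t, ξ⟫) (Ici 0)) ∧
  u 0 = u₀ ∧
  -- regularity of `u`
  (∀ T : ℝ, 0 < T → MemLp u ⊤ (volume.restrict (Ioo 0 T))) ∧
  (∀ T : ℝ, 0 < T → ∫⁻ t in Ioo 0 T, ∫⁻ x in Ω, ‖u t x‖ₑ ^ p < ⊤) ∧
  ∃ (v : ℝ → V Ω μ s) (z₁ : ℝ → StrongDual ℝ (V Ω μ s)) (z₂ : ℝ → E N → ℝ),
    (∀ᵐ t ∂(volume.restrict (Ioi 0)), toL2 (v t) = u t) ∧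
    (∀ T : ℝ, 0 < T → MemLp v 2 (volume.restrict (Ioo 0 T))) ∧
    -- regularity of the time derivative
    (∀ T : ℝ, 0 < T → MemLp z₁ 2 (volume.restrict (Ioo 0 T))) ∧
    (∀ T : ℝ, 0 < T → MemLp (fun q : ℝ × E N => z₂ q.1 q.2) (ENNReal.ofReal (p / (p - 1)))
      ((volume.restrict (Ioo 0 T)).prod (volume.restrict Ω))) ∧
    (∀ ξ : V Ω μ s, MemLp (toL2 ξ) (ENNReal.ofReal p) (volume.restrict Ω) →
      ∀ ψ : ℝ → ℝ, ContDiff ℝ ∞ ψ → HasCompactSupport ψ → tsupport ψ ⊆ Ioi 0 →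
        ∫ t in Ioi 0, deriv ψ t * ⟪u t, toL2 ξ⟫
          = - ∫ t in Ioi 0, ψ t * (z₁ t ξ + ∫ x in Ω, z₂ t x * toL2 ξ x)) ∧
    -- variational identity
    (∀ᵐ t ∂(volume.restrict (Ioi 0)), ∀ ξ : V Ω μ s,
      MemLp (toL2 ξ) (ENNReal.ofReal p) (volume.restrict Ω) →
        (z₁ t ξ + ∫ x in Ω, z₂ t x * toL2 ξ x) + form (v t) ξ
          + ∫ x in Ω, f (u t x) * toL2 ξ x = 0) ∧
    -- energy identity
    (∀ t : ℝ, 0 ≤ t →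
      (1 / 2) * ‖u t‖ ^ 2
        + ∫ τ in (0 : ℝ)..t, (form (v τ) (v τ) + ∫ x in Ω, f (u τ x) * u τ x)
        = (1 / 2) * ‖u 0‖ ^ 2)

end RoughRobin

end

/-!
The problem is the gradient flow, perturbed by the Lipschitz term `C u`, of a convex energy, but
it has to be solved with very little compactness and with a time derivative that lies only in
`V* + L^{p'}`.

*Abstract setting.* The boundary enters only through the Hilbert space `V` and its contraction
`j : V → L²(m)` with `m` finite; the form is `energyForm j v w = ⟪v, w⟫ - ⟪j v, j w⟫`, and all that
is needed of `V` is that the bounded functions in the range of `j` are dense in `L²(m)`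
(`IsEnergyEmbedding`). Here they comprise the test functions of `Ω`, which are elements of the
energy space with vanishing trace (`isEnergyEmbedding_toL2L`).

*Stationary problem.* With `C` the constant of the one-sided bound of `f'`, `r ↦ f r + C r` is
monotone, and `u ↦ A u + f(u) + C u`, where `A` is the operator of the form, is a monotone relation
`EnergyRel` between `V` and `L²(m)`. It is maximal: its resolvents are the minimisers of functionals
that are uniformly convex on `V` (`exists_isMinOn_resolventFunctional`), so that minimising
sequences converge strongly in `V` and Fatou's lemma suffices for the potential of `f`. Its
domain is dense (`exists_energyRel_norm_sub_lt`).

*Existence.* For initial values in the domain, the Yosida approximations converge locally uniformly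
in `V` to a strong solution (`exists_isStrongSolution`). Monotonicity, retaining the energy of the
difference, makes strong solutions depend continuously on their initial values both uniformly in
`L²` and in `L²(0, T; V)`. Hence approximating an arbitrary initial value at a geometric rate gives
a limit with `j (v t) = u t` for almost every `t` (`exists_isStrongLimit`). The energy identity
bounds the approximations in `L^p((0, T) × Ω)`; together with convergence almost everywhere this
gives weak convergence of the nonlinear terms (`tendsto_integral_mul_of_ae_tendsto`), so the limit
solves the equation integrated in time. Its energy identity is the limit of the pairing of the
approximations with the limit itself.

*Uniqueness and Lipschitz dependence.* The usual proof differentiates `‖u - w‖²` by a product rule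
of Lions–Magenes type in `V* + L^{p'}`. Here this is avoided: a strong solution is continuous with
values in `V` and bounded in `L^p`, and its values are admissible test elements for any weak
solution. So both partial increments of `(a, c) ↦ ⟪u a, w c⟫` are given by the two equations, and
an elementary lemma on the diagonal of a function of two variables (`diagonal_integral_eq_sub`)
yields the derivative of `⟪u t, w t⟫` (`inner_integralSolution`). With the two energy identities,
which a weak solution satisfies by definition, and Grönwall's inequality, a strong and a weak
solution depart from each other by a factor of at most `e^{Ct}` (`norm_sub_integralSolution_le`).
Two weak solutions are then compared through strong solutions that approximate one of them
(`IsIntegralSolution.norm_sub_le`).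

The weak formulation and the equation integrated in time are equivalent by the lemma of
du Bois-Reymond (`sub_eq_integral_of_integral_deriv_mul`).
-/

noncomputable section

namespace RoughRobin

section

/-! ### Calculus of absolutely continuous functions of one variable -/

/-- The interval `[0, t]` is divided into `n + 1` equal parts, and on each of them the second
variable of `D` is frozen at the left (`o = 0`) or right (`o = 1`) endpoint. As the parts shrink,
the integrals tend to that of the diagonal, by dominated convergence. -/
theorem tendsto_sum_integral_diag {t : ℝ} (ht : 0 < t) {D : ℝ → ℝ → ℝ} {β : ℝ → ℝ} (o : ℕ)
    (ho : o ≤ 1)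
    (hD : ∀ c ∈ Icc 0 t, IntervalIntegrable (fun σ => D σ c) volume 0 t)
    (hβ : IntervalIntegrable β volume 0 t)
    (hb : ∀ᵐ σ, σ ∈ Ioc 0 t → ∀ c ∈ Icc 0 t, |D σ c| ≤ β σ)
    (hc : ∀ᵐ σ, σ ∈ Ioc 0 t → ContinuousOn (D σ) (Icc 0 t)) :
    IntervalIntegrable (fun σ => D σ σ) volume 0 t ∧
    Tendsto (fun n : ℕ => ∑ i ∈ Finset.range (n + 1),
      ∫ σ in (i * t / (n + 1) : ℝ)..((i + 1 : ℕ) * t / (n + 1) : ℝ),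
        D σ ((i + o : ℕ) * t / (n + 1))) atTop (𝓝 (∫ σ in (0 : ℝ)..t, D σ σ)) := by
  set a : ℕ → ℕ → ℝ := fun n i => i * t / (n + 1) with ha
  -- the node associated with `σ ∈ (a n i, a n (i + 1)]` is `a n (i + o)`
  set c : ℕ → ℝ → ℝ := fun n σ => a n (⌈σ * (n + 1) / t⌉₊ - 1 + o) with hcdef
  have ha0 : ∀ n, a n 0 = 0 := fun n => by simp [ha]
  have hat : ∀ n, a n (n + 1) = t := fun n => by simp only [ha]; push_cast; field_simp
  have hmono : ∀ n, Monotone (a n) := by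
    intro n i k hik
    simp only [ha]
    have : (i : ℝ) ≤ k := by exact_mod_cast hik
    gcongr
  have hmem : ∀ n i, i ≤ n + 1 → a n i ∈ Icc 0 t := fun n i hi =>
    ⟨by simp only [ha]; positivity, (hmono n hi).trans_eq (hat n)⟩
  have hceil : ∀ n i σ, σ ∈ Ioc (a n i) (a n (i + 1)) → c n σ = a n (i + o) := by
    intro n i σ hσ
    have : ⌈σ * (n + 1) / t⌉₊ = i + 1 := by
      rw [Nat.ceil_eq_iff (by omega)]
      have h1 := hσ.1
      have h2 := hσ.2
      simp only [ha] at h1 h2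
      rw [div_lt_iff₀ (by positivity)] at h1
      rw [le_div_iff₀ (by positivity)] at h2
      constructor
      · rw [lt_div_iff₀ ht]; simpa using h1
      · rw [div_le_iff₀ ht]; exact h2
    simp only [hcdef, this, Nat.add_sub_cancel]
  have hcmem : ∀ n σ, σ ∈ Ioc 0 t → c n σ ∈ Icc 0 t ∧ |c n σ - σ| ≤ t / (n + 1) := by
    intro n σ hσ
    have hpos : 0 < σ * (n + 1) / t := by have := hσ.1; positivity
    obtain ⟨i, hi⟩ : ∃ i, ⌈σ * (n + 1) / t⌉₊ = i + 1 :=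
      Nat.exists_eq_succ_of_ne_zero (by have := Nat.ceil_pos.2 hpos; omega)
    have hi' := (Nat.ceil_eq_iff (by omega)).1 hi
    obtain ⟨h1, h2⟩ := hi'
    have hi1 : i ≤ n := by
      have : ⌈σ * (n + 1) / t⌉₊ ≤ n + 1 := by
        rw [Nat.ceil_le, div_le_iff₀ ht]; push_cast
        have := hσ.2; nlinarith
      omega
    have hin : σ ∈ Ioc (a n i) (a n (i + 1)) := by
      simp only [ha]
      constructor
      · rw [div_lt_iff₀ (by positivity)]; rw [lt_div_iff₀ ht] at h1; simpa using h1
      · rw [le_div_iff₀ (by positivity)]; rw [div_le_iff₀ ht] at h2; exact h2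
    rw [hceil n i σ hin]
    refine ⟨hmem n _ (by omega), ?_⟩
    have hd : a n (i + 1) - a n i = t / (n + 1) := by simp only [ha]; push_cast; field_simp; ring
    have h3 : a n (i + o) ∈ Icc (a n i) (a n (i + 1)) :=
      ⟨hmono n (by omega), hmono n (by omega)⟩
    rw [abs_le]; constructor <;> linarith [hin.1, hin.2, h3.1, h3.2]
  have hclim : ∀ σ ∈ Ioc 0 t, Tendsto (fun n => c n σ) atTop (𝓝 σ) := by
    intro σ hσ
    rw [tendsto_iff_dist_tendsto_zero]
    refine squeeze_zero (fun _ => dist_nonneg) (fun n => (hcmem n σ hσ).2) ?_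
    have := tendsto_one_div_add_atTop_nhds_zero_nat.const_mul t
    simpa [mul_one_div, div_eq_mul_inv] using this
  have hpiece : ∀ n i, i < n + 1 →
      EqOn (fun σ => D σ (c n σ)) (fun σ => D σ (a n (i + o))) (uIoc (a n i) (a n (i + 1))) := by
    intro n i hi σ hσ
    rw [uIoc_of_le (hmono n (Nat.le_succ i))] at hσ
    simp only [hceil n i σ hσ]
  have hintp : ∀ n i, i < n + 1 →
      IntervalIntegrable (fun σ => D σ (c n σ)) volume (a n i) (a n (i + 1)) := by
    intro n i hi
    refine IntervalIntegrable.congr (hpiece n i hi).symm ?_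
    refine (hD _ (hmem n _ (by omega))).mono_set ?_
    rw [uIcc_of_le (hmono n (Nat.le_succ i)), uIcc_of_le ht.le]
    exact Icc_subset_Icc (hmem n i hi.le).1 (hmem n (i + 1) hi).2
  have hF : ∀ n, IntervalIntegrable (fun σ => D σ (c n σ)) volume 0 t := by
    intro n
    have := IntervalIntegrable.trans_iterate (a := a n) (n := n + 1) (hintp n)
    rwa [ha0, hat] at this
  have hsum : ∀ n : ℕ, ∑ i ∈ Finset.range (n + 1), ∫ σ in (a n i)..(a n (i + 1)),
      D σ (a n (i + o)) = ∫ σ in (0 : ℝ)..t, D σ (c n σ) := by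
    intro n
    have := intervalIntegral.sum_integral_adjacent_intervals (a := a n) (n := n + 1) (hintp n)
    rw [ha0, hat] at this
    rw [← this]
    refine Finset.sum_congr rfl fun i hi => ?_
    exact intervalIntegral.integral_congr_ae (Eventually.of_forall
      fun σ hσ => (hpiece n i (Finset.mem_range.1 hi) hσ).symm)
  have hlim : ∀ᵐ σ, σ ∈ Ioc 0 t → Tendsto (fun n => D σ (c n σ)) atTop (𝓝 (D σ σ)) := by
    filter_upwards [hc] with σ h hσ
    have h1 := (h hσ) σ ⟨hσ.1.le, hσ.2⟩
    refine h1.tendsto.comp ?_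
    exact tendsto_nhdsWithin_iff.2
      ⟨hclim σ hσ, Eventually.of_forall fun n => (hcmem n σ hσ).1⟩
  rw [intervalIntegrable_iff_integrableOn_Ioc_of_le ht.le] at hβ ⊢
  have hFm : ∀ n, AEStronglyMeasurable (fun σ => D σ (c n σ)) (volume.restrict (Ioc 0 t)) :=
    fun n => ((intervalIntegrable_iff_integrableOn_Ioc_of_le ht.le).1 (hF n)).1
  constructor
  · refine Integrable.mono' hβ (aestronglyMeasurable_of_tendsto_ae atTop hFm
      ((ae_restrict_iff' measurableSet_Ioc).2 hlim)) ?_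
    rw [ae_restrict_iff' measurableSet_Ioc]
    filter_upwards [hb] with σ h hσ
    exact h hσ σ ⟨hσ.1.le, hσ.2⟩
  · simp only [ha] at hsum
    simp_rw [hsum]
    refine intervalIntegral.tendsto_integral_filter_of_dominated_convergence β ?_ ?_
      ((intervalIntegrable_iff_integrableOn_Ioc_of_le ht.le).2 hβ) ?_
    · rw [uIoc_of_le ht.le]; exact Eventually.of_forall hFm
    · rw [uIoc_of_le ht.le]
      refine Eventually.of_forall fun n => ?_
      filter_upwards [hb] with σ h hσ
      exact h hσ _ (hcmem n σ hσ).1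
    · rw [uIoc_of_le ht.le]; exact hlim

/-- If both partial increments of `P` are integrals of densities `D σ c`, `e σ c` which are
continuous in the frozen variable, then the diagonal `P σ σ` has density `D σ σ + e σ σ`. This
replaces the Lions–Magenes lemma: it needs no differentiability of `P`. -/
theorem diagonal_integral_eq_sub {t : ℝ} (ht : 0 ≤ t) {P D e : ℝ → ℝ → ℝ} {β : ℝ → ℝ}
    (hP1 : ∀ b ∈ Icc 0 t, ∀ c ∈ Icc 0 t, P b c - P 0 c = ∫ σ in (0 : ℝ)..b, D σ c)
    (hP2 : ∀ b ∈ Icc 0 t, ∀ c ∈ Icc 0 t, P c b - P c 0 = ∫ σ in (0 : ℝ)..b, e σ c)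
    (hD : ∀ c ∈ Icc 0 t, IntervalIntegrable (fun σ => D σ c) volume 0 t)
    (he : ∀ c ∈ Icc 0 t, IntervalIntegrable (fun σ => e σ c) volume 0 t)
    (hβ : IntervalIntegrable β volume 0 t)
    (hDb : ∀ᵐ σ, σ ∈ Ioc 0 t → ∀ c ∈ Icc 0 t, |D σ c| ≤ β σ)
    (heb : ∀ᵐ σ, σ ∈ Ioc 0 t → ∀ c ∈ Icc 0 t, |e σ c| ≤ β σ)
    (hDc : ∀ᵐ σ, σ ∈ Ioc 0 t → ContinuousOn (D σ) (Icc 0 t))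
    (hec : ∀ᵐ σ, σ ∈ Ioc 0 t → ContinuousOn (e σ) (Icc 0 t)) :
    IntervalIntegrable (fun σ => D σ σ + e σ σ) volume 0 t ∧
      P t t - P 0 0 = ∫ σ in (0 : ℝ)..t, (D σ σ + e σ σ) := by
  rcases ht.eq_or_lt with rfl | ht
  · simp
  obtain ⟨i1, l1⟩ := tendsto_sum_integral_diag ht 1 le_rfl hD hβ hDb hDc
  obtain ⟨i2, l2⟩ := tendsto_sum_integral_diag ht 0 zero_le_one he hβ heb hec
  refine ⟨i1.add i2, ?_⟩
  rw [intervalIntegral.integral_add i1 i2]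
  refine tendsto_nhds_unique ?_ (l1.add l2)
  refine tendsto_const_nhds.congr fun n => ?_
  have hmem : ∀ i : ℕ, i ≤ n + 1 → (i * t / (n + 1) : ℝ) ∈ Icc 0 t := by
    intro i hi
    refine ⟨by positivity, ?_⟩
    rw [div_le_iff₀ (by positivity)]
    have : (i : ℝ) ≤ n + 1 := by exact_mod_cast hi
    nlinarith
  have hsub : ∀ {F : ℝ → ℝ}, IntervalIntegrable F volume 0 t → ∀ b ∈ Icc 0 t,
      IntervalIntegrable F volume 0 b := fun hF b hb =>
    hF.mono_set (by rw [uIcc_of_le hb.1, uIcc_of_le ht.le]; exact Icc_subset_Icc le_rfl hb.2)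
  rw [← Finset.sum_add_distrib]
  -- over one part, the first variable moves with the second at the right endpoint, and then the
  -- second moves with the first at the left endpoint
  have key : ∀ i ∈ Finset.range (n + 1),
      (∫ σ in (i * t / (n + 1) : ℝ)..((i + 1 : ℕ) * t / (n + 1) : ℝ),
        D σ ((i + 1 : ℕ) * t / (n + 1))) +
      (∫ σ in (i * t / (n + 1) : ℝ)..((i + 1 : ℕ) * t / (n + 1) : ℝ),
        e σ ((i + 0 : ℕ) * t / (n + 1))) =
      P ((i + 1 : ℕ) * t / (n + 1)) ((i + 1 : ℕ) * t / (n + 1)) -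
        P (i * t / (n + 1)) (i * t / (n + 1)) := by
    intro i hi
    have hi := Finset.mem_range.1 hi
    have m0 := hmem i (by omega)
    have m1 := hmem (i + 1) (by omega)
    rw [← intervalIntegral.integral_interval_sub_left (hsub (hD _ m1) _ m1) (hsub (hD _ m1) _ m0),
      ← hP1 _ m1 _ m1, ← hP1 _ m0 _ m1, add_zero,
      ← intervalIntegral.integral_interval_sub_left (hsub (he _ m0) _ m1) (hsub (he _ m0) _ m0),
      ← hP2 _ m1 _ m0, ← hP2 _ m0 _ m0]
    ring
  rw [Finset.sum_congr rfl key, Finset.sum_range_sub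
    (fun i : ℕ => P (i * t / (n + 1)) (i * t / (n + 1)))]
  have : ((n + 1 : ℕ) : ℝ) * t / (n + 1) = t := by push_cast; field_simp
  rw [this]; simp

/-- Continuity of a function which is the indefinite integral of `A` on `[0, t]`. -/
theorem continuousOn_of_sub_eq_integral {t : ℝ} {α A : ℝ → ℝ}
    (hA : IntervalIntegrable A volume 0 t)
    (hα : ∀ b ∈ Icc 0 t, α b - α 0 = ∫ σ in (0 : ℝ)..b, A σ) : ContinuousOn α (Icc 0 t) := by
  rcases lt_or_ge t 0 with h | ht
  · simp [Icc_eq_empty h.not_ge]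
  have h1 : ContinuousOn (fun b => α 0 + ∫ σ in (0 : ℝ)..b, A σ) (Icc 0 t) :=
    continuousOn_const.add (by
      have := intervalIntegral.continuousOn_primitive_interval
        (f := A) (μ := volume) (a := 0) (b := t) (by
          rw [uIcc_of_le ht]
          exact (intervalIntegrable_iff_integrableOn_Icc_of_le ht).1 hA)
      rwa [uIcc_of_le ht] at this)
  exact h1.congr fun b hb => by simp only; linarith [hα b hb]

/-- Product rule for absolutely continuous functions. -/
theorem product_rule_integral {t : ℝ} (ht : 0 ≤ t) {α γ A G : ℝ → ℝ}
    (hA : IntervalIntegrable A volume 0 t) (hG : IntervalIntegrable G volume 0 t)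
    (hα : ∀ b ∈ Icc 0 t, α b - α 0 = ∫ σ in (0 : ℝ)..b, A σ)
    (hγ : ∀ b ∈ Icc 0 t, γ b - γ 0 = ∫ σ in (0 : ℝ)..b, G σ) :
    IntervalIntegrable (fun σ => A σ * γ σ + α σ * G σ) volume 0 t ∧
      α t * γ t - α 0 * γ 0 = ∫ σ in (0 : ℝ)..t, (A σ * γ σ + α σ * G σ) := by
  have cα := continuousOn_of_sub_eq_integral hA hα
  have cγ := continuousOn_of_sub_eq_integral hG hγ
  obtain ⟨M, hM⟩ := isCompact_Icc.exists_bound_of_continuousOn cα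
  obtain ⟨K, hK⟩ := isCompact_Icc.exists_bound_of_continuousOn cγ
  have hM0 : 0 ≤ M := (norm_nonneg _).trans (hM 0 ⟨le_rfl, ht⟩)
  have hK0 : 0 ≤ K := (norm_nonneg _).trans (hK 0 ⟨le_rfl, ht⟩)
  refine diagonal_integral_eq_sub ht (P := fun a c => α a * γ c) (D := fun σ c => A σ * γ c)
    (e := fun σ c => α c * G σ) (β := fun σ => |A σ| * K + M * |G σ|) ?_ ?_ ?_ ?_ ?_ ?_ ?_ ?_ ?_
  · intro b hb c _
    rw [intervalIntegral.integral_mul_const, ← hα b hb]; ring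
  · intro b hb c _
    rw [intervalIntegral.integral_const_mul, ← hγ b hb]; ring
  · exact fun c _ => hA.mul_const _
  · exact fun c _ => hG.const_mul _
  · exact (hA.abs.mul_const K).add (hG.abs.const_mul M)
  · refine Eventually.of_forall fun σ _ c hc => ?_
    rw [abs_mul]
    have := hK c hc
    rw [Real.norm_eq_abs] at this
    nlinarith [abs_nonneg (A σ), abs_nonneg (G σ), mul_nonneg hM0 (abs_nonneg (G σ)),
      mul_le_mul_of_nonneg_left this (abs_nonneg (A σ))]
  · refine Eventually.of_forall fun σ _ c hc => ?_
    rw [abs_mul]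
    have := hM c hc
    rw [Real.norm_eq_abs] at this
    nlinarith [abs_nonneg (A σ), abs_nonneg (G σ), mul_nonneg hK0 (abs_nonneg (A σ)),
      mul_le_mul_of_nonneg_right this (abs_nonneg (G σ))]
  · exact Eventually.of_forall fun σ _ => continuousOn_const.mul cγ
  · exact Eventually.of_forall fun σ _ => cα.mul continuousOn_const

/-- Grönwall's inequality for an absolutely continuous `φ`, keeping the dissipated quantity `α`. -/
theorem gronwall_dissipation {t C : ℝ} (ht : 0 ≤ t) {φ ψ α : ℝ → ℝ}
    (hψ : IntervalIntegrable ψ volume 0 t)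
    (hα : IntervalIntegrable α volume 0 t)
    (hφ : ∀ b ∈ Icc 0 t, φ b - φ 0 = ∫ σ in (0 : ℝ)..b, ψ σ)
    (hle : ∀ᵐ σ, σ ∈ Ioc 0 t → ψ σ ≤ 2 * C * φ σ - α σ) :
    Real.exp (-(2 * C) * t) * φ t + ∫ σ in (0 : ℝ)..t, Real.exp (-(2 * C) * σ) * α σ ≤ φ 0 := by
  have hE : ∀ σ : ℝ, HasDerivAt (fun σ => Real.exp (-(2 * C) * σ))
      (-(2 * C) * Real.exp (-(2 * C) * σ)) σ := fun σ => by
    have := ((hasDerivAt_id σ).const_mul (-(2 * C))).exp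
    simpa [mul_comm] using this
  have hEc : Continuous fun σ : ℝ => -(2 * C) * Real.exp (-(2 * C) * σ) := by fun_prop
  have h0 := product_rule_integral ht (α := fun σ => Real.exp (-(2 * C) * σ)) (γ := φ)
    (A := fun σ => -(2 * C) * Real.exp (-(2 * C) * σ)) (G := ψ)
    (hEc.intervalIntegrable _ _) hψ
    (fun b _ => (intervalIntegral.integral_eq_sub_of_hasDerivAt (fun σ _ => hE σ)
      (hEc.intervalIntegrable _ _)).symm) hφ
  obtain ⟨hi, h⟩ := h0
  have hαi : IntervalIntegrable (fun σ => Real.exp (-(2 * C) * σ) * α σ) volume 0 t :=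
    hα.continuousOn_mul (by fun_prop)
  have : ∫ σ in (0 : ℝ)..t, (-(2 * C) * Real.exp (-(2 * C) * σ) * φ σ
      + Real.exp (-(2 * C) * σ) * ψ σ) ≤ ∫ σ in (0 : ℝ)..t, -(Real.exp (-(2 * C) * σ) * α σ) := by
    refine intervalIntegral.integral_mono_ae_restrict ht hi hαi.neg ?_
    rw [← restrict_Ioc_eq_restrict_Icc]
    refine (ae_restrict_iff' measurableSet_Ioc).2 ?_
    filter_upwards [hle] with σ h1 hσ
    have := mul_le_mul_of_nonneg_left (h1 hσ) (Real.exp_pos (-(2 * C) * σ)).le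
    linarith
  rw [intervalIntegral.integral_neg] at this
  simp only [mul_zero, Real.exp_zero, one_mul] at h
  linarith

end

section

theorem exists_Icc_of_isCompact_subset_Ioi {K : Set ℝ} (hK : IsCompact K) (h : K ⊆ Ioi 0) :
    ∃ a b : ℝ, 0 < a ∧ a ≤ b ∧ K ⊆ Icc a b := by
  have hc : IsCompact (insert 1 K) := hK.insert 1
  obtain ⟨a, ha, ha'⟩ := hc.exists_isLeast ⟨1, mem_insert _ _⟩
  obtain ⟨b, -, hb'⟩ := hc.exists_isGreatest ⟨1, mem_insert _ _⟩
  refine ⟨a, b, ?_, hb' ha,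
    fun x hx => ⟨ha' (mem_insert_of_mem _ hx), hb' (mem_insert_of_mem _ hx)⟩⟩
  rcases ha with rfl | ha
  · exact one_pos
  · exact h ha

theorem integral_Ioi_eq_intervalIntegral {F : ℝ → ℝ} {b : ℝ} (hb : 0 ≤ b)
    (hF : ∀ t, b < t → F t = 0) : ∫ t in Ioi 0, F t = ∫ t in (0 : ℝ)..b, F t := by
  rw [intervalIntegral.integral_of_le hb]
  refine (setIntegral_eq_of_subset_of_forall_sdiff_eq_zero measurableSet_Ioi
    Ioc_subset_Ioi_self fun t ht => hF t ?_)
  by_contra hcon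
  exact ht.2 ⟨ht.1, not_lt.1 hcon⟩

/-- An absolutely continuous function has its density as distributional derivative. -/
theorem integral_deriv_mul_of_sub_eq_integral {y h : ℝ → ℝ}
    (hh : ∀ T, 0 ≤ T → IntervalIntegrable h volume 0 T)
    (hy : ∀ t, 0 ≤ t → y t - y 0 = ∫ σ in (0 : ℝ)..t, h σ)
    {ψ : ℝ → ℝ} (hψ : ContDiff ℝ ∞ ψ) (hc : HasCompactSupport ψ) (hs : tsupport ψ ⊆ Ioi 0) :
    ∫ t in Ioi 0, deriv ψ t * y t = - ∫ t in Ioi 0, ψ t * h t := by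
  obtain ⟨a, b, ha, hab, hK⟩ := exists_Icc_of_isCompact_subset_Ioi hc hs
  have hb : 0 ≤ b + 1 := by linarith
  have z1 : ∀ t, b < t → ψ t = 0 := fun t ht =>
    image_eq_zero_of_notMem_tsupport fun h => by linarith [(hK h).2]
  have z0 : ψ 0 = 0 := image_eq_zero_of_notMem_tsupport fun h => by linarith [(hK h).1]
  have z2 : ∀ t, b < t → deriv ψ t = 0 := fun t ht =>
    image_eq_zero_of_notMem_tsupport fun h => by
      linarith [(hK (tsupport_deriv_subset (𝕜 := ℝ) h)).2]
  rw [integral_Ioi_eq_intervalIntegral (b := b + 1) hb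
      (fun t ht => by rw [z2 t (by linarith), zero_mul]),
    integral_Ioi_eq_intervalIntegral (b := b + 1) hb
      (fun t ht => by rw [z1 t (by linarith), zero_mul])]
  have hd : Continuous (deriv ψ) := hψ.continuous_deriv (by simp)
  have hyb : ∀ t ∈ Icc 0 (b + 1), y t - y 0 = ∫ σ in (0 : ℝ)..t, h σ := fun t ht => hy t ht.1
  obtain ⟨hi, he⟩ := product_rule_integral hb (α := ψ) (γ := y) (A := deriv ψ) (G := h)
    (hd.intervalIntegrable _ _) (hh _ hb)
    (fun t _ => (intervalIntegral.integral_deriv_eq_sub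
      (fun x _ => hψ.differentiable (by simp) x) (hd.intervalIntegrable _ _)).symm) hyb
  have hyc : ContinuousOn y (uIcc 0 (b + 1)) := by
    rw [uIcc_of_le hb]; exact continuousOn_of_sub_eq_integral (hh _ hb) hyb
  rw [intervalIntegral.integral_add ((hd.intervalIntegrable _ _).mul_continuousOn hyc)
    ((hh _ hb).continuousOn_mul hψ.continuous.continuousOn), z0, z1 (b + 1) (by linarith)] at he
  linarith

/-- A continuous function on `[0, ∞)` with vanishing distributional derivative in `(0, ∞)` is
constant. -/
theorem eqOn_const_of_integral_deriv_mul_eq_zero {Y : ℝ → ℝ} (hY : ContinuousOn Y (Ici 0))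
    (h : ∀ ψ : ℝ → ℝ, ContDiff ℝ ∞ ψ → HasCompactSupport ψ → tsupport ψ ⊆ Ioi 0 →
      ∫ t in Ioi 0, deriv ψ t * Y t = 0) : ∀ t, 0 ≤ t → Y t = Y 0 := by
  obtain ⟨φ₀, hφt, hφc, hφs, hφr, hφ1⟩ := exists_contDiff_tsupport_subset (E := ℝ) (n := (⊤ : ℕ∞))
    (s := Ioi 0) (x := 1) (Ioi_mem_nhds one_pos)
  have hi0 : 0 < ∫ t, φ₀ t := by
    refine hφs.continuous.integral_pos_of_hasCompactSupport_nonneg_nonzero hφc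
      (fun t => (hφr ⟨t, rfl⟩).1) (x := 1) (by rw [hφ1]; exact one_ne_zero)
  set I₀ := ∫ t, φ₀ t
  have hint : ∀ φ : ℝ → ℝ, ContDiff ℝ ∞ φ → HasCompactSupport φ → tsupport φ ⊆ Ioi 0 →
      IntegrableOn (fun t => φ t * Y t) (Ioi 0) := by
    intro φ hφ hc hs
    obtain ⟨a, b, ha, hab, hK⟩ := exists_Icc_of_isCompact_subset_Ioi hc hs
    have h1 : IntegrableOn (fun t => φ t * Y t) (Icc a b) :=
      (hφ.continuous.continuousOn.mul
        (hY.mono fun t ht => ha.le.trans ht.1)).integrableOn_Icc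
    refine h1.of_forall_sdiff_eq_zero measurableSet_Ioi fun t ht => ?_
    rw [image_eq_zero_of_notMem_tsupport fun h => ht.2 (hK h), zero_mul]
  -- `φ - k φ₀` has mean zero, hence is the derivative of a test function
  set c := (∫ t in Ioi 0, φ₀ t * Y t) / I₀
  have hzero : ∀ φ : ℝ → ℝ, ContDiff ℝ ∞ φ → HasCompactSupport φ → tsupport φ ⊆ Ioi 0 →
      ∫ t in Ioi 0, φ t * Y t = c * ∫ t, φ t := by
    intro φ hφ hc hs
    set k := (∫ t, φ t) / I₀
    set θ : ℝ → ℝ := fun t => φ t - k * φ₀ t with hθ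
    have hθs : ContDiff ℝ ∞ θ := hφ.sub (contDiff_const.mul hφs)
    have hθi : ∫ t, θ t = 0 := by
      rw [integral_sub (hφ.continuous.integrable_of_hasCompactSupport hc)
        ((hφs.continuous.integrable_of_hasCompactSupport hφc).const_mul k), integral_const_mul]
      have : k * I₀ = ∫ t, φ t := div_mul_cancel₀ _ hi0.ne'
      linarith
    obtain ⟨a, b, ha, hab, hK⟩ := exists_Icc_of_isCompact_subset_Ioi
      (hc.isCompact.union hφc.isCompact) (union_subset hs hφt)
    have hθ0 : ∀ t, t ∉ Icc a b → θ t = 0 := by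
      intro t ht
      simp only [hθ]
      rw [image_eq_zero_of_notMem_tsupport fun h => ht (hK (Or.inl h)),
        image_eq_zero_of_notMem_tsupport fun h => ht (hK (Or.inr h)), mul_zero, sub_zero]
    set ψ : ℝ → ℝ := fun t => ∫ σ in (0 : ℝ)..t, θ σ with hψ
    have hd : ∀ t, HasDerivAt ψ (θ t) t := fun t =>
      intervalIntegral.integral_hasDerivAt_right (hθs.continuous.intervalIntegrable _ _)
        (hθs.continuous.stronglyMeasurableAtFilter _ _) hθs.continuous.continuousAt
    have hdψ : deriv ψ = θ := funext fun t => (hd t).deriv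
    have hψs : ContDiff ℝ ∞ ψ := by
      rw [contDiff_infty_iff_deriv]
      exact ⟨fun t => (hd t).differentiableAt, hdψ ▸ hθs⟩
    have hψ0 : ∀ t, t ∉ Icc a b → ψ t = 0 := by
      intro t ht
      rcases lt_or_ge t a with h1 | h1
      · refine intervalIntegral.integral_zero_ae (Eventually.of_forall fun σ hσ => hθ0 σ ?_)
        intro h2
        rcases le_total 0 t with h3 | h3
        · rw [uIoc_of_le h3] at hσ; linarith [hσ.2, h2.1]
        · rw [uIoc_of_ge h3] at hσ; linarith [hσ.2, h2.1]
      · have h2 : b < t := by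
          by_contra h3; exact ht ⟨h1, not_lt.1 h3⟩
        have h4 : 0 ≤ t := by linarith
        rw [← hθi]
        simp only [hψ]
        rw [intervalIntegral.integral_of_le h4]
        refine setIntegral_eq_integral_of_forall_compl_eq_zero fun σ hσ => hθ0 σ fun h5 => ?_
        exact hσ ⟨by linarith [h5.1], by linarith [h5.2]⟩
    have h1 := h ψ hψs (HasCompactSupport.intro isCompact_Icc hψ0) (by
      refine (closure_minimal (s := Function.support ψ) (t := Icc a b) ?_ isClosed_Icc).trans
        fun t ht => ha.trans_le ht.1
      intro t ht
      by_contra h6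
      exact ht (hψ0 t h6))
    rw [hdψ] at h1
    simp only [hθ, sub_mul] at h1
    rw [integral_sub (hint φ hφ hc hs)
      (by simpa only [mul_assoc] using (hint φ₀ hφs hφc hφt).const_mul k)] at h1
    simp only [mul_assoc] at h1
    rw [integral_const_mul] at h1
    have : c * ∫ t, φ t = k * ∫ t in Ioi 0, φ₀ t * Y t := by
      simp only [c, k]; field_simp
    linarith
  have hae : ∀ᵐ t, t ∈ Ioi (0 : ℝ) → (Y t - c) = 0 := by
    have hYo : ContinuousOn (fun t => Y t - c) (Ioi 0) :=
      (hY.mono Ioi_subset_Ici_self).sub continuousOn_const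
    have hm := (isOpen_Ioi (a := (0 : ℝ))).ae_eq_zero_of_integral_contDiff_smul_eq_zero
      (f := (Ioi (0 : ℝ)).indicator fun t => Y t - c) (μ := volume) ?_ ?_
    · filter_upwards [hm] with t ht h0
      have := ht h0
      rwa [indicator_of_mem h0] at this
    · refine (hYo.congr fun t ht => ?_).locallyIntegrableOn measurableSet_Ioi
      rw [indicator_of_mem ht]
    · intro φ hφ hc hs
      have h1 : ∀ t, φ t • (Ioi (0 : ℝ)).indicator (fun t => Y t - c) t
          = (Ioi (0 : ℝ)).indicator (fun t => φ t * Y t - c * φ t) t := by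
        intro t
        by_cases ht : t ∈ Ioi (0 : ℝ)
        · rw [indicator_of_mem ht, indicator_of_mem ht, smul_eq_mul]; ring
        · rw [indicator_of_notMem ht, indicator_of_notMem ht, smul_zero]
      simp_rw [h1]
      rw [integral_indicator measurableSet_Ioi, integral_sub (hint φ hφ hc hs)
        ((hφ.continuous.integrable_of_hasCompactSupport hc).const_mul c).integrableOn,
        integral_const_mul, hzero φ hφ hc hs,
        setIntegral_eq_integral_of_forall_compl_eq_zero (s := Ioi 0) (f := φ), sub_self]
      intro t ht
      exact image_eq_zero_of_notMem_tsupport fun h => ht (hs h)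
  have hcl : EqOn Y (fun _ => c) (Ici 0) := by
    have h1 : EqOn Y (fun _ => c) (Ioi 0) := by
      refine Measure.eqOn_open_of_ae_eq (μ := volume) ?_ isOpen_Ioi
        (hY.mono Ioi_subset_Ici_self) continuousOn_const
      refine (ae_restrict_iff' measurableSet_Ioi).2 ?_
      filter_upwards [hae] with t ht h0
      exact sub_eq_zero.1 (ht h0)
    have h2 : Ici (0 : ℝ) ⊆ closure (Ioi 0) := by rw [closure_Ioi]
    exact h1.of_subset_closure hY continuousOn_const Ioi_subset_Ici_self h2
  intro t ht
  rw [hcl ht, hcl (le_refl (0 : ℝ))]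

/-- The du Bois-Reymond lemma, up to the initial time. -/
theorem sub_eq_integral_of_integral_deriv_mul {y h : ℝ → ℝ} (hy : ContinuousOn y (Ici 0))
    (hh : ∀ T, 0 ≤ T → IntervalIntegrable h volume 0 T)
    (hd : ∀ ψ : ℝ → ℝ, ContDiff ℝ ∞ ψ → HasCompactSupport ψ → tsupport ψ ⊆ Ioi 0 →
      ∫ t in Ioi 0, deriv ψ t * y t = - ∫ t in Ioi 0, ψ t * h t) :
    ∀ t, 0 ≤ t → y t - y 0 = ∫ σ in (0 : ℝ)..t, h σ := by
  -- `y` minus a primitive of `h` has vanishing distributional derivative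
  set η : ℝ → ℝ := fun t => ∫ σ in (0 : ℝ)..t, h σ with hη
  have hη0 : η 0 = 0 := by simp [hη]
  have hηc : ContinuousOn η (Ici 0) := by
    intro t ht
    have h1 : ContinuousOn η (Icc 0 (t + 1)) :=
      continuousOn_of_sub_eq_integral (hh (t + 1) (by linarith [mem_Ici.1 ht]))
        (fun b _ => by rw [hη0, sub_zero])
    refine (h1 t ⟨ht, by linarith⟩).mono_of_mem_nhdsWithin ?_
    rw [mem_nhdsWithin]
    exact ⟨Iio (t + 1), isOpen_Iio, by simp, fun x hx => ⟨hx.2, (mem_Iio.1 hx.1).le⟩⟩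
  have hint : ∀ (Z : ℝ → ℝ), ContinuousOn Z (Ici 0) → ∀ ψ : ℝ → ℝ, ContDiff ℝ ∞ ψ →
      HasCompactSupport ψ → tsupport ψ ⊆ Ioi 0 →
      IntegrableOn (fun t => deriv ψ t * Z t) (Ioi 0) := by
    intro Z hZ ψ hψ hc hs
    obtain ⟨a, b, ha, hab, hK⟩ := exists_Icc_of_isCompact_subset_Ioi hc hs
    have h1 : IntegrableOn (fun t => deriv ψ t * Z t) (Icc a b) :=
      ((hψ.continuous_deriv (by simp)).continuousOn.mul
        (hZ.mono fun t ht => ha.le.trans ht.1)).integrableOn_Icc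
    refine h1.of_forall_sdiff_eq_zero measurableSet_Ioi fun t ht => ?_
    rw [image_eq_zero_of_notMem_tsupport fun h =>
      ht.2 (hK (tsupport_deriv_subset (𝕜 := ℝ) h)), zero_mul]
  intro t ht
  have := eqOn_const_of_integral_deriv_mul_eq_zero (Y := fun t => y t - η t) (hy.sub hηc) ?_ t ht
  · simp only [hη0, sub_zero] at this
    simp only [hη] at this
    linarith
  · intro ψ hψ hc hs
    simp only [mul_sub]
    rw [integral_sub (hint y hy ψ hψ hc hs) (hint η hηc ψ hψ hc hs), hd ψ hψ hc hs,
      integral_deriv_mul_of_sub_eq_integral (y := η) hh (fun t _ => by rw [hη0, sub_zero]) hψ hc hs,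
      sub_self]

end

section

/-! ### Ordinary differential equations in Banach and Hilbert spaces -/

theorem norm_integral_le_of_norm_le_mul_exp {F : Type*} [NormedAddCommGroup F] [NormedSpace ℝ F]
    {G : ℝ → F} {A κ t : ℝ} (hκ : 0 < κ) (hA : 0 ≤ A) (ht : 0 ≤ t)
    (h : ∀ s ∈ Ioc 0 t, ‖G s‖ ≤ A * Real.exp (κ * s)) :
    ‖∫ s in (0 : ℝ)..t, G s‖ ≤ A / κ * Real.exp (κ * t) := by
  have h1 : ‖∫ s in (0 : ℝ)..t, G s‖ ≤ ∫ s in (0 : ℝ)..t, A * Real.exp (κ * s) :=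
    intervalIntegral.norm_integral_le_of_norm_le ht (Eventually.of_forall h)
      (Continuous.intervalIntegrable (by fun_prop) _ _)
  have h2 : ∫ s in (0 : ℝ)..t, A * Real.exp (κ * s) =
      A / κ * Real.exp (κ * t) - A / κ * Real.exp (κ * 0) := by
    refine intervalIntegral.integral_eq_sub_of_hasDerivAt (f := fun s => A / κ * Real.exp (κ * s))
      (fun s _ => ?_)
      (Continuous.intervalIntegrable (by fun_prop) _ _)
    have := (((hasDerivAt_id s).const_mul κ).exp).const_mul (A / κ)
    refine this.congr_deriv ?_
    change A / κ * (Real.exp (κ * s) * (κ * 1)) = A * Real.exp (κ * s)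
    field_simp
  have h3 : 0 ≤ A / κ * Real.exp (κ * 0) := by positivity
  linarith

/-- Picard's theorem for a globally Lipschitz field: solutions exist for all positive times. The
Picard operator is a contraction for an exponentially weighted supremum norm. -/
theorem exists_forall_hasDerivAt_of_lipschitzWith {F : Type*} [NormedAddCommGroup F]
    [NormedSpace ℝ F] [CompleteSpace F] {f : F → F} {K : NNReal} (hf : LipschitzWith K f) (x : F) :
    ∃ u : ℝ → F, u 0 = x ∧ ∀ t, 0 ≤ t → HasDerivAt u (f (u t)) t := by
  set κ : ℝ := 2 * K + 1 with hκ
  have hκ0 : 0 < κ := by positivity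
  have hcont : ∀ y : BoundedContinuousFunction ℝ F,
      Continuous fun s => f (Real.exp (κ * s) • y s) := fun y =>
    hf.continuous.comp ((by fun_prop : Continuous fun s => Real.exp (κ * s)).smul y.continuous)
  have hbound : ∀ (y : BoundedContinuousFunction ℝ F) (s : ℝ), 0 ≤ s →
      ‖f (Real.exp (κ * s) • y s)‖ ≤ (‖f 0‖ + K * ‖y‖) * Real.exp (κ * s) := by
    intro y s hs
    have h1 := hf.norm_sub_le (Real.exp (κ * s) • y s) 0
    rw [sub_zero, norm_smul, Real.norm_eq_abs, Real.abs_exp] at h1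
    have h2 := norm_le_norm_add_norm_sub' (f (Real.exp (κ * s) • y s)) (f 0)
    have h3 : 1 ≤ Real.exp (κ * s) := Real.one_le_exp (by positivity)
    have h4 := y.norm_coe_le_norm s
    have h5 : (K : ℝ) * (Real.exp (κ * s) * ‖y s‖) ≤ K * (Real.exp (κ * s) * ‖y‖) := by gcongr
    nlinarith [norm_nonneg (f 0)]
  -- the unknown is `y t = exp (-κ t) • u t`; the operator is made constant for negative times
  set T : BoundedContinuousFunction ℝ F → BoundedContinuousFunction ℝ F := fun y =>
    BoundedContinuousFunction.ofNormedAddCommGroup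
      (fun t => Real.exp (-κ * max t 0) •
        (x + ∫ s in (0 : ℝ)..(max t 0), f (Real.exp (κ * s) • y s)))
      (by
        have h1 : Continuous fun t : ℝ => ∫ s in (0 : ℝ)..t, f (Real.exp (κ * s) • y s) :=
          intervalIntegral.continuous_primitive
            (fun a b => (hcont y).intervalIntegrable a b) 0
        have h2 : Continuous fun t : ℝ => max t 0 := by fun_prop
        exact (by fun_prop : Continuous fun t : ℝ => Real.exp (-κ * max t 0)).smul
          (continuous_const.add (h1.comp h2)))
      (‖x‖ + (‖f 0‖ + K * ‖y‖) / κ)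
      (by
        intro t
        set r := max t 0
        have hr : 0 ≤ r := le_max_right _ _
        have h1 := norm_integral_le_of_norm_le_mul_exp hκ0 (by positivity) hr
          (fun s hs => hbound y s hs.1.le)
        rw [norm_smul, Real.norm_eq_abs, Real.abs_exp]
        have h2 := norm_add_le x (∫ s in (0 : ℝ)..r, f (Real.exp (κ * s) • y s))
        have h3 : Real.exp (-κ * r) ≤ 1 := Real.exp_le_one_iff.2 (by nlinarith)
        have h4 : Real.exp (-κ * r) * Real.exp (κ * r) = 1 := by
          rw [← Real.exp_add]; simp
        calc _ ≤ Real.exp (-κ * r) *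
              (‖x‖ + (‖f 0‖ + K * ‖y‖) / κ * Real.exp (κ * r)) := by
              gcongr; exact h2.trans (by gcongr)
          _ = Real.exp (-κ * r) * ‖x‖ + (‖f 0‖ + K * ‖y‖) / κ *
              (Real.exp (-κ * r) * Real.exp (κ * r)) := by ring
          _ ≤ _ := by
              rw [h4, mul_one]
              have := mul_le_mul_of_nonneg_right h3 (norm_nonneg x)
              linarith) with hT
  have hTc : ContractingWith (1 / 2) T := by
    refine ⟨by rw [← NNReal.coe_lt_coe]; norm_num, LipschitzWith.of_dist_le_mul fun y z => ?_⟩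
    rw [BoundedContinuousFunction.dist_le (by positivity)]
    intro t
    simp only [hT, BoundedContinuousFunction.coe_ofNormedAddCommGroup]
    set r := max t 0
    have hr : 0 ≤ r := le_max_right _ _
    rw [dist_eq_norm, ← smul_sub, add_sub_add_left_eq_sub, ← intervalIntegral.integral_sub
      ((hcont y).intervalIntegrable _ _) ((hcont z).intervalIntegrable _ _), norm_smul,
      Real.norm_eq_abs, Real.abs_exp]
    have h1 := norm_integral_le_of_norm_le_mul_exp (A := K * dist y z) hκ0 (by positivity) hr
      (G := fun s => f (Real.exp (κ * s) • y s) - f (Real.exp (κ * s) • z s)) (fun s hs => by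
        have h1 := hf.norm_sub_le (Real.exp (κ * s) • y s) (Real.exp (κ * s) • z s)
        rw [← smul_sub, norm_smul, Real.norm_eq_abs, Real.abs_exp, ← dist_eq_norm (y s)] at h1
        refine h1.trans ?_
        have := BoundedContinuousFunction.dist_coe_le_dist (f := y) (g := z) s
        calc (K : ℝ) * (Real.exp (κ * s) * dist (y s) (z s))
            ≤ K * (Real.exp (κ * s) * dist y z) := by gcongr
          _ = _ := by ring)
    have h4 : Real.exp (-κ * r) * Real.exp (κ * r) = 1 := by
      rw [← Real.exp_add]; simp
    have h5 : (K : ℝ) / κ ≤ 1 / 2 := by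
      rw [div_le_div_iff₀ hκ0 (by norm_num)]; linarith
    calc _ ≤ Real.exp (-κ * r) * (K * dist y z / κ * Real.exp (κ * r)) := by gcongr
      _ = K / κ * dist y z * (Real.exp (-κ * r) * Real.exp (κ * r)) := by ring
      _ ≤ 1 / 2 * dist y z := by rw [h4, mul_one]; gcongr
      _ = _ := by simp
  set y := ContractingWith.fixedPoint T hTc with hy
  have hfix : T y = y := ContractingWith.fixedPoint_isFixedPt hTc
  set u : ℝ → F := fun t => x + ∫ s in (0 : ℝ)..t, f (Real.exp (κ * s) • y s) with hu
  have huy : ∀ t, 0 ≤ t → Real.exp (κ * t) • y t = u t := by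
    intro t ht
    have h1 : y t = Real.exp (-κ * t) • u t := by
      have := DFunLike.congr_fun hfix t
      simp only [hT, BoundedContinuousFunction.coe_ofNormedAddCommGroup, max_eq_left ht] at this
      exact this.symm
    rw [h1, smul_smul, ← Real.exp_add]; simp
  refine ⟨u, by simp [hu], fun t ht => ?_⟩
  have h1 : HasDerivAt u (f (Real.exp (κ * t) • y t)) t :=
    (intervalIntegral.integral_hasDerivAt_right ((hcont y).intervalIntegrable _ _)
      ((hcont y).stronglyMeasurableAtFilter _ _) (hcont y).continuousAt).const_add x
  rwa [huy t ht] at h1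

variable {H : Type*} [NormedAddCommGroup H] [InnerProductSpace ℝ H]

/-- Grönwall's inequality for two curves whose velocities satisfy a one-sided Lipschitz condition up
to a defect `δ`. -/
theorem norm_sub_sq_le_exp_mul {u w u' w' : ℝ → H} {C δ T : ℝ} (hC : 0 ≤ C) (hδ : 0 ≤ δ)
    (hu : ∀ t ∈ Icc 0 T, HasDerivAt u (u' t) t) (hw : ∀ t ∈ Icc 0 T, HasDerivAt w (w' t) t)
    (h : ∀ t ∈ Icc 0 T, ⟪u' t - w' t, u t - w t⟫ ≤ C * ‖u t - w t‖ ^ 2 + δ) :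
    ∀ t ∈ Icc 0 T,
      ‖u t - w t‖ ^ 2 ≤ Real.exp (2 * C * t) * (‖u 0 - w 0‖ ^ 2 + 2 * δ * t) := by
  set φ : ℝ → ℝ := fun t => Real.exp (-(2 * C) * t) * ‖u t - w t‖ ^ 2 - 2 * δ * t with hφ
  have hd : ∀ t ∈ Icc 0 T, HasDerivAt φ (-(2 * C) * Real.exp (-(2 * C) * t) * ‖u t - w t‖ ^ 2
      + Real.exp (-(2 * C) * t) * (2 * ⟪u t - w t, u' t - w' t⟫) - 2 * δ) t := by
    intro t ht
    have h1 : HasDerivAt (fun σ => Real.exp (-(2 * C) * σ))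
        (-(2 * C) * Real.exp (-(2 * C) * t)) t := by
      have := ((hasDerivAt_id t).const_mul (-(2 * C))).exp
      simpa [mul_comm] using this
    have h2 := ((hu t ht).sub (hw t ht)).norm_sq
    have h3 := (hasDerivAt_id t).const_mul (2 * δ)
    rw [mul_one] at h3
    exact (h1.mul h2).sub h3
  have hanti : AntitoneOn φ (Icc 0 T) := by
    refine antitoneOn_of_deriv_nonpos (convex_Icc 0 T)
      (fun t ht => (hd t ht).continuousAt.continuousWithinAt)
      (fun t ht => (hd t (interior_subset ht)).differentiableAt.differentiableWithinAt) ?_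
    intro t ht
    have ht := interior_subset ht
    rw [(hd t ht).deriv]
    have h1 := h t ht
    rw [real_inner_comm] at h1
    have h2 : Real.exp (-(2 * C) * t) ≤ 1 := Real.exp_le_one_iff.2 (by
      have := mul_nonneg hC ht.1; linarith)
    have h3 := mul_le_mul_of_nonneg_left h1 (Real.exp_pos (-(2 * C) * t)).le
    nlinarith
  intro t ht
  have h1 := hanti ⟨le_rfl, ht.1.trans ht.2⟩ ht ht.1
  simp only [hφ, mul_zero, Real.exp_zero, one_mul, sub_zero] at h1
  have h2 : Real.exp (2 * C * t) * Real.exp (-(2 * C) * t) = 1 := by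
    rw [← Real.exp_add]; simp
  have h3 := mul_le_mul_of_nonneg_left h1 (Real.exp_pos (2 * C * t)).le
  calc ‖u t - w t‖ ^ 2
      = (Real.exp (2 * C * t) * Real.exp (-(2 * C) * t)) * ‖u t - w t‖ ^ 2 := by rw [h2, one_mul]
    _ ≤ _ := by nlinarith

end

section

/-! ### Yosida approximation of a maximal monotone relation -/

variable {V H : Type*} [NormedAddCommGroup V] [InnerProductSpace ℝ V]
  [NormedAddCommGroup H] [InnerProductSpace ℝ H]

/-- A relation `B v b`, to be read as "`b` is the value at `j v` of a monotone operator on `H` whose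
energy space is `V`". Monotonicity is strengthened by the energy `‖v‖² - ‖j v‖²`, and maximality is
expressed by the range condition; only parameters `ε ≤ 1` are required, as small ones suffice. -/
structure IsCoerciveMonotone (j : V →L[ℝ] H) (B : V → H → Prop) : Prop where
  norm_map_le : ∀ v, ‖j v‖ ≤ ‖v‖
  mono : ∀ {v b v' b'}, B v b → B v' b' →
    ‖v - v'‖ ^ 2 - ‖j v - j v'‖ ^ 2 ≤ ⟪b - b', j v - j v'⟫
  range : ∀ ε : ℝ, 0 < ε → ε ≤ 1 → ∀ x : H, ∃ v b, B v b ∧ j v + ε • b = x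
  unique : ∀ {v b b'}, B v b → B v b' → b = b'

namespace IsCoerciveMonotone

variable {j : V →L[ℝ] H} {B : V → H → Prop}

theorem inner_nonneg (hB : IsCoerciveMonotone j B) {v b v' b'} (h : B v b) (h' : B v' b') :
    0 ≤ ⟪b - b', j v - j v'⟫ := by
  have h1 := hB.mono h h'
  have h2 := hB.norm_map_le (v - v')
  rw [map_sub] at h2
  have := pow_le_pow_left₀ (norm_nonneg _) h2 2
  linarith

/-- The resolvent `rv`, with values in the energy space, and the Yosida approximation `rb`, which at
a point of the domain is bounded by the operator itself. -/
theorem exists_resolvent (hB : IsCoerciveMonotone j B) {ε : ℝ} (hε : 0 < ε) (hε1 : ε ≤ 1) :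
    ∃ (rv : H → V) (rb : H → H), (∀ x, B (rv x) (rb x)) ∧ (∀ x, j (rv x) + ε • rb x = x) ∧
      Continuous rv ∧ LipschitzWith (Real.toNNReal ε⁻¹) rb ∧
      ∀ v b, B v b → ‖rb (j v)‖ ≤ ‖b‖ := by
  choose rv rb hr hx using hB.range ε hε hε1
  -- all estimates come from expanding the square of `x = j (rv x) + ε • rb x`
  have key : ∀ x y, ‖x - y‖ ^ 2 = ‖j (rv x) - j (rv y)‖ ^ 2 +
      2 * ε * ⟪rb x - rb y, j (rv x) - j (rv y)⟫ + ε ^ 2 * ‖rb x - rb y‖ ^ 2 := by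
    intro x y
    have : x - y = (j (rv x) - j (rv y)) + ε • (rb x - rb y) := by
      nth_rewrite 1 [← hx x, ← hx y]
      rw [smul_sub]; abel
    rw [this, norm_add_sq_real, inner_smul_right, norm_smul, mul_pow, Real.norm_eq_abs, sq_abs,
      real_inner_comm]
    ring
  refine ⟨rv, rb, hr, hx, ?_, ?_, ?_⟩
  · refine (LipschitzWith.of_dist_le_mul (K := Real.toNNReal (1 + ε⁻¹)) fun x y => ?_).continuous
    have h0 : 0 ≤ ε⁻¹ := by positivity
    rw [Real.coe_toNNReal _ (by positivity), dist_eq_norm, dist_eq_norm]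
    have h1 := hB.inner_nonneg (hr x) (hr y)
    have h2 := hB.mono (hr x) (hr y)
    have h3 := key x y
    have h4 : ⟪rb x - rb y, j (rv x) - j (rv y)⟫ ≤ ε⁻¹ * ‖x - y‖ ^ 2 := by
      have : ε * ⟪rb x - rb y, j (rv x) - j (rv y)⟫ ≤ ‖x - y‖ ^ 2 := by
        have := mul_nonneg hε.le h1
        nlinarith [sq_nonneg ‖j (rv x) - j (rv y)‖, mul_nonneg (sq_nonneg ε)
          (sq_nonneg ‖rb x - rb y‖)]
      calc _ = ε⁻¹ * (ε * ⟪rb x - rb y, j (rv x) - j (rv y)⟫) := by field_simp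
        _ ≤ _ := by gcongr
    refine abs_le_of_sq_le_sq' ?_ (by positivity) |>.2
    have h5 : ‖j (rv x) - j (rv y)‖ ^ 2 ≤ ‖x - y‖ ^ 2 := by
      have := mul_nonneg hε.le h1
      nlinarith [mul_nonneg (sq_nonneg ε) (sq_nonneg ‖rb x - rb y‖)]
    have h6 : ‖rv x - rv y‖ ^ 2 ≤ (1 + ε⁻¹) * ‖x - y‖ ^ 2 := by linarith
    rw [mul_pow]
    refine h6.trans (mul_le_mul_of_nonneg_right ?_ (sq_nonneg _))
    nlinarith
  · refine LipschitzWith.of_dist_le_mul fun x y => ?_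
    rw [Real.coe_toNNReal _ (by positivity), dist_eq_norm, dist_eq_norm]
    have h1 := hB.inner_nonneg (hr x) (hr y)
    have h3 := key x y
    have h4 : ε * ‖rb x - rb y‖ ≤ ‖x - y‖ := by
      refine abs_le_of_sq_le_sq' ?_ (by positivity) |>.2
      have := mul_nonneg hε.le h1
      nlinarith [sq_nonneg ‖j (rv x) - j (rv y)‖]
    calc _ = ε⁻¹ * (ε * ‖rb x - rb y‖) := by field_simp
      _ ≤ _ := by gcongr
  · intro v b h
    have h1 := hB.inner_nonneg (hr (j v)) h
    have h2 : j (rv (j v)) - j v = -(ε • rb (j v)) := by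
      nth_rewrite 2 [← hx (j v)]; abel
    rw [h2, inner_neg_right, inner_smul_right, inner_sub_left, real_inner_self_eq_norm_sq] at h1
    have h3 : ‖rb (j v)‖ ^ 2 ≤ ⟪b, rb (j v)⟫ := by
      by_contra hcon
      have := mul_pos hε (sub_pos.2 (not_le.1 hcon))
      linarith
    have h4 := real_inner_le_norm b (rb (j v))
    by_contra hcon
    have h5 : 0 < ‖rb (j v)‖ := (norm_nonneg b).trans_lt (not_le.1 hcon)
    nlinarith

/-- The flow of the Yosida approximation, with an a priori bound of its velocity that does not
depend on the parameter. -/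
theorem exists_yosida_flow [CompleteSpace H] (hB : IsCoerciveMonotone j B) {C : ℝ} (hC : 0 ≤ C)
    {v₀ : V} {b₀ : H} (h0 : B v₀ b₀) {ε : ℝ} (hε : 0 < ε) (hε1 : ε ≤ 1) :
    ∃ (u : ℝ → H) (v : ℝ → V) (b : ℝ → H), u 0 = j v₀ ∧
      (∀ t, 0 ≤ t → HasDerivAt u (-b t + C • u t) t) ∧ (∀ t, B (v t) (b t)) ∧
      (∀ t, j (v t) + ε • b t = u t) ∧ ContinuousOn v (Ici 0) ∧ ContinuousOn b (Ici 0) ∧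
      ContinuousOn u (Ici 0) ∧
      ∀ t, 0 ≤ t → ‖-b t + C • u t‖ ≤ Real.exp (C * t) * (‖b₀‖ + C * ‖j v₀‖) := by
  obtain ⟨rv, rb, hr, hx, hrc, hrl, hrb⟩ := hB.exists_resolvent hε hε1
  have hF : LipschitzWith (Real.toNNReal ε⁻¹ + Real.toNNReal C) fun x => -rb x + C • x := by
    refine LipschitzWith.add hrl.neg ?_
    refine LipschitzWith.of_dist_le_mul fun x y => ?_
    rw [dist_eq_norm, ← smul_sub, norm_smul, Real.norm_eq_abs, abs_of_nonneg hC,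
      Real.coe_toNNReal _ hC, dist_eq_norm]
  obtain ⟨u, hu0, hu⟩ := exists_forall_hasDerivAt_of_lipschitzWith hF (j v₀)
  have huc : ContinuousOn u (Ici 0) := fun t ht => (hu t ht).continuousAt.continuousWithinAt
  refine ⟨u, fun t => rv (u t), fun t => rb (u t), hu0, hu, fun t => hr _, fun t => hx _,
    hrc.comp_continuousOn huc, hrl.continuous.comp_continuousOn huc, huc, ?_⟩
  have hone : ∀ x y, ⟪(-rb x + C • x) - (-rb y + C • y), x - y⟫ ≤ C * ‖x - y‖ ^ 2 + 0 := by
    intro x y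
    have h1 := hB.inner_nonneg (hr x) (hr y)
    have e1 : (-rb x + C • x) - (-rb y + C • y) = -(rb x - rb y) + C • (x - y) := by
      rw [smul_sub]; abel
    have e2 : x - y = (j (rv x) - j (rv y)) + ε • (rb x - rb y) := by
      nth_rewrite 1 [← hx x, ← hx y]
      rw [smul_sub]; abel
    rw [e1, inner_add_left, real_inner_smul_left, real_inner_self_eq_norm_sq, inner_neg_left]
    have h2 : 0 ≤ ⟪rb x - rb y, x - y⟫ := by
      rw [e2, inner_add_right, inner_smul_right, real_inner_self_eq_norm_sq]
      have := mul_nonneg hε.le (sq_nonneg ‖rb x - rb y‖)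
      linarith
    linarith
  -- the distance of two time translates grows at most exponentially
  have hshift : ∀ h, 0 ≤ h → ∀ t, 0 ≤ t →
      ‖u (t + h) - u t‖ ≤ Real.exp (C * t) * ‖u h - u 0‖ := by
    intro h hh t ht
    have h1 := norm_sub_sq_le_exp_mul (u := fun t => u (t + h)) (w := u)
      (u' := fun t => -rb (u (t + h)) + C • u (t + h)) (w' := fun t => -rb (u t) + C • u t)
      (T := t) hC le_rfl
      (fun s hs => (hu (s + h) (add_nonneg hs.1 hh)).comp_add_const s h)
      (fun s hs => hu s hs.1) (fun s _ => hone _ _) t ⟨ht, le_rfl⟩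
    simp only [zero_add, mul_zero, zero_mul, add_zero] at h1
    refine abs_le_of_sq_le_sq' ?_ (by positivity) |>.2
    rw [mul_pow, ← Real.exp_nat_mul]
    refine h1.trans_eq ?_
    push_cast; ring_nf
  -- dividing by `h` and letting `h → 0` bounds the velocity by its initial value
  have hvel0 : ‖-rb (u 0) + C • u 0‖ ≤ ‖b₀‖ + C * ‖j v₀‖ := by
    rw [hu0]
    refine (norm_add_le _ _).trans ?_
    rw [norm_neg, norm_smul, Real.norm_eq_abs, abs_of_nonneg hC]
    have := hrb v₀ b₀ h0
    linarith
  have hslope : ∀ t, 0 ≤ t → Tendsto (fun h : ℝ => ‖h⁻¹ • (u (t + h) - u t)‖) (𝓝[>] 0)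
      (𝓝 ‖-rb (u t) + C • u t‖) := by
    intro t ht
    have := (hasDerivAt_iff_tendsto_slope_zero.1 (hu t ht)).norm
    exact this.mono_left (nhdsWithin_mono _ fun x hx => (mem_Ioi.1 hx).ne')
  intro t ht
  have h1 : ‖-rb (u t) + C • u t‖ ≤ Real.exp (C * t) * ‖-rb (u 0) + C • u 0‖ := by
    have h0 := (hslope 0 le_rfl).const_mul (Real.exp (C * t))
    refine le_of_tendsto_of_tendsto (hslope t ht) h0 ?_
    filter_upwards [self_mem_nhdsWithin] with h hh
    have := hshift h (mem_Ioi.1 hh).le t ht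
    rw [norm_smul, norm_smul, zero_add]
    calc ‖h⁻¹‖ * ‖u (t + h) - u t‖ ≤ ‖h⁻¹‖ * (Real.exp (C * t) * ‖u h - u 0‖) := by gcongr
      _ = _ := by ring
  exact h1.trans (by gcongr)

/-- Demiclosedness (Minty's trick): the relation passes to the limit when the energies converge
strongly and the values stay bounded; the values then converge weakly. -/
theorem exists_weak_limit [CompleteSpace H] (hB : IsCoerciveMonotone j B) {v : ℕ → V} {b : ℕ → H}
    {v' : V} {M : ℝ} (h : ∀ n, B (v n) (b n)) (hv : Tendsto v atTop (𝓝 v'))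
    (hb : ∀ n, ‖b n‖ ≤ M) :
    ∃ b', B v' b' ∧ ‖b'‖ ≤ M ∧ ∀ η, Tendsto (fun n => ⟪b n, η⟫) atTop (𝓝 ⟪b', η⟫) := by
  have hjv : Tendsto (fun n => j (v n)) atTop (𝓝 (j v')) := (j.continuous.tendsto v').comp hv
  have hM : 0 ≤ M := (norm_nonneg _).trans (hb 0)
  -- bounded sets of `H` are weakly compact, so that the values converge along each ultrafilter; by
  -- single-valuedness the limit does not depend on it
  have main : ∀ F : Ultrafilter ℕ, (F : Filter ℕ) ≤ atTop → ∃ b', B v' b' ∧ ‖b'‖ ≤ M ∧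
      ∀ η, Tendsto (fun n => ⟪b n, η⟫) F (𝓝 ⟪b', η⟫) := by
    intro F hF
    set d : ℕ → WeakDual ℝ H := fun n => StrongDual.toWeakDual (InnerProductSpace.toDual ℝ H (b n))
    have hd : ∀ n, d n ∈ WeakDual.toStrongDual ⁻¹' Metric.closedBall (0 : StrongDual ℝ H) M := by
      intro n
      have : ‖InnerProductSpace.toDual ℝ H (b n)‖ ≤ M := by
        rw [LinearIsometryEquiv.norm_map]; exact hb n
      exact mem_closedBall_zero_iff.2 this
    obtain ⟨ℓ, hℓ, hlim⟩ := (WeakDual.isCompact_closedBall (𝕜 := ℝ) (0 : StrongDual ℝ H) M)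
      |>.ultrafilter_le_nhds (F.map d) (by
        rw [Ultrafilter.coe_map]; exact (tendsto_principal.2 (Eventually.of_forall hd)))
    set b' := (InnerProductSpace.toDual ℝ H).symm (WeakDual.toStrongDual ℓ) with hb'
    have hℓb : ∀ η, ⟪b', η⟫ = ℓ η := fun η => InnerProductSpace.toDual_symm_apply
    have hweak : ∀ η, Tendsto (fun n => ⟪b n, η⟫) F (𝓝 ⟪b', η⟫) := by
      intro η
      rw [hℓb]
      have : Tendsto d F (𝓝 ℓ) := by rw [Ultrafilter.coe_map] at hlim; exact hlim
      exact ((WeakDual.eval_continuous η).tendsto ℓ).comp this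
    have hb'M : ‖b'‖ ≤ M := by
      rw [hb', LinearIsometryEquiv.norm_map]
      exact mem_closedBall_zero_iff.1 hℓ
    -- pairing of a weakly with a strongly convergent sequence
    have hpair : ∀ c y, Tendsto (fun n => ⟪b n - c, j (v n) - y⟫) F (𝓝 ⟪b' - c, j v' - y⟫) := by
      intro c y
      have h1 : Tendsto (fun n => ⟪b n - c, j (v n) - j v'⟫) F (𝓝 0) := by
        have h2 : Tendsto (fun n => (M + ‖c‖) * ‖j (v n) - j v'‖) F (𝓝 0) := by
          have := ((tendsto_iff_norm_sub_tendsto_zero.1 hjv).const_mul (M + ‖c‖)).mono_left hF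
          rwa [mul_zero] at this
        refine squeeze_zero_norm (fun n => ?_) h2
        refine (norm_inner_le_norm _ _).trans ?_
        gcongr
        exact (norm_sub_le _ _).trans (by gcongr; exact hb n)
      have h3 := (hweak (j v' - y)).sub_const ⟪c, j v' - y⟫
      have h4 := h1.add h3
      rw [zero_add, ← inner_sub_left] at h4
      refine h4.congr fun n => ?_
      rw [← inner_sub_left, ← inner_add_right, sub_add_sub_cancel]
    -- the pair `(w, c)` with `j w + c = j v' + b'` is compared with the weak limit
    obtain ⟨w, c, hwc, hw⟩ := hB.range 1 one_pos le_rfl (j v' + b')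
    rw [one_smul] at hw
    have hlow := fun n => hB.mono (h n) hwc
    have hl1 : Tendsto (fun n => ‖v n - w‖ ^ 2 - ‖j (v n) - j w‖ ^ 2) F
        (𝓝 (‖v' - w‖ ^ 2 - ‖j v' - j w‖ ^ 2)) :=
      (((hv.sub_const w).norm.pow 2).sub ((hjv.sub_const (j w)).norm.pow 2)).mono_left hF
    have hle := le_of_tendsto_of_tendsto' hl1 (hpair c (j w)) hlow
    have hbc : b' - c = -(j v' - j w) := by
      have := congrArg (fun z => z - j v' - c) hw
      rw [add_sub_cancel_left] at this
      rw [← this]; abel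
    rw [hbc, inner_neg_left, real_inner_self_eq_norm_sq] at hle
    have hvw : v' = w := by
      have : ‖v' - w‖ ^ 2 ≤ 0 := by linarith
      have := pow_eq_zero_iff (two_ne_zero) |>.1 (le_antisymm this (sq_nonneg _))
      exact sub_eq_zero.1 (norm_eq_zero.1 this)
    have hbc' : b' = c := by
      rw [hvw, sub_self, neg_zero] at hbc; exact sub_eq_zero.1 hbc
    exact ⟨b', by rw [hvw, hbc']; exact hwc, hb'M, hweak⟩
  obtain ⟨b', hb', hM', -⟩ := main (hyperfilter ℕ) (by
    rw [← Nat.cofinite_eq_atTop]; exact hyperfilter_le_cofinite)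
  refine ⟨b', hb', hM', fun η => ?_⟩
  rw [tendsto_iff_ultrafilter]
  intro F hF
  obtain ⟨c, hc, -, hlim⟩ := main F hF
  rw [hB.unique hb' hc]
  exact hlim η

end IsCoerciveMonotone

end

section

/-! ### Strong solutions -/

variable {V H : Type*} [NormedAddCommGroup V] [InnerProductSpace ℝ V]
  [NormedAddCommGroup H] [InnerProductSpace ℝ H]

theorem continuousOn_Ici_of_Icc {X : Type*} [TopologicalSpace X] {f : ℝ → X}
    (h : ∀ T, 0 ≤ T → ContinuousOn f (Icc 0 T)) : ContinuousOn f (Ici 0) := by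
  intro t ht
  have ht : (0 : ℝ) ≤ t := ht
  refine (h (t + 1) (by linarith) t ⟨ht, by linarith⟩).mono_of_mem_nhdsWithin ?_
  rw [mem_nhdsWithin]
  exact ⟨Iio (t + 1), isOpen_Iio, by simp, fun x hx => ⟨hx.2, (mem_Iio.1 hx.1).le⟩⟩

/-- Solutions of `u' + B u = C u`, `u = j v`, that are continuous in the energy space, have
locally bounded velocity, and satisfy the equation against every element of `H`. -/
structure IsStrongSolution (j : V →L[ℝ] H) (B : V → H → Prop) (C : ℝ) (v : ℝ → V) (b : ℝ → H) :
    Prop where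
  rel : ∀ t, 0 ≤ t → B (v t) (b t)
  cont : ContinuousOn v (Ici 0)
  bdd : ∀ T, ∃ M, ∀ t ∈ Icc 0 T, ‖b t‖ ≤ M
  meas : ∀ η, AEStronglyMeasurable (fun t => ⟪b t, η⟫) (volume.restrict (Ioi 0))
  eq : ∀ η t, 0 ≤ t → ⟪j (v t), η⟫ - ⟪j (v 0), η⟫ =
    ∫ σ in (0 : ℝ)..t, (-⟪b σ, η⟫ + C * ⟪j (v σ), η⟫)

namespace IsCoerciveMonotone

variable {j : V →L[ℝ] H} {B : V → H → Prop}

/-- Solvability for initial values in the domain of the operator, by letting the parameter of the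
Yosida approximation tend to zero. -/
theorem exists_isStrongSolution [CompleteSpace V] [CompleteSpace H] (hB : IsCoerciveMonotone j B)
    {C : ℝ} (hC : 0 ≤ C) {v₀ : V} {b₀ : H} (h0 : B v₀ b₀) :
    ∃ v b, IsStrongSolution j B C v b ∧ j (v 0) = j v₀ := by
  set ε : ℕ → ℝ := fun n => 1 / ((n : ℝ) + 1) with hεdef
  have hε : ∀ n, 0 < ε n := fun n => Nat.one_div_pos_of_nat
  have hε1 : ∀ n, ε n ≤ 1 := fun n => by
    simp only [hεdef]; rw [div_le_one (by positivity)]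
    have : (0 : ℝ) ≤ n := n.cast_nonneg
    linarith
  have hε0 : Tendsto ε atTop (𝓝 0) := tendsto_one_div_add_atTop_nhds_zero_nat
  choose U W b hU0 hUd hrel hres hWc hbc hUc hvel using
    fun n => hB.exists_yosida_flow hC h0 (hε n) (hε1 n)
  -- bounds on `[0, T]` which do not depend on the approximation: `R T` for `U n`, `M T` for `b n`
  set M0 := ‖b₀‖ + C * ‖j v₀‖ with hM0
  have hM0' : 0 ≤ M0 := by positivity
  set R : ℝ → ℝ := fun T => ‖j v₀‖ + Real.exp (C * T) * M0 * T with hR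
  set M : ℝ → ℝ := fun T => Real.exp (C * T) * M0 + C * R T with hM
  have hvelT : ∀ n T, ∀ t ∈ Icc 0 T, ‖-b n t + C • U n t‖ ≤ Real.exp (C * T) * M0 := by
    intro n T t ht
    refine (hvel n t ht.1).trans ?_
    gcongr
    exact ht.2
  have hUb : ∀ n T, ∀ t ∈ Icc 0 T, ‖U n t‖ ≤ R T := by
    intro n T t ht
    have h1 := norm_image_sub_le_of_norm_deriv_le_segment' (f := U n) (a := 0) (b := T)
      (f' := fun t => -b n t + C • U n t) (C := Real.exp (C * T) * M0)
      (fun x hx => (hUd n x hx.1).hasDerivWithinAt)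
      (fun x hx => hvelT n T x ⟨hx.1, hx.2.le⟩) t ht
    rw [hU0, sub_zero] at h1
    have h2 := norm_le_norm_add_norm_sub' (U n t) (j v₀)
    have h3 : Real.exp (C * T) * M0 * t ≤ Real.exp (C * T) * M0 * T := by
      gcongr; exact ht.2
    simp only [hR]; linarith
  have hbb : ∀ n T, ∀ t ∈ Icc 0 T, ‖b n t‖ ≤ M T := by
    intro n T t ht
    have h1 := hvelT n T t ht
    have h2 : b n t = C • U n t - (-b n t + C • U n t) := by abel
    rw [h2]
    refine (norm_sub_le _ _).trans ?_
    rw [norm_smul, Real.norm_eq_abs, abs_of_nonneg hC]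
    have := mul_le_mul_of_nonneg_left (hUb n T t ht) hC
    simp only [hM]; linarith
  -- The relation is monotone for `j (W n) = U n - ε n • b n`, not for `U n`; the defect is of order
  -- `ε n + ε m`, which bounds the distance in `H`. The energy retained in `mono` then bounds the
  -- distance in `V`.
  have hcauchy : ∀ T, 0 ≤ T → UniformCauchySeqOn W atTop (Icc 0 T) := by
    intro T hT
    have hMT : 0 ≤ M T := (norm_nonneg _).trans (hbb 0 T 0 ⟨le_rfl, hT⟩)
    set K := Real.exp (2 * C * T) * (2 * (2 * M T ^ 2) * T) with hK
    have hK0 : 0 ≤ K := by positivity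
    set mod : ℝ → ℝ := fun r => (√(K * r) + M T * r) ^ 2 + 2 * M T * (√(K * r) + M T * r) with hmod
    have hmodc : Tendsto mod (𝓝 0) (𝓝 0) := by
      have : Continuous mod := by fun_prop
      have h1 := this.tendsto 0
      simpa [hmod] using h1
    have hest : ∀ n m, ∀ t ∈ Icc 0 T, ‖W n t - W m t‖ ^ 2 ≤ mod (ε n + ε m) := by
      intro n m t ht
      have hr : 0 ≤ ε n + ε m := (add_pos (hε n) (hε m)).le
      have hdiff : ∀ s, U n s - U m s =
          (j (W n s) - j (W m s)) + (ε n • b n s - ε m • b m s) := by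
        intro s; rw [← hres n s, ← hres m s]; abel
      have hrem : ∀ s ∈ Icc 0 T, ‖ε n • b n s - ε m • b m s‖ ≤ M T * (ε n + ε m) := by
        intro s hs
        refine (norm_sub_le _ _).trans ?_
        rw [norm_smul, norm_smul, Real.norm_eq_abs, Real.norm_eq_abs, abs_of_pos (hε n),
          abs_of_pos (hε m)]
        nlinarith [mul_le_mul_of_nonneg_left (hbb n T s hs) (hε n).le,
          mul_le_mul_of_nonneg_left (hbb m T s hs) (hε m).le]
      have hbd : ∀ s ∈ Icc 0 T, ‖b n s - b m s‖ ≤ 2 * M T := by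
        intro s hs
        refine (norm_sub_le _ _).trans ?_
        linarith [hbb n T s hs, hbb m T s hs]
      have h1 := norm_sub_sq_le_exp_mul (u := U n) (w := U m) (T := T)
        (δ := 2 * M T ^ 2 * (ε n + ε m)) hC (by positivity)
        (fun s hs => hUd n s hs.1) (fun s hs => hUd m s hs.1) (fun s hs => by
          have e1 : (-b n s + C • U n s) - (-b m s + C • U m s) =
              -(b n s - b m s) + C • (U n s - U m s) := by rw [smul_sub]; abel
          rw [e1, inner_add_left, real_inner_smul_left, real_inner_self_eq_norm_sq,
            inner_neg_left]
          have h2 := hB.inner_nonneg (hrel n s) (hrel m s)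
          have h3 : ⟪b n s - b m s, U n s - U m s⟫ = ⟪b n s - b m s, j (W n s) - j (W m s)⟫
              + ⟪b n s - b m s, ε n • b n s - ε m • b m s⟫ := by
            rw [hdiff s, inner_add_right]
          have h4 := neg_le_of_abs_le (abs_real_inner_le_norm (b n s - b m s)
            (ε n • b n s - ε m • b m s))
          have h5 := mul_le_mul (hbd s hs) (hrem s hs) (norm_nonneg _) (by positivity)
          nlinarith) t ht
      rw [hU0, hU0, sub_self, norm_zero] at h1
      have h2 : ‖U n t - U m t‖ ^ 2 ≤ K * (ε n + ε m) := by
        refine h1.trans ?_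
        have hexp : Real.exp (2 * C * t) ≤ Real.exp (2 * C * T) :=
          Real.exp_le_exp.2 (by have := ht.2; gcongr)
        have : Real.exp (2 * C * t) * (2 * (2 * M T ^ 2 * (ε n + ε m)) * t) ≤
            Real.exp (2 * C * T) * (2 * (2 * M T ^ 2 * (ε n + ε m)) * T) := by
          have := ht.2
          have := ht.1
          gcongr
        simp only [hK]
        calc _ = Real.exp (2 * C * t) * (2 * (2 * M T ^ 2 * (ε n + ε m)) * t) := by ring
          _ ≤ _ := this
          _ = _ := by ring
      have h3 : ‖U n t - U m t‖ ≤ √(K * (ε n + ε m)) := Real.le_sqrt_of_sq_le h2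
      have h4 : ‖j (W n t) - j (W m t)‖ ≤ √(K * (ε n + ε m)) + M T * (ε n + ε m) := by
        have : j (W n t) - j (W m t) = (U n t - U m t) - (ε n • b n t - ε m • b m t) := by
          rw [hdiff t]; abel
        rw [this]
        exact (norm_sub_le _ _).trans (add_le_add h3 (hrem t ht))
      have h5 := hB.mono (hrel n t) (hrel m t)
      have h6 := real_inner_le_norm (b n t - b m t) (j (W n t) - j (W m t))
      have h7 := mul_le_mul (hbd t ht) h4 (norm_nonneg _) (by positivity)
      have h8 := pow_le_pow_left₀ (norm_nonneg _) h4 2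
      simp only [hmod]
      linarith
    rw [Metric.uniformCauchySeqOn_iff]
    intro e he
    obtain ⟨δ, hδ, hδm⟩ := Metric.tendsto_nhds_nhds.1 hmodc (e ^ 2) (by positivity)
    obtain ⟨n0, hn0⟩ := (hε0.eventually (gt_mem_nhds (half_pos hδ))).exists_forall_of_atTop
    refine ⟨n0, fun m hm n hn t ht => ?_⟩
    have h1 := hest m n t ht
    have h2 : dist (ε m + ε n) 0 < δ := by
      rw [dist_zero_right, Real.norm_eq_abs, abs_of_pos (add_pos (hε m) (hε n))]
      linarith [hn0 m hm, hn0 n hn]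
    have h3 := hδm h2
    rw [dist_zero_right] at h3
    rw [dist_eq_norm]
    exact lt_of_pow_lt_pow_left₀ 2 he.le (h1.trans_lt ((le_abs_self _).trans_lt h3))
  have hlim : ∀ t, ∃ l, 0 ≤ t → Tendsto (fun n => W n t) atTop (𝓝 l) := by
    intro t
    by_cases ht : 0 ≤ t
    · obtain ⟨l, hl⟩ := cauchySeq_tendsto_of_complete
        ((hcauchy t ht).cauchySeq (x := t) ⟨ht, le_rfl⟩)
      exact ⟨l, fun _ => hl⟩
    · exact ⟨0, fun h => absurd h ht⟩
  choose v hv using hlim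
  have hunif : ∀ T, 0 ≤ T → TendstoUniformlyOn W v atTop (Icc 0 T) := fun T hT =>
    (hcauchy T hT).tendstoUniformlyOn_of_tendsto fun t ht => hv t ht.1
  have hvc : ContinuousOn v (Ici 0) := continuousOn_Ici_of_Icc fun T hT =>
    (hunif T hT).continuousOn (Frequently.of_forall fun n => (hWc n).mono fun t ht => ht.1)
  have hwl : ∀ t, ∃ b', 0 ≤ t → B (v t) b' ∧ ‖b'‖ ≤ M t ∧
      ∀ η, Tendsto (fun n => ⟪b n t, η⟫) atTop (𝓝 ⟪b', η⟫) := by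
    intro t
    by_cases ht : 0 ≤ t
    · obtain ⟨b', hb'⟩ := hB.exists_weak_limit (fun n => hrel n t) (hv t ht)
        (fun n => hbb n t t ⟨ht, le_rfl⟩)
      exact ⟨b', fun _ => hb'⟩
    · exact ⟨0, fun h => absurd h ht⟩
  choose b' hb' using hwl
  have hUlim : ∀ t, 0 ≤ t → Tendsto (fun n => U n t) atTop (𝓝 (j (v t))) := by
    intro t ht
    have h1 : Tendsto (fun n => ε n • b n t) atTop (𝓝 0) := by
      refine squeeze_zero_norm (a := fun n => ε n * M t) (fun n => ?_)
        (by simpa using hε0.mul_const (M t))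
      rw [norm_smul, Real.norm_eq_abs, abs_of_pos (hε n)]
      exact mul_le_mul_of_nonneg_left (hbb n t t ⟨ht, le_rfl⟩) (hε n).le
    have h2 := ((j.continuous.tendsto (v t)).comp (hv t ht)).add h1
    rw [add_zero] at h2
    exact h2.congr fun n => hres n t
  have hj0 : j (v 0) = j v₀ := by
    refine tendsto_nhds_unique (hUlim 0 le_rfl) ?_
    simp_rw [hU0]; exact tendsto_const_nhds
  have hbcη : ∀ n η, ContinuousOn (fun t => ⟪b n t, η⟫) (Ici 0) := fun n η =>
    (hbc n).inner continuousOn_const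
  refine ⟨v, b', ⟨fun t ht => (hb' t ht).1, hvc, fun T => ⟨M (max T 0), fun t ht => ?_⟩,
    fun η => ?_, fun η t ht => ?_⟩, hj0⟩
  · have hM' := (hb' t ht.1).2.1
    refine hM'.trans ?_
    have h1 : t ≤ max T 0 := ht.2.trans (le_max_left _ _)
    have := ht.1
    simp only [hM, hR]
    gcongr
  · refine aestronglyMeasurable_of_tendsto_ae (f := fun n t => ⟪b n t, η⟫) atTop
      (fun n => ((hbcη n η).mono Ioi_subset_Ici_self).aestronglyMeasurable measurableSet_Ioi) ?_
    refine (ae_restrict_iff' measurableSet_Ioi).2 (Eventually.of_forall fun t ht => ?_)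
    exact (hb' t (mem_Ioi.1 ht).le).2.2 η
  · have hci : ∀ n, ContinuousOn (fun σ => -⟪b n σ, η⟫ + C * ⟪U n σ, η⟫) (Icc 0 t) := fun n =>
      (((hbcη n η).neg).add (continuousOn_const.mul ((hUc n).inner continuousOn_const))).mono
        fun s hs => hs.1
    have hn : ∀ n, ⟪U n t, η⟫ - ⟪U n 0, η⟫ =
        ∫ σ in (0 : ℝ)..t, (-⟪b n σ, η⟫ + C * ⟪U n σ, η⟫) := by
      intro n
      refine (intervalIntegral.integral_eq_sub_of_hasDerivAt (f := fun σ => ⟪U n σ, η⟫)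
        (fun s hs => ?_) ?_).symm
      · rw [uIcc_of_le ht] at hs
        have := (hUd n s hs.1).inner ℝ (hasDerivAt_const s η)
        refine this.congr_deriv ?_
        rw [inner_zero_right, zero_add, inner_add_left, inner_neg_left, real_inner_smul_left]
      · exact (hci n).intervalIntegrable_of_Icc ht
    have hl : Tendsto (fun n => ⟪U n t, η⟫ - ⟪U n 0, η⟫) atTop
        (𝓝 (⟪j (v t), η⟫ - ⟪j (v 0), η⟫)) :=
      ((hUlim t ht).inner tendsto_const_nhds).sub ((hUlim 0 le_rfl).inner tendsto_const_nhds)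
    refine tendsto_nhds_unique hl ?_
    simp_rw [hn]
    refine intervalIntegral.tendsto_integral_filter_of_dominated_convergence
      (fun _ => M t * ‖η‖ + C * (R t * ‖η‖)) ?_ ?_ (by simp) ?_
    · rw [uIoc_of_le ht]
      exact Eventually.of_forall fun n =>
        ((hci n).mono Ioc_subset_Icc_self).aestronglyMeasurable measurableSet_Ioc
    · rw [uIoc_of_le ht]
      refine Eventually.of_forall fun n => Eventually.of_forall fun s hs => ?_
      have hs' : s ∈ Icc 0 t := ⟨hs.1.le, hs.2⟩
      refine (norm_add_le _ _).trans ?_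
      rw [norm_neg, norm_mul, Real.norm_eq_abs C, abs_of_nonneg hC]
      have h1 := norm_inner_le_norm (𝕜 := ℝ) (b n s) η
      have h2 := norm_inner_le_norm (𝕜 := ℝ) (U n s) η
      have h3 := mul_le_mul_of_nonneg_right (hbb n t s hs') (norm_nonneg η)
      have h4 := mul_le_mul_of_nonneg_right (hUb n t s hs') (norm_nonneg η)
      have h5 := mul_le_mul_of_nonneg_left (h2.trans h4) hC
      linarith
    · rw [uIoc_of_le ht]
      refine Eventually.of_forall fun s hs => ?_
      exact ((hb' s hs.1.le).2.2 η).neg.add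
        (((hUlim s hs.1.le).inner tendsto_const_nhds).const_mul C)

end IsCoerciveMonotone

end

section

/-! ### Continuous dependence of strong solutions on their initial values -/

variable {V H : Type*} [NormedAddCommGroup V] [InnerProductSpace ℝ V]
  [NormedAddCommGroup H] [InnerProductSpace ℝ H]

namespace IsStrongSolution

variable {j : V →L[ℝ] H} {B : V → H → Prop} {C : ℝ} {v w : ℝ → V} {b d : ℝ → H}

theorem intervalIntegrable_inner (hv : IsStrongSolution j B C v b) (η : H) {t : ℝ} (ht : 0 ≤ t) :
    IntervalIntegrable (fun σ => -⟪b σ, η⟫ + C * ⟪j (v σ), η⟫) volume 0 t := by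
  have h1 : ContinuousOn (fun σ => C * ⟪j (v σ), η⟫) (Icc 0 t) :=
    continuousOn_const.mul (((j.continuous.comp_continuousOn hv.cont).mono
      fun s hs => hs.1).inner continuousOn_const)
  refine IntervalIntegrable.add ?_ (h1.intervalIntegrable_of_Icc ht)
  refine IntervalIntegrable.neg ?_
  obtain ⟨M, hM⟩ := hv.bdd t
  rw [intervalIntegrable_iff_integrableOn_Ioc_of_le ht]
  refine Integrable.mono' (g := fun _ => M * ‖η‖) (integrable_const _)
    ((hv.meas η).mono_measure (Measure.restrict_mono Ioc_subset_Ioi_self le_rfl)) ?_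
  refine (ae_restrict_iff' measurableSet_Ioc).2 (Eventually.of_forall fun s hs => ?_)
  exact (norm_inner_le_norm _ _).trans
    (mul_le_mul_of_nonneg_right (hM s ⟨hs.1.le, hs.2⟩) (norm_nonneg η))

/-- The squared distance of two strong solutions is absolutely continuous. -/
theorem norm_sub_sq_eq_integral (hv : IsStrongSolution j B C v b)
    (hw : IsStrongSolution j B C w d) {t : ℝ} (ht : 0 ≤ t) :
    IntervalIntegrable (fun σ => 2 * (-⟪b σ - d σ, j (v σ) - j (w σ)⟫ +
        C * ‖j (v σ) - j (w σ)‖ ^ 2)) volume 0 t ∧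
    ‖j (v t) - j (w t)‖ ^ 2 - ‖j (v 0) - j (w 0)‖ ^ 2 =
      ∫ σ in (0 : ℝ)..t, 2 * (-⟪b σ - d σ, j (v σ) - j (w σ)⟫ +
        C * ‖j (v σ) - j (w σ)‖ ^ 2) := by
  set z : ℝ → H := fun t => j (v t) - j (w t) with hz
  have hzc : ContinuousOn z (Ici 0) := (j.continuous.comp_continuousOn hv.cont).sub
    (j.continuous.comp_continuousOn hw.cont)
  obtain ⟨M, hM⟩ := hv.bdd t
  obtain ⟨M', hM'⟩ := hw.bdd t
  have hM0 := (norm_nonneg _).trans (hM 0 ⟨le_rfl, ht⟩)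
  have hM0' := (norm_nonneg _).trans (hM' 0 ⟨le_rfl, ht⟩)
  obtain ⟨R, hR⟩ := isCompact_Icc.exists_bound_of_continuousOn (hzc.mono fun s hs => hs.1 :
    ContinuousOn z (Icc 0 t))
  have hR0 := (norm_nonneg _).trans (hR 0 ⟨le_rfl, ht⟩)
  set D : ℝ → ℝ → ℝ := fun σ c => -⟪b σ - d σ, z c⟫ + C * ⟪z σ, z c⟫ with hD
  have hDeq : ∀ σ c, D σ c = (-⟪b σ, z c⟫ + C * ⟪j (v σ), z c⟫) -
      (-⟪d σ, z c⟫ + C * ⟪j (w σ), z c⟫) := by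
    intro σ c; simp only [hD]
    rw [inner_sub_left]
    nth_rewrite 3 [hz]
    simp only [inner_sub_left]; ring
  have hDi : ∀ c ∈ Icc 0 t, IntervalIntegrable (fun σ => D σ c) volume 0 t := by
    intro c _
    simp only [hDeq]
    exact (hv.intervalIntegrable_inner _ ht).sub (hw.intervalIntegrable_inner _ ht)
  have hP : ∀ a ∈ Icc 0 t, ∀ c ∈ Icc 0 t, ⟪z a, z c⟫ - ⟪z 0, z c⟫ =
      ∫ σ in (0 : ℝ)..a, D σ c := by
    intro a ha c _
    simp only [hDeq]
    rw [intervalIntegral.integral_sub (hv.intervalIntegrable_inner _ ha.1)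
      (hw.intervalIntegrable_inner _ ha.1), ← hv.eq _ a ha.1, ← hw.eq _ a ha.1]
    nth_rewrite 1 [hz]
    nth_rewrite 2 [hz]
    simp only [inner_sub_left]; ring
  have hDb : ∀ᵐ σ, σ ∈ Ioc 0 t → ∀ c ∈ Icc 0 t, |D σ c| ≤ (M + M') * R + |C| * (R * R) := by
    refine Eventually.of_forall fun σ hσ c hc => ?_
    have hσ' : σ ∈ Icc 0 t := ⟨hσ.1.le, hσ.2⟩
    simp only [hD]
    refine (abs_add_le _ _).trans ?_
    rw [abs_neg, abs_mul]
    have h1 := abs_real_inner_le_norm (b σ - d σ) (z c)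
    have h2 := abs_real_inner_le_norm (z σ) (z c)
    have h3 : ‖b σ - d σ‖ ≤ M + M' :=
      (norm_sub_le _ _).trans (add_le_add (hM σ hσ') (hM' σ hσ'))
    have h4 := mul_le_mul h3 (hR c hc) (norm_nonneg _) (by positivity)
    have h5 := mul_le_mul (hR σ hσ') (hR c hc) (norm_nonneg _) (by positivity)
    have h6 := mul_le_mul_of_nonneg_left (h2.trans h5) (abs_nonneg C)
    linarith
  have hDc : ∀ᵐ σ, σ ∈ Ioc 0 t → ContinuousOn (D σ) (Icc 0 t) := by
    refine Eventually.of_forall fun σ _ => ?_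
    have hzc' : ContinuousOn z (Icc 0 t) := hzc.mono fun s hs => hs.1
    exact (continuousOn_const.inner hzc').neg.add
      (continuousOn_const.mul (continuousOn_const.inner hzc'))
  obtain ⟨hi, he⟩ := diagonal_integral_eq_sub ht (P := fun a c => ⟪z a, z c⟫) (D := D) (e := D)
    (β := fun _ => (M + M') * R + |C| * (R * R)) hP
    (fun a ha c hc => by
      rw [real_inner_comm, real_inner_comm (z 0)]; exact hP a ha c hc) hDi hDi (by simp)
    hDb hDb hDc hDc
  have hDD : ∀ σ, D σ σ + D σ σ = 2 * (-⟪b σ - d σ, j (v σ) - j (w σ)⟫ +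
      C * ‖j (v σ) - j (w σ)‖ ^ 2) := by
    intro σ; simp only [hD, real_inner_self_eq_norm_sq]; simp only [hz]; ring
  simp only [hDD, real_inner_self_eq_norm_sq] at hi he
  exact ⟨hi, he⟩

/-- The contraction estimate for strong solutions, retaining the energy of their difference. -/
theorem exp_mul_norm_sub_sq_add_integral_le (hB : IsCoerciveMonotone j B)
    (hv : IsStrongSolution j B C v b) (hw : IsStrongSolution j B C w d) {t : ℝ} (ht : 0 ≤ t) :
    Real.exp (-(2 * C) * t) * ‖j (v t) - j (w t)‖ ^ 2 +
      ∫ σ in (0 : ℝ)..t, Real.exp (-(2 * C) * σ) *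
        (2 * (‖v σ - w σ‖ ^ 2 - ‖j (v σ) - j (w σ)‖ ^ 2)) ≤ ‖j (v 0) - j (w 0)‖ ^ 2 := by
  have hc : ContinuousOn (fun σ => 2 * (‖v σ - w σ‖ ^ 2 - ‖j (v σ) - j (w σ)‖ ^ 2)) (Icc 0 t) := by
    have h1 : ContinuousOn v (Icc 0 t) := hv.cont.mono fun s hs => hs.1
    have h2 : ContinuousOn w (Icc 0 t) := hw.cont.mono fun s hs => hs.1
    fun_prop
  refine gronwall_dissipation (φ := fun t => ‖j (v t) - j (w t)‖ ^ 2) ht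
    (hv.norm_sub_sq_eq_integral hw ht).1 (hc.intervalIntegrable_of_Icc ht)
    (fun a ha => (hv.norm_sub_sq_eq_integral hw ha.1).2) (Eventually.of_forall fun σ hσ => ?_)
  have := hB.mono (hv.rel σ hσ.1.le) (hw.rel σ hσ.1.le)
  linarith

theorem norm_sub_le (hB : IsCoerciveMonotone j B)
    (hv : IsStrongSolution j B C v b) (hw : IsStrongSolution j B C w d) {t : ℝ} (ht : 0 ≤ t) :
    ‖j (v t) - j (w t)‖ ≤ Real.exp (C * t) * ‖j (v 0) - j (w 0)‖ := by
  have h1 := hv.exp_mul_norm_sub_sq_add_integral_le hB hw ht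
  have h2 : 0 ≤ ∫ σ in (0 : ℝ)..t, Real.exp (-(2 * C) * σ) *
        (2 * (‖v σ - w σ‖ ^ 2 - ‖j (v σ) - j (w σ)‖ ^ 2)) := by
    refine intervalIntegral.integral_nonneg ht fun s _ => ?_
    have := hB.norm_map_le (v s - w s)
    rw [map_sub] at this
    have := pow_le_pow_left₀ (norm_nonneg _) this 2
    have : 0 ≤ ‖v s - w s‖ ^ 2 - ‖j (v s) - j (w s)‖ ^ 2 := by linarith
    positivity
  have h3 : Real.exp (-(2 * C) * t) * ‖j (v t) - j (w t)‖ ^ 2 ≤ ‖j (v 0) - j (w 0)‖ ^ 2 := by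
    linarith
  refine abs_le_of_sq_le_sq' ?_ (by positivity) |>.2
  have h4 : Real.exp (2 * C * t) * Real.exp (-(2 * C) * t) = 1 := by
    rw [← Real.exp_add]; simp
  have h5 := mul_le_mul_of_nonneg_left h3 (Real.exp_pos (2 * C * t)).le
  rw [← mul_assoc, h4, one_mul] at h5
  rw [mul_pow, ← Real.exp_nat_mul]
  refine h5.trans_eq ?_
  push_cast; ring_nf

/-- Strong solutions are close to each other in the energy space, in the mean over time. -/
theorem integral_exp_mul_norm_sub_sq_le (hB : IsCoerciveMonotone j B)
    (hv : IsStrongSolution j B C v b) (hw : IsStrongSolution j B C w d) {t : ℝ} (ht : 0 ≤ t) :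
    ∫ σ in (0 : ℝ)..t, Real.exp (-(2 * C + 1) * σ) * ‖v σ - w σ‖ ^ 2 ≤
      2 * ‖j (v 0) - j (w 0)‖ ^ 2 := by
  have h1 := hv.exp_mul_norm_sub_sq_add_integral_le hB hw ht
  have hv' : ContinuousOn v (Icc 0 t) := hv.cont.mono fun s hs => hs.1
  have hw' : ContinuousOn w (Icc 0 t) := hw.cont.mono fun s hs => hs.1
  set φ0 := ‖j (v 0) - j (w 0)‖ ^ 2
  have hle : ∫ σ in (0 : ℝ)..t, Real.exp (-(2 * C + 1) * σ) * ‖v σ - w σ‖ ^ 2 ≤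
      ∫ σ in (0 : ℝ)..t, (Real.exp (-(2 * C) * σ) *
        (2 * (‖v σ - w σ‖ ^ 2 - ‖j (v σ) - j (w σ)‖ ^ 2)) + Real.exp (-σ) * φ0) := by
    -- `‖v - w‖²` is the energy plus `‖j (v - w)‖²`, and the latter is bounded by the contraction
    refine intervalIntegral.integral_mono_on ht ?_ ?_ fun s hs => ?_
    · exact ContinuousOn.intervalIntegrable_of_Icc ht (by fun_prop)
    · exact ContinuousOn.intervalIntegrable_of_Icc ht (by fun_prop)
    · have h2 := hv.norm_sub_le hB hw hs.1
      have h3 := pow_le_pow_left₀ (norm_nonneg _) h2 2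
      rw [mul_pow, ← Real.exp_nat_mul] at h3
      have h4 := hB.norm_map_le (v s - w s)
      rw [map_sub] at h4
      have h4 := pow_le_pow_left₀ (norm_nonneg _) h4 2
      have e1 : Real.exp (-(2 * C + 1) * s) = Real.exp (-(2 * C) * s) * Real.exp (-s) := by
        rw [← Real.exp_add]; ring_nf
      have e2 : Real.exp (-(2 * C) * s) * Real.exp ((2 : ℕ) * (C * s)) = 1 := by
        rw [← Real.exp_add]; push_cast; ring_nf; simp
      have e3 : Real.exp (-s) ≤ 1 := Real.exp_le_one_iff.2 (by linarith [hs.1])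
      have p1 := Real.exp_pos (-(2 * C) * s)
      have p2 := Real.exp_pos (-s)
      have h5 : Real.exp (-(2 * C) * s) * ‖j (v s) - j (w s)‖ ^ 2 ≤ φ0 := by
        have := mul_le_mul_of_nonneg_left h3 p1.le
        rwa [← mul_assoc, e2, one_mul] at this
      rw [e1]
      have h6 := mul_le_mul_of_nonneg_left h5 p2.le
      have h7 : 0 ≤ Real.exp (-(2 * C) * s) * (‖v s - w s‖ ^ 2 - ‖j (v s) - j (w s)‖ ^ 2) :=
        mul_nonneg p1.le (by linarith)
      have h8 := mul_le_mul_of_nonneg_right e3 h7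
      nlinarith
  rw [intervalIntegral.integral_add (ContinuousOn.intervalIntegrable_of_Icc ht (by fun_prop))
    (ContinuousOn.intervalIntegrable_of_Icc ht (by fun_prop)),
    intervalIntegral.integral_mul_const] at hle
  have h2 : ∫ σ in (0 : ℝ)..t, Real.exp (-σ) ≤ 1 := by
    have : ∫ σ in (0 : ℝ)..t, Real.exp (-σ) = -Real.exp (-t) - -Real.exp (-0) := by
      refine intervalIntegral.integral_eq_sub_of_hasDerivAt (f := fun σ => -Real.exp (-σ))
        (fun s _ => ?_) (Continuous.intervalIntegrable (by fun_prop) _ _)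
      have := ((hasDerivAt_id s).neg.exp).neg
      exact this.congr_deriv (by simp)
    rw [this]; simp [(Real.exp_pos _).le]
  have h3 : 0 ≤ Real.exp (-(2 * C) * t) * ‖j (v t) - j (w t)‖ ^ 2 := by positivity
  have h4 : (∫ σ in (0 : ℝ)..t, Real.exp (-σ)) * φ0 ≤ 1 * φ0 :=
    mul_le_mul_of_nonneg_right h2 (sq_nonneg _)
  linarith

end IsStrongSolution

end

section

/-! ### Measure-theoretic tools -/

variable {X : Type*} [MeasurableSpace X] {m : Measure X}

/-- Fast convergence in `L²` implies convergence almost everywhere of the whole sequence. -/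
theorem ae_tendsto_of_sum_norm_sub_sq {w : ℕ → Lp ℝ 2 m} {w' : Lp ℝ 2 m}
    (h : ∑' n, ‖w n - w'‖ₑ ^ 2 ≠ ⊤) :
    ∀ᵐ x ∂m, Tendsto (fun n => w n x) atTop (𝓝 (w' x)) := by
  have hn : ∀ n, ∫⁻ x, ‖w n x - w' x‖ₑ ^ 2 ∂m = ‖w n - w'‖ₑ ^ 2 := by
    intro n
    rw [Lp.enorm_def, eLpNorm_eq_lintegral_rpow_enorm_toReal (by simp) (by simp)]
    simp only [ENNReal.toReal_ofNat, ENNReal.rpow_ofNat]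
    rw [← ENNReal.rpow_natCast, ← ENNReal.rpow_mul]
    simp only [Nat.cast_ofNat, one_div, ne_eq, OfNat.ofNat_ne_zero, not_false_eq_true,
      inv_mul_cancel₀, ENNReal.rpow_one]
    refine lintegral_congr_ae ?_
    filter_upwards [Lp.coeFn_sub (w n) w'] with x hx
    rw [hx, Pi.sub_apply]
  have hm : ∀ n, AEMeasurable (fun x => ‖w n x - w' x‖ₑ ^ 2) m := fun n =>
    ((Lp.aestronglyMeasurable (w n)).sub (Lp.aestronglyMeasurable w')).enorm.pow_const 2
  have h1 : ∫⁻ x, ∑' n, ‖w n x - w' x‖ₑ ^ 2 ∂m ≠ ⊤ := by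
    rw [lintegral_tsum hm]; simpa only [hn] using h
  filter_upwards [ae_lt_top' (AEMeasurable.tsum hm) h1] with x hx
  have h2 := ENNReal.tendsto_atTop_zero_of_tsum_ne_top hx.ne
  rw [tendsto_iff_edist_tendsto_0]
  have h3 := (ENNReal.continuous_rpow_const (y := (1 / 2 : ℝ))).tendsto 0 |>.comp h2
  rw [ENNReal.zero_rpow_of_pos (by norm_num)] at h3
  refine h3.congr fun n => ?_
  simp only [Function.comp]
  rw [← ENNReal.rpow_natCast, ← ENNReal.rpow_mul, edist_eq_enorm_sub]
  simp

theorem exists_subseq_ae_tendsto {w : ℕ → Lp ℝ 2 m} {w' : Lp ℝ 2 m}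
    (h : Tendsto w atTop (𝓝 w')) : ∃ ns : ℕ → ℕ, StrictMono ns ∧
      ∀ᵐ x ∂m, Tendsto (fun n => w (ns n) x) atTop (𝓝 (w' x)) :=
  (tendstoInMeasure_of_tendsto_Lp h).exists_seq_tendsto_ae

/-- A measurable curve in `L²` has a jointly measurable representative: it is approximated, at a
geometric rate, by curves with values in a countable set. -/
theorem exists_measurable_uncurry_ae_eq [SecondCountableTopology (Lp ℝ 2 m)] {S : Type*}
    [MeasurableSpace S] {τ : Measure S} {u : S → Lp ℝ 2 m} (hu : AEStronglyMeasurable u τ) :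
    ∃ U : S → X → ℝ, Measurable (Function.uncurry U) ∧ ∀ᵐ t ∂τ, U t =ᵐ[m] u t := by
  classical
  let _ : MeasurableSpace (Lp ℝ 2 m) := borel _
  have : BorelSpace (Lp ℝ 2 m) := ⟨rfl⟩
  set d := TopologicalSpace.denseSeq (Lp ℝ 2 m)
  have hd : DenseRange d := TopologicalSpace.denseRange_denseSeq _
  set u' := hu.mk u
  have hu' : Measurable u' := hu.stronglyMeasurable_mk.measurable
  have hex : ∀ k : ℕ, ∀ t, ∃ n, ‖d n - u' t‖ < (1 / 2 : ℝ) ^ k := by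
    intro k t
    obtain ⟨n, hn⟩ := hd.exists_dist_lt (u' t) (ε := (1 / 2 : ℝ) ^ k) (by positivity)
    exact ⟨n, by rwa [dist_comm, dist_eq_norm] at hn⟩
  set ν : ℕ → S → ℕ := fun k t => Nat.find (hex k t)
  have hν : ∀ k, Measurable (ν k) := fun k => measurable_find (hex k) fun n =>
    measurableSet_lt (measurable_const.sub hu').norm measurable_const
  have hνs : ∀ k t, ‖d (ν k t) - u' t‖ < (1 / 2 : ℝ) ^ k := fun k t => Nat.find_spec (hex k t)
  have hD : Measurable (fun q : ℕ × X => (d q.1 : X → ℝ) q.2) :=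
    measurable_from_prod_countable_right fun n => (Lp.stronglyMeasurable (d n)).measurable
  set U' : ℕ → S × X → ℝ := fun k q => (d (ν k q.1) : X → ℝ) q.2
  have hU' : ∀ k, Measurable (U' k) := fun k =>
    hD.comp (((hν k).comp measurable_fst).prodMk measurable_snd)
  have hUm : StronglyMeasurable fun q => limUnder atTop fun k => U' k q :=
    StronglyMeasurable.limUnder fun k => (hU' k).stronglyMeasurable
  refine ⟨fun t x => limUnder atTop fun k => U' k (t, x), hUm.measurable, ?_⟩
  filter_upwards [hu.ae_eq_mk] with t ht
  have hlim := ae_tendsto_of_sum_norm_sub_sq (m := m) (w := fun k => d (ν k t)) (w' := u' t) (by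
    have hle : ∀ k, ‖d (ν k t) - u' t‖ₑ ^ 2 ≤ ENNReal.ofReal ((1 / 4 : ℝ) ^ k) := by
      intro k
      rw [← ofReal_norm, ← ENNReal.ofReal_pow (norm_nonneg _)]
      refine ENNReal.ofReal_le_ofReal ?_
      refine (pow_le_pow_left₀ (norm_nonneg _) (hνs k t).le 2).trans_eq ?_
      rw [← pow_mul, mul_comm, pow_mul]; norm_num
    refine ne_top_of_le_ne_top ?_ (ENNReal.tsum_le_tsum hle)
    rw [← ENNReal.ofReal_tsum_of_nonneg (fun k => by positivity)
      (summable_geometric_of_lt_one (by norm_num) (by norm_num))]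
    exact ENNReal.ofReal_ne_top)
  filter_upwards [hlim] with x hx
  rw [ht]
  exact hx.limUnder_eq

/-- Weak convergence in `L^q`, `q > 1`, of a bounded sequence which converges almost everywhere. The
test function is split into its restrictions to a set where the convergence is dominated and to a
set where its norm in `L^{q'}` is small. -/
theorem tendsto_integral_mul_of_ae_tendsto [IsFiniteMeasure m] {q q' : ℝ}
    (hq : q.HolderConjugate q') {F : ℕ → X → ℝ} {F' Ξ : X → ℝ} {K : ℝ≥0∞} (hK : K ≠ ⊤)
    (hF : ∀ n, AEStronglyMeasurable (F n) m) (hb : ∀ n, eLpNorm (F n) (ENNReal.ofReal q) m ≤ K)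
    (hlim : ∀ᵐ x ∂m, Tendsto (fun n => F n x) atTop (𝓝 (F' x)))
    (hΞ : MemLp Ξ (ENNReal.ofReal q') m) :
    MemLp F' (ENNReal.ofReal q) m ∧
      Tendsto (fun n => ∫ x, F n x * Ξ x ∂m) atTop (𝓝 (∫ x, F' x * Ξ x ∂m)) := by
  have hF'm : AEStronglyMeasurable F' m := aestronglyMeasurable_of_tendsto_ae atTop hF hlim
  have hF'b : eLpNorm F' (ENNReal.ofReal q) m ≤ K :=
    Lp.eLpNorm_le_of_ae_tendsto (u := atTop) (Eventually.of_forall hb) hF hlim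
  have hF' : MemLp F' (ENNReal.ofReal q) m := ⟨hF'm, hF'b.trans_lt hK.lt_top⟩
  refine ⟨hF', ?_⟩
  have : ENNReal.HolderConjugate (ENNReal.ofReal q) (ENNReal.ofReal q') := hq.ennrealOfReal
  have hFL : ∀ n, MemLp (F n) (ENNReal.ofReal q) m := fun n => ⟨hF n, (hb n).trans_lt hK.lt_top⟩
  have hi : ∀ n, Integrable (fun x => F n x * Ξ x) m := fun n => (hFL n).integrable_mul hΞ
  have hi' : Integrable (fun x => F' x * Ξ x) m := hF'.integrable_mul hΞ
  refine tendsto_integral_of_L1 _ hi'.1 (Eventually.of_forall hi) ?_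
  have hq1 : 1 ≤ ENNReal.ofReal q' := by
    rw [← ENNReal.ofReal_one]; exact ENNReal.ofReal_le_ofReal hq.symm.lt.le
  have hΞ1 : Integrable Ξ m := hΞ.integrable hq1
  -- for a level `N`, the set where the tail of the sequence is `1`-close to its limit
  set A : ℕ → Set X := fun N => {x | ∃ n, N ≤ n ∧ 1 < ‖F n x - F' x‖ₑ} with hA
  have hAm : ∀ N, NullMeasurableSet (A N) m := by
    intro N
    have : A N = ⋃ n, ⋃ (_ : N ≤ n), {x | 1 < ‖F n x - F' x‖ₑ} := by
      ext x; simp [hA]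
    rw [this]
    exact NullMeasurableSet.iUnion fun n => NullMeasurableSet.iUnion fun _ =>
      nullMeasurableSet_lt aemeasurable_const ((hF n).sub hF'm).enorm
  have htail : Tendsto (fun N => eLpNorm ((A N).indicator Ξ) (ENNReal.ofReal q') m) atTop
      (𝓝 0) := by
    have h0 : ENNReal.ofReal q' ≠ 0 := by simpa using hq.symm.pos
    have hpw : Tendsto (fun N => ∫⁻ x, ‖(A N).indicator Ξ x‖ₑ ^ q' ∂m) atTop (𝓝 0) := by
      have hl : Tendsto (fun N => ∫⁻ x, ‖(A N).indicator Ξ x‖ₑ ^ q' ∂m) atTop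
          (𝓝 (∫⁻ _, 0 ∂m)) := by
        refine tendsto_lintegral_of_dominated_convergence' (fun x => ‖Ξ x‖ₑ ^ q')
          (fun N => ((hΞ.1.indicator₀ (hAm N)).enorm.pow_const _)) (fun N => ?_) ?_ ?_
        · refine Eventually.of_forall fun x => ?_
          simp only
          gcongr
          · exact hq.symm.nonneg
          · exact enorm_indicator_le_enorm_self _ _
        · have := lintegral_rpow_enorm_lt_top_of_eLpNorm_lt_top h0 ENNReal.ofReal_ne_top hΞ.2
          rw [ENNReal.toReal_ofReal hq.symm.nonneg] at this
          exact this.ne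
        · filter_upwards [hlim] with x hx
          refine tendsto_const_nhds.congr' ?_
          have h1 := tendsto_iff_edist_tendsto_0.1 hx
          obtain ⟨N0, hN0⟩ := (h1.eventually (gt_mem_nhds one_pos)).exists_forall_of_atTop
          filter_upwards [eventually_ge_atTop N0] with N hN
          rw [indicator_of_notMem]
          · simp [hq.symm.pos]
          · rintro ⟨n, hn, h2⟩
            have := hN0 n (hN.trans hn)
            rw [edist_eq_enorm_sub] at this
            exact absurd h2 this.le.not_gt
      simpa using hl
    have h1 := ((ENNReal.continuous_rpow_const (y := 1 / q')).tendsto 0).comp hpw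
    rw [ENNReal.zero_rpow_of_pos (one_div_pos.2 hq.symm.pos)] at h1
    refine h1.congr fun N => ?_
    rw [eLpNorm_eq_lintegral_rpow_enorm_toReal h0 ENNReal.ofReal_ne_top,
      ENNReal.toReal_ofReal hq.symm.nonneg]
    rfl
  have hgood : ∀ N, Tendsto (fun n => ∫⁻ x, ‖(F n x - F' x) * (A N)ᶜ.indicator Ξ x‖ₑ ∂m) atTop
      (𝓝 0) := by
    intro N
    rw [← tendsto_add_atTop_iff_nat N]
    have hl : Tendsto (fun n => ∫⁻ x, ‖(F (n + N) x - F' x) * (A N)ᶜ.indicator Ξ x‖ₑ ∂m) atTop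
        (𝓝 (∫⁻ _, 0 ∂m)) := by
      refine tendsto_lintegral_of_dominated_convergence' (fun x => ‖Ξ x‖ₑ)
        (fun n => (((hF _).sub hF'm).mul (hΞ.1.indicator₀ (hAm N).compl)).enorm)
        (fun n => Eventually.of_forall fun x => ?_) hΞ1.2.ne ?_
      · change ‖(F (n + N) x - F' x) * (A N)ᶜ.indicator Ξ x‖ₑ ≤ ‖Ξ x‖ₑ
        by_cases hx : x ∈ A N
        · rw [indicator_of_notMem (by simpa using hx)]; simp
        · rw [indicator_of_mem (by simpa using hx), enorm_mul]
          have : ‖F (n + N) x - F' x‖ₑ ≤ 1 := by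
            by_contra hcon
            exact hx ⟨n + N, by omega, not_le.1 hcon⟩
          calc _ ≤ 1 * ‖Ξ x‖ₑ := by gcongr
            _ = _ := one_mul _
      · filter_upwards [hlim] with x hx
        have h1 := ((hx.comp (tendsto_add_atTop_nat N)).sub_const (F' x)).mul_const
          ((A N)ᶜ.indicator Ξ x)
        rw [sub_self, zero_mul] at h1
        have h2 := h1.enorm
        rw [enorm_zero] at h2
        exact h2
    simpa using hl
  have hsplit : ∀ N n, ∫⁻ x, ‖F n x * Ξ x - F' x * Ξ x‖ₑ ∂m ≤
      2 * K * eLpNorm ((A N).indicator Ξ) (ENNReal.ofReal q') m +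
        ∫⁻ x, ‖(F n x - F' x) * (A N)ᶜ.indicator Ξ x‖ₑ ∂m := by
    intro N n
    have h1 : ∫⁻ x, ‖(F n x - F' x) * (A N).indicator Ξ x‖ₑ ∂m ≤
        2 * K * eLpNorm ((A N).indicator Ξ) (ENNReal.ofReal q') m := by
      have h2 := eLpNorm_smul_le_mul_eLpNorm (p := ENNReal.ofReal q) (q := ENNReal.ofReal q')
        (r := 1) (hΞ.1.indicator₀ (hAm N)) ((hF n).sub hF'm)
      rw [eLpNorm_one_eq_lintegral_enorm] at h2
      refine h2.trans ?_
      gcongr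
      refine (eLpNorm_sub_le (hF n) hF'm hq.ennrealOfReal.one_le).trans ?_
      rw [two_mul]
      exact add_le_add (hb n) hF'b
    refine le_trans ?_ (add_le_add_left h1 _)
    rw [← lintegral_add_left' (f := fun x => ‖(F n x - F' x) * (A N).indicator Ξ x‖ₑ)
      (((hF n).sub hF'm).mul (hΞ.1.indicator₀ (hAm N))).enorm]
    refine lintegral_mono fun x => ?_
    have : F n x * Ξ x - F' x * Ξ x =
        (F n x - F' x) * (A N).indicator Ξ x + (F n x - F' x) * (A N)ᶜ.indicator Ξ x := by
      rw [← mul_add, ← Pi.add_apply, indicator_self_add_compl]; ring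
    rw [this]
    exact enorm_add_le _ _
  rw [ENNReal.tendsto_nhds_zero]
  intro e he
  have h2 : Tendsto (fun N => 2 * K * eLpNorm ((A N).indicator Ξ) (ENNReal.ofReal q') m) atTop
      (𝓝 0) := by
    have := ENNReal.Tendsto.const_mul (a := 2 * K) htail (Or.inr (by finiteness))
    rwa [mul_zero] at this
  obtain ⟨N, hN⟩ := ((ENNReal.tendsto_nhds_zero.1 h2) (e / 2) (by simpa using he.ne')).exists
  filter_upwards [(ENNReal.tendsto_nhds_zero.1 (hgood N)) (e / 2) (by simpa using he.ne')] with n hn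
  calc _ ≤ _ := hsplit N n
    _ ≤ e / 2 + e / 2 := add_le_add hN hn
    _ = e := ENNReal.add_halves e

end

section

/-! ### The nonlinearity -/

/-- The consequences of growth, dissipativity and one-sided Lipschitz continuity that are used for
the nonlinearity `f`: the growth is that of a map `L^p → L^{p'}`. -/
structure IsNonlinearity (f : ℝ → ℝ) (p C : ℝ) : Prop where
  cont : Continuous f
  one_lt : 1 < p
  nonneg : 0 ≤ C
  mono : Monotone fun r => f r + C * r
  growth : ∃ K, 0 ≤ K ∧ ∀ r, |f r| ^ (p / (p - 1)) ≤ K * (1 + |r| ^ p)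
  coercive : ∃ c c', 0 < c ∧ 0 ≤ c' ∧ ∀ r, c * |r| ^ p - c' ≤ f r * r

/-- Away from the origin the growth of `f` follows from that of `f r * r`, near it from
continuity. -/
theorem isNonlinearity_of_H2_H3 {f : ℝ → ℝ} {p C : ℝ} (hp : 1 < p) (h2 : H2 f p) (h3 : H3 f C) :
    IsNonlinearity f p C := by
  obtain ⟨hf, c, d, c', d', hc, hd, hc', hd', hb⟩ := h2
  obtain ⟨-, hC, hC'⟩ := h3
  have hfd : Differentiable ℝ f := hf.differentiable (by simp)
  have hq : 0 ≤ p / (p - 1) := div_nonneg (by linarith) (by linarith)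
  refine ⟨hf.continuous, hp, hC.le, ?_, ?_, ⟨c, d, hc, hd.le, fun r => (hb r).1⟩⟩
  · refine monotone_of_deriv_nonneg (by fun_prop) fun r => ?_
    have : HasDerivAt (fun r => f r + C * r) (deriv f r + C * 1) r :=
      (hfd r).hasDerivAt.add ((hasDerivAt_id r).const_mul C)
    rw [this.deriv]; linarith [hC' r]
  · obtain ⟨M, hM⟩ := isCompact_Icc.exists_bound_of_continuousOn
      (hf.continuous.continuousOn (s := Icc (-1) 1))
    have hM0 : 0 ≤ M := (norm_nonneg _).trans (hM 0 (by simp))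
    set L := c' + d + d' with hL
    have hL0 : 0 ≤ L := by positivity
    refine ⟨M ^ (p / (p - 1)) + L ^ (p / (p - 1)), by positivity, fun r => ?_⟩
    have hr0 : 0 ≤ |r| ^ p := by positivity
    have hMq : 0 ≤ M ^ (p / (p - 1)) := by positivity
    have hLq : 0 ≤ L ^ (p / (p - 1)) := by positivity
    rcases le_or_gt |r| 1 with hr | hr
    · have h1 : |f r| ≤ M := hM r (abs_le.1 hr)
      have h2 := Real.rpow_le_rpow (abs_nonneg _) h1 hq
      nlinarith [mul_nonneg hMq hr0, mul_nonneg hLq hr0]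
    · have hr1 : 1 ≤ |r| ^ p := Real.one_le_rpow hr.le (by linarith)
      have h1 : |f r| * |r| ≤ L * |r| ^ p := by
        rw [← abs_mul, abs_le]
        have := hb r
        constructor <;> nlinarith [mul_nonneg hc.le hr0]
      have h2 : |f r| ≤ L * |r| ^ (p - 1) := by
        rw [Real.rpow_sub_one (by linarith), ← mul_div_assoc, le_div_iff₀ (by linarith)]
        exact h1
      have h3 := Real.rpow_le_rpow (abs_nonneg _) h2 hq
      rw [Real.mul_rpow hL0 (by positivity), ← Real.rpow_mul (abs_nonneg _),
        mul_div_cancel₀ _ (by linarith : p - 1 ≠ 0)] at h3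
      nlinarith [mul_nonneg hMq hr0]

/-- The primitive of the monotone function `r ↦ f r + C r`. -/
def primitive (f : ℝ → ℝ) (C : ℝ) (r : ℝ) : ℝ := ∫ s in (0 : ℝ)..r, (f s + C * s)

namespace IsNonlinearity

variable {f : ℝ → ℝ} {p C : ℝ}

theorem continuous_shift (hf : IsNonlinearity f p C) : Continuous fun r => f r + C * r :=
  hf.cont.add (continuous_const.mul continuous_id)

theorem continuous_primitive (hf : IsNonlinearity f p C) : Continuous (primitive f C) :=
  intervalIntegral.continuous_primitive
    (fun a b => hf.continuous_shift.intervalIntegrable a b) 0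

theorem tangent_le_primitive (hf : IsNonlinearity f p C) (a b : ℝ) :
    primitive f C a + (f a + C * a) * (b - a) ≤ primitive f C b := by
  have hi := fun x y => hf.continuous_shift.intervalIntegrable (μ := volume) x y
  have h1 : primitive f C b - primitive f C a = ∫ s in a..b, (f s + C * s) :=
    intervalIntegral.integral_interval_sub_left (hi 0 b) (hi 0 a)
  have hconst : ∀ x y k : ℝ, ∫ _ in x..y, k = (y - x) * k := fun x y k => by simp
  rcases le_total a b with h | h
  · have h2 : ∫ _ in a..b, (f a + C * a) ≤ ∫ s in a..b, (f s + C * s) :=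
      intervalIntegral.integral_mono_on h (by simp) (hi a b) fun s hs => hf.mono hs.1
    rw [hconst] at h2; linarith
  · have h2 : ∫ s in b..a, (f s + C * s) ≤ ∫ _ in b..a, (f a + C * a) :=
      intervalIntegral.integral_mono_on h (hi b a) (by simp) fun s hs => hf.mono hs.2
    rw [hconst, intervalIntegral.integral_symm] at h2; linarith

theorem primitive_midpoint_le (hf : IsNonlinearity f p C) (a b : ℝ) :
    primitive f C ((a + b) / 2) ≤ (primitive f C a + primitive f C b) / 2 := by
  have h1 := hf.tangent_le_primitive ((a + b) / 2) a
  have h2 := hf.tangent_le_primitive ((a + b) / 2) b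
  nlinarith

theorem primitive_le (hf : IsNonlinearity f p C) (r : ℝ) :
    primitive f C r ≤ (f r + C * r) * r := by
  have h1 := hf.tangent_le_primitive r 0
  have h2 : primitive f C 0 = 0 := by simp [primitive]
  linarith

/-- The primitive has growth of order `p` from below: `f r * r` is compared with the increment of
the primitive over `[r / 2, r]`. -/
theorem exists_le_primitive (hf : IsNonlinearity f p C) :
    ∃ c c' : ℝ, 0 < c ∧ ∀ r, c * |r| ^ p - c' ≤ primitive f C r := by
  obtain ⟨c, c', hc, hc', h⟩ := hf.coercive
  have hp := hf.one_lt
  -- the primitive attains its minimum at a zero `r₀` of its derivative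
  obtain ⟨r₀, hr₀⟩ : ∃ r₀, f r₀ + C * r₀ = 0 := by
    set R := max 1 (c' / c)
    have hR1 : 1 ≤ R := le_max_left _ _
    have hRp : 0 ≤ c * |R| ^ p - c' := by
      have h1 : c' / c ≤ R := le_max_right _ _
      have h2 : R ≤ |R| ^ p := by
        rw [abs_of_pos (by linarith)]; exact Real.self_le_rpow_of_one_le hR1 hp.le
      rw [div_le_iff₀ hc] at h1
      nlinarith
    have h1 := hRp.trans (h R)
    have h2 := h (-R)
    rw [abs_neg] at h2
    have h3 := hRp.trans h2
    have h4 : 0 ≤ f R + C * R := by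
      have : 0 ≤ f R := nonneg_of_mul_nonneg_left h1 (by linarith)
      have := hf.nonneg
      positivity
    have h5 : f (-R) + C * -R ≤ 0 := by
      have : f (-R) ≤ 0 := by nlinarith
      have := mul_nonneg hf.nonneg (by linarith : 0 ≤ R)
      linarith
    obtain ⟨r₀, -, hr₀⟩ := intermediate_value_Icc (by linarith : -R ≤ R)
      hf.continuous_shift.continuousOn ⟨h5, h4⟩
    exact ⟨r₀, hr₀⟩
  have hmin : ∀ r, primitive f C r₀ ≤ primitive f C r := fun r => by
    have := hf.tangent_le_primitive r₀ r
    rwa [hr₀, zero_mul, add_zero] at this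
  refine ⟨c * (1 / 2) ^ p, c' - primitive f C r₀, by positivity, fun r => ?_⟩
  have h1 := hf.tangent_le_primitive (r / 2) r
  have h2 := hmin (r / 2)
  have h3 := h (r / 2)
  have h4 : |r / 2| ^ p = (1 / 2) ^ p * |r| ^ p := by
    rw [← Real.mul_rpow (by norm_num) (abs_nonneg _), abs_div, abs_two]; ring_nf
  rw [h4] at h3
  have h5 := mul_nonneg hf.nonneg (sq_nonneg (r / 2))
  nlinarith

theorem holderConjugate (hf : IsNonlinearity f p C) : p.HolderConjugate (p / (p - 1)) :=
  Real.HolderConjugate.conjExponent hf.one_lt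

theorem ofReal_ne_zero (hf : IsNonlinearity f p C) : ENNReal.ofReal p ≠ 0 := by
  simpa using zero_lt_one.trans hf.one_lt

section Integrability

variable {X : Type*} [MeasurableSpace X] {m : Measure X} {w ζ : X → ℝ}

theorem memLp_iff_integrable (hf : IsNonlinearity f p C) (hw : AEStronglyMeasurable w m) :
    MemLp w (ENNReal.ofReal p) m ↔ Integrable (fun x => |w x| ^ p) m := by
  have h := integrable_norm_rpow_iff hw hf.ofReal_ne_zero ENNReal.ofReal_ne_top
  rw [ENNReal.toReal_ofReal (zero_le_one.trans hf.one_lt.le)] at h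
  exact h.symm

theorem memLp_comp [IsFiniteMeasure m] (hf : IsNonlinearity f p C)
    (hw : MemLp w (ENNReal.ofReal p) m) :
    MemLp (fun x => f (w x)) (ENNReal.ofReal (p / (p - 1))) m := by
  have hq := hf.holderConjugate.symm.pos
  have hm : AEStronglyMeasurable (fun x => f (w x)) m := hf.cont.comp_aestronglyMeasurable hw.1
  have h := integrable_norm_rpow_iff hm (p := ENNReal.ofReal (p / (p - 1)))
    (by simpa using hq) ENNReal.ofReal_ne_top
  rw [← h, ENNReal.toReal_ofReal hq.le]
  obtain ⟨K, hK, hg⟩ := hf.growth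
  refine Integrable.mono' (((integrable_const 1).add
    ((hf.memLp_iff_integrable hw.1).1 hw)).const_mul K)
    (hm.norm.aemeasurable.pow_const _).aestronglyMeasurable (Eventually.of_forall ?_)
  intro x
  rw [Real.norm_eq_abs, Real.norm_eq_abs, abs_of_nonneg (by positivity)]
  exact hg (w x)

theorem integrable_mul [IsFiniteMeasure m] (hf : IsNonlinearity f p C)
    (hw : MemLp w (ENNReal.ofReal p) m) (hζ : MemLp ζ (ENNReal.ofReal p) m) :
    Integrable (fun x => f (w x) * ζ x) m :=
  have : ENNReal.HolderConjugate (ENNReal.ofReal (p / (p - 1))) (ENNReal.ofReal p) :=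
    hf.holderConjugate.symm.ennrealOfReal
  (hf.memLp_comp hw).integrable_mul hζ

theorem integrable_shift_mul [IsFiniteMeasure m] (hf : IsNonlinearity f p C)
    (hw : MemLp w (ENNReal.ofReal p) m) (hw2 : MemLp w 2 m)
    (hζ : MemLp ζ (ENNReal.ofReal p) m) (hζ2 : MemLp ζ 2 m) :
    Integrable (fun x => (f (w x) + C * w x) * ζ x) m := by
  have h1 := (hf.integrable_mul hw hζ).add ((hw2.integrable_mul hζ2).const_mul C)
  refine h1.congr (Eventually.of_forall fun x => ?_)
  simp only [Pi.add_apply, Pi.mul_apply]; ring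

theorem integrable_primitive [IsFiniteMeasure m] (hf : IsNonlinearity f p C)
    (hw : MemLp w (ENNReal.ofReal p) m) (hw2 : MemLp w 2 m) :
    Integrable (fun x => primitive f C (w x)) m := by
  obtain ⟨c, c', hc, hcc⟩ := hf.exists_le_primitive
  have hup := hf.integrable_shift_mul hw hw2 hw hw2
  refine integrable_of_le_of_le (g₁ := fun _ => -c')
    (hf.continuous_primitive.comp_aestronglyMeasurable hw.1)
    (Eventually.of_forall fun x => ?_) (Eventually.of_forall fun x => hf.primitive_le (w x))
    (integrable_const _) hup
  have := hcc (w x)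
  have : 0 ≤ c * |w x| ^ p := by positivity
  simp only
  linarith

end Integrability

end IsNonlinearity

end

section

/-! ### The stationary operator -/

variable {X : Type*} [MeasurableSpace X] {m : Measure X} {V : Type*} [NormedAddCommGroup V]
  [InnerProductSpace ℝ V]

/-- The energy form: the inner product of the energy space without its `L²` part. -/
def energyForm (j : V →L[ℝ] Lp ℝ 2 m) (v w : V) : ℝ := ⟪v, w⟫ - ⟪j v, j w⟫

/-- The elements of the energy space whose underlying function lies in `L^p`. -/
def MemEnergyLp (j : V →L[ℝ] Lp ℝ 2 m) (p : ℝ) (v : V) : Prop := MemLp (j v) (ENNReal.ofReal p) m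

/-- `b` is the value at `j v` of the operator `u ↦ A u + f(u) + C u`, where `A` is the operator of
the energy form; test functions are the elements of the energy space that lie in `L^p`. -/
def EnergyRel (j : V →L[ℝ] Lp ℝ 2 m) (f : ℝ → ℝ) (p C : ℝ) (v : V) (b : Lp ℝ 2 m) : Prop :=
  MemEnergyLp j p v ∧ ∀ ξ, MemEnergyLp j p ξ →
    energyForm j v ξ + ∫ x, (f (j v x) + C * j v x) * j ξ x ∂m = ⟪b, j ξ⟫

theorem L2_inner_eq_integral (a b : Lp ℝ 2 m) : ⟪a, b⟫ = ∫ x, a x * b x ∂m := by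
  rw [L2.inner_def]
  refine integral_congr_ae (Eventually.of_forall fun x => ?_)
  simp [mul_comm]

namespace MemEnergyLp

variable {j : V →L[ℝ] Lp ℝ 2 m} {p : ℝ} {v w : V}

theorem add (hv : MemEnergyLp j p v) (hw : MemEnergyLp j p w) : MemEnergyLp j p (v + w) := by
  rw [MemEnergyLp, map_add]
  exact (memLp_congr_ae (Lp.coeFn_add _ _)).2 (MemLp.add hv hw)

theorem sub (hv : MemEnergyLp j p v) (hw : MemEnergyLp j p w) : MemEnergyLp j p (v - w) := by
  rw [MemEnergyLp, map_sub]
  exact (memLp_congr_ae (Lp.coeFn_sub _ _)).2 (MemLp.sub hv hw)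

theorem smul (c : ℝ) (hv : MemEnergyLp j p v) : MemEnergyLp j p (c • v) := by
  rw [MemEnergyLp, map_smul]
  exact (memLp_congr_ae (Lp.coeFn_smul _ _)).2 (MemLp.const_smul hv c)

end MemEnergyLp

variable {j : V →L[ℝ] Lp ℝ 2 m} {f : ℝ → ℝ} {p C : ℝ}

theorem energyForm_self (v : V) : energyForm j v v = ‖v‖ ^ 2 - ‖j v‖ ^ 2 := by
  rw [energyForm, real_inner_self_eq_norm_sq, real_inner_self_eq_norm_sq]

theorem energyForm_sub_right (v w z : V) :
    energyForm j v (w - z) = energyForm j v w - energyForm j v z := by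
  simp only [energyForm, map_sub, inner_sub_right]; ring

theorem energyForm_comm (v w : V) : energyForm j v w = energyForm j w v := by
  simp only [energyForm, real_inner_comm]

theorem energyForm_self_nonneg (hj : ∀ v, ‖j v‖ ≤ ‖v‖) (v : V) : 0 ≤ energyForm j v v := by
  rw [energyForm_self]
  have := pow_le_pow_left₀ (norm_nonneg _) (hj v) 2
  linarith

theorem abs_energyForm_le (hj : ∀ v, ‖j v‖ ≤ ‖v‖) (v w : V) :
    |energyForm j v w| ≤ 2 * (‖v‖ * ‖w‖) := by
  have h1 := abs_real_inner_le_norm v w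
  have h2 := abs_real_inner_le_norm (j v) (j w)
  have h3 := mul_le_mul (hj v) (hj w) (norm_nonneg _) (norm_nonneg _)
  refine (abs_sub _ _).trans ?_
  linarith

theorem continuous_energyForm : Continuous fun q : V × V => energyForm j q.1 q.2 := by
  unfold energyForm; fun_prop

/-- The nonlinearity contributes a nonnegative term to the pairing of differences; the form
contributes their energy. -/
theorem EnergyRel.mono [IsFiniteMeasure m] (hf : IsNonlinearity f p C) {v w : V}
    {b d : Lp ℝ 2 m} (hv : EnergyRel j f p C v b) (hw : EnergyRel j f p C w d) :
    ‖v - w‖ ^ 2 - ‖j v - j w‖ ^ 2 ≤ ⟪b - d, j v - j w⟫ := by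
  have hs := hv.1.sub hw.1
  have e1 := hv.2 _ hs
  have e2 := hw.2 _ hs
  rw [← map_sub, inner_sub_left, ← e1, ← e2]
  have e3 : energyForm j v (v - w) - energyForm j w (v - w) = ‖v - w‖ ^ 2 - ‖j (v - w)‖ ^ 2 := by
    rw [← energyForm_self, energyForm, energyForm, energyForm, map_sub]
    simp only [inner_sub_left]; ring
  have e4 : ∫ x, (f (j w x) + C * j w x) * j (v - w) x ∂m ≤
      ∫ x, (f (j v x) + C * j v x) * j (v - w) x ∂m := by
    refine integral_mono_ae (hf.integrable_shift_mul hw.1 (Lp.memLp _) hs (Lp.memLp _))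
      (hf.integrable_shift_mul hv.1 (Lp.memLp _) hs (Lp.memLp _)) ?_
    rw [map_sub]
    filter_upwards [Lp.coeFn_sub (j v) (j w)] with x hx
    rw [hx, Pi.sub_apply]
    rcases le_total (j v x) (j w x) with h | h
    · have := hf.mono h
      simp only at this
      nlinarith
    · have := hf.mono h
      simp only at this
      nlinarith
  linarith

theorem EnergyRel.unique {v : V} {b d : Lp ℝ 2 m}
    (hdense : Dense {x : Lp ℝ 2 m | ∃ ξ, MemEnergyLp j p ξ ∧ j ξ = x})
    (hv : EnergyRel j f p C v b) (hw : EnergyRel j f p C v d) : b = d := by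
  refine ext_inner_right ℝ fun x => ?_
  have h : EqOn (fun x => ⟪b, x⟫) (fun x => ⟪d, x⟫)
      {x : Lp ℝ 2 m | ∃ ξ, MemEnergyLp j p ξ ∧ j ξ = x} := by
    rintro _ ⟨ξ, hξ, rfl⟩
    simp only
    rw [← hv.2 ξ hξ, ← hw.2 ξ hξ]
  exact congrFun (Continuous.ext_on hdense (by fun_prop) (by fun_prop) h) x

/-- Fatou's lemma for the convex potential. The potential controls `L^p`, so membership in `L^p`
passes to the limit as well. -/
theorem memLp_and_integral_primitive_le [IsFiniteMeasure m] (hf : IsNonlinearity f p C)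
    {w : ℕ → Lp ℝ 2 m} {w' : Lp ℝ 2 m} (hw : Tendsto w atTop (𝓝 w'))
    (hwp : ∀ n, MemLp (w n) (ENNReal.ofReal p) m) {a : ℕ → ℝ} {a' : ℝ}
    (ha : Tendsto a atTop (𝓝 a')) (hle : ∀ n, ∫ x, primitive f C (w n x) ∂m ≤ a n) :
    MemLp w' (ENNReal.ofReal p) m ∧ ∫ x, primitive f C (w' x) ∂m ≤ a' := by
  obtain ⟨ns, hns, hae⟩ := exists_subseq_ae_tendsto hw
  obtain ⟨c, c', hc, hcc⟩ := hf.exists_le_primitive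
  set k : ℝ := m.real univ * c' with hk
  have hG0 : ∀ r, c * |r| ^ p ≤ primitive f C r + c' := fun r => by linarith [hcc r]
  have hG00 : ∀ r, 0 ≤ primitive f C r + c' := fun r => le_trans (by positivity) (hG0 r)
  have hGm : ∀ u : Lp ℝ 2 m, AEStronglyMeasurable (fun x => primitive f C (u x) + c') m :=
    fun u => ((hf.continuous_primitive.comp_aestronglyMeasurable
      (Lp.aestronglyMeasurable u))).add aestronglyMeasurable_const
  have hfat : ∫⁻ x, ENNReal.ofReal (primitive f C (w' x) + c') ∂m ≤ ENNReal.ofReal (a' + k) := by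
    have h1 : ∀ᵐ x ∂m, ENNReal.ofReal (primitive f C (w' x) + c') ≤
        liminf (fun n => ENNReal.ofReal (primitive f C (w (ns n) x) + c')) atTop := by
      filter_upwards [hae] with x hx
      have h2 : Tendsto (fun n => ENNReal.ofReal (primitive f C (w (ns n) x) + c')) atTop
          (𝓝 (ENNReal.ofReal (primitive f C (w' x) + c'))) :=
        (ENNReal.continuous_ofReal.tendsto _).comp
          (((hf.continuous_primitive.tendsto _).comp hx).add_const c')
      exact h2.liminf_eq.ge
    refine (lintegral_mono_ae h1).trans ?_
    refine (lintegral_liminf_le' fun n => (hGm _).aemeasurable.ennreal_ofReal).trans ?_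
    have h3 : Tendsto (fun n => ENNReal.ofReal (a (ns n) + k)) atTop
        (𝓝 (ENNReal.ofReal (a' + k))) :=
      (ENNReal.continuous_ofReal.tendsto _).comp
        ((ha.comp hns.tendsto_atTop).add_const k)
    rw [← h3.liminf_eq]
    refine liminf_le_liminf (Eventually.of_forall fun n => ?_)
    rw [← ofReal_integral_eq_lintegral_ofReal (f := fun x => primitive f C (w (ns n) x) + c')
      ((hf.integrable_primitive (hwp _) (Lp.memLp _)).add (integrable_const _))
      (Eventually.of_forall fun x => hG00 _)]
    refine ENNReal.ofReal_le_ofReal ?_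
    rw [integral_add (hf.integrable_primitive (hwp _) (Lp.memLp _)) (integrable_const _),
      integral_const, smul_eq_mul]
    exact add_le_add_left (hle _) _
  have hint : Integrable (fun x => primitive f C (w' x) + c') m := by
    refine ⟨hGm w', ?_⟩
    rw [hasFiniteIntegral_iff_ofReal (Eventually.of_forall fun x => hG00 _)]
    exact hfat.trans_lt ENNReal.ofReal_lt_top
  have hmem : MemLp w' (ENNReal.ofReal p) m := by
    rw [hf.memLp_iff_integrable (Lp.aestronglyMeasurable _)]
    refine Integrable.mono' (hint.const_mul c⁻¹)
      ((Lp.aestronglyMeasurable w').norm.aemeasurable.pow_const _).aestronglyMeasurable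
      (Eventually.of_forall fun x => ?_)
    rw [Real.norm_eq_abs, abs_of_nonneg (by positivity), le_inv_mul_iff₀ hc]
    exact hG0 _
  refine ⟨hmem, ?_⟩
  rw [← ofReal_integral_eq_lintegral_ofReal hint (Eventually.of_forall fun x => hG00 _),
    integral_add (hf.integrable_primitive hmem (Lp.memLp _)) (integrable_const _),
    integral_const, smul_eq_mul] at hfat
  by_cases h0 : 0 ≤ a' + k
  · have := (ENNReal.ofReal_le_ofReal_iff h0).1 hfat
    linarith
  · have h1 : ∀ n, 0 ≤ a n + k := by
      intro n
      have h2 : 0 ≤ ∫ x, (primitive f C (w n x) + c') ∂m := integral_nonneg fun x => hG00 _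
      rw [integral_add (hf.integrable_primitive (hwp _) (Lp.memLp _)) (integrable_const _),
        integral_const, smul_eq_mul] at h2
      linarith [hle n]
    exact absurd (ge_of_tendsto' (ha.add_const k) h1) h0

theorem L2.norm_sq_eq_integral (a : Lp ℝ 2 m) : ‖a‖ ^ 2 = ∫ x, a x * a x ∂m := by
  rw [← real_inner_self_eq_norm_sq, L2_inner_eq_integral]

/-- Convexity of the integral functional, as an inequality between its values and its derivative
along a segment. -/
theorem integral_primitive_add_smul_le [IsFiniteMeasure m] (hf : IsNonlinearity f p C)
    {v ξ : V} (hv : MemEnergyLp j p v) (hξ : MemEnergyLp j p ξ) (ε : ℝ) :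
    ∫ x, primitive f C (j (v + ε • ξ) x) ∂m ≤ ∫ x, primitive f C (j v x) ∂m +
      ε * ∫ x, (f (j (v + ε • ξ) x) + C * j (v + ε • ξ) x) * j ξ x ∂m := by
  have hvξ := hv.add (hξ.smul ε)
  rw [← integral_const_mul, ← integral_add (hf.integrable_primitive hv (Lp.memLp _))
    ((hf.integrable_shift_mul hvξ (Lp.memLp _) hξ (Lp.memLp _)).const_mul ε)]
  refine integral_mono_ae (hf.integrable_primitive hvξ (Lp.memLp _))
    ((hf.integrable_primitive hv (Lp.memLp _)).add
    ((hf.integrable_shift_mul hvξ (Lp.memLp _) hξ (Lp.memLp _)).const_mul ε)) ?_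
  rw [map_add, map_smul]
  filter_upwards [Lp.coeFn_add (j v) (ε • j ξ), Lp.coeFn_smul ε (j ξ)] with x h1 h2
  have h3 := hf.tangent_le_primitive ((j v + ε • j ξ : Lp ℝ 2 m) x) (j v x)
  have h4 : (j v + ε • j ξ : Lp ℝ 2 m) x = j v x + ε * j ξ x := by
    rw [h1, Pi.add_apply, h2, Pi.smul_apply, smul_eq_mul]
  rw [h4] at h3 ⊢
  linarith

/-- Differentiability of the integral functional along a segment, in the form of one-sided
continuity of its derivative. -/
theorem IsNonlinearity.tendsto_integral_shift_mul [IsFiniteMeasure m]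
    (hf : IsNonlinearity f p C) {a z : X → ℝ} (ha : MemLp a (ENNReal.ofReal p) m)
    (ha2 : MemLp a 2 m) (hz : MemLp z (ENNReal.ofReal p) m) (hz2 : MemLp z 2 m) :
    Tendsto (fun ε : ℝ => ∫ x, (f (a x + ε * z x) + C * (a x + ε * z x)) * z x ∂m) (𝓝[>] 0)
      (𝓝 (∫ x, (f (a x) + C * a x) * z x ∂m)) := by
  obtain ⟨g, hg⟩ : ∃ g : ℝ → ℝ, ∀ r, f r + C * r = g r := ⟨_, fun _ => rfl⟩
  have hgc : Continuous g := hf.continuous_shift.congr hg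
  have hgm : Monotone g := fun r r' h => by rw [← hg, ← hg]; exact hf.mono h
  simp only [hg]
  -- monotonicity bounds the integrand for `|ε| ≤ 1` by its values at `a ± |z|`
  have hbi : ∀ ζ : X → ℝ, MemLp ζ (ENNReal.ofReal p) m → MemLp ζ 2 m →
      Integrable (fun x => |g (ζ x)| * |z x|) m := by
    intro ζ h1 h2
    refine (hf.integrable_shift_mul h1 h2 hz hz2).abs.congr
      (Eventually.of_forall fun x => ?_)
    simp only [hg, abs_mul]
  have hb1 := hbi (fun x => a x + |z x|) (ha.add hz.abs) (ha2.add hz2.abs)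
  have hb2 := hbi (fun x => a x - |z x|) (ha.sub hz.abs) (ha2.sub hz2.abs)
  refine tendsto_integral_filter_of_dominated_convergence _ (Eventually.of_forall fun ε => ?_) ?_
    (hb1.add hb2) (Eventually.of_forall fun x => ?_)
  · exact (hgc.comp_aestronglyMeasurable (ha.1.add (hz.1.const_mul ε))).mul hz.1
  · filter_upwards [Ioo_mem_nhdsGT one_pos] with ε hε
    refine Eventually.of_forall fun x => ?_
    simp only [Pi.add_apply]
    rw [norm_mul, Real.norm_eq_abs, Real.norm_eq_abs, ← add_mul]
    refine mul_le_mul_of_nonneg_right ?_ (abs_nonneg _)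
    have h0 : |ε * z x| ≤ |z x| := by
      rw [abs_mul, abs_of_pos hε.1]
      exact mul_le_of_le_one_left (abs_nonneg _) hε.2.le
    have h1 : g (a x - |z x|) ≤ g (a x + ε * z x) := hgm (by linarith [neg_le_of_abs_le h0])
    have h2 : g (a x + ε * z x) ≤ g (a x + |z x|) := hgm (by linarith [le_of_abs_le h0])
    rw [abs_le]
    constructor
    · linarith [neg_abs_le (g (a x - |z x|)), abs_nonneg (g (a x + |z x|))]
    · linarith [le_abs_self (g (a x + |z x|)), abs_nonneg (g (a x - |z x|))]
  · have h1 : Continuous fun ε : ℝ => g (a x + ε * z x) * z x := by fun_prop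
    have h2 := (h1.tendsto 0).mono_left (nhdsWithin_le_nhds (s := Ioi 0))
    simpa using h2

theorem tendsto_integral_shift_mul [IsFiniteMeasure m] (hf : IsNonlinearity f p C)
    {v ξ : V} (hv : MemEnergyLp j p v) (hξ : MemEnergyLp j p ξ) :
    Tendsto (fun ε : ℝ => ∫ x, (f (j (v + ε • ξ) x) + C * j (v + ε • ξ) x) * j ξ x ∂m) (𝓝[>] 0)
      (𝓝 (∫ x, (f (j v x) + C * j v x) * j ξ x ∂m)) := by
  refine (hf.tendsto_integral_shift_mul hv (Lp.memLp _) hξ (Lp.memLp _)).congr fun ε => ?_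
  refine integral_congr_ae ?_
  rw [map_add, map_smul]
  filter_upwards [Lp.coeFn_add (j v) (ε • j ξ), Lp.coeFn_smul ε (j ξ)] with x h1 h2
  rw [h1, Pi.add_apply, h2, Pi.smul_apply, smul_eq_mul]

end

section

/-! ### Resolvents by minimisation -/

variable {X : Type*} [MeasurableSpace X] {m : Measure X} {V : Type*} [NormedAddCommGroup V]
  [InnerProductSpace ℝ V] {j : V →L[ℝ] Lp ℝ 2 m} {f : ℝ → ℝ} {p C : ℝ}

theorem memEnergyLp_zero : MemEnergyLp j p 0 := by
  rw [MemEnergyLp, map_zero]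
  exact (memLp_congr_ae (Lp.coeFn_zero _ _ _)).2 MemLp.zero

/-- The functional whose minimiser is the resolvent at `x`. -/
def resolventFunctional (j : V →L[ℝ] Lp ℝ 2 m) (f : ℝ → ℝ) (C κ : ℝ) (x : Lp ℝ 2 m) (v : V) : ℝ :=
  energyForm j v v / 2 + κ * ‖j v - x‖ ^ 2 + ∫ y, primitive f C (j v y) ∂m

/-- For `κ ≥ 1 / 2` the quadratic part dominates half the squared norm of `V`, which makes the
functional uniformly convex. -/
theorem resolventFunctional_midpoint_le [IsFiniteMeasure m] (hf : IsNonlinearity f p C) {κ : ℝ}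
    (hκ : 1 / 2 ≤ κ) (x : Lp ℝ 2 m) {v w : V} (hv : MemEnergyLp j p v) (hw : MemEnergyLp j p w) :
    resolventFunctional j f C κ x ((1 / 2 : ℝ) • (v + w)) ≤
      (resolventFunctional j f C κ x v + resolventFunctional j f C κ x w) / 2 -
        ‖v - w‖ ^ 2 / 8 := by
  have hmid := (hv.add hw).smul (1 / 2)
  have hG : ∫ y, primitive f C (j ((1 / 2 : ℝ) • (v + w)) y) ∂m ≤
      ∫ y, (1 / 2 * primitive f C (j v y) + 1 / 2 * primitive f C (j w y)) ∂m := by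
    refine integral_mono_ae (hf.integrable_primitive hmid (Lp.memLp _))
      (((hf.integrable_primitive hv (Lp.memLp _)).const_mul _).add
        ((hf.integrable_primitive hw (Lp.memLp _)).const_mul _)) ?_
    rw [map_smul, map_add]
    filter_upwards [Lp.coeFn_smul (1 / 2 : ℝ) (j v + j w), Lp.coeFn_add (j v) (j w)] with y h1 h2
    rw [h1, Pi.smul_apply, h2, Pi.add_apply, smul_eq_mul]
    have := hf.primitive_midpoint_le (j v y) (j w y)
    have e : 1 / 2 * (j v y + j w y) = (j v y + j w y) / 2 := by ring
    rw [e]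
    linarith
  rw [integral_add ((hf.integrable_primitive hv (Lp.memLp _)).const_mul _)
    ((hf.integrable_primitive hw (Lp.memLp _)).const_mul _), integral_const_mul,
    integral_const_mul] at hG
  have hE : energyForm j ((1 / 2 : ℝ) • (v + w)) ((1 / 2 : ℝ) • (v + w)) =
      (energyForm j v v + energyForm j w w) / 2 - energyForm j (v - w) (v - w) / 4 := by
    simp only [energyForm, map_smul, map_add, map_sub, inner_smul_left, inner_smul_right,
      inner_add_left, inner_add_right, inner_sub_left, inner_sub_right, real_inner_comm v w,
      real_inner_comm (j v) (j w)]
    norm_num; ring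
  have hN : ‖j ((1 / 2 : ℝ) • (v + w)) - x‖ ^ 2 =
      (‖j v - x‖ ^ 2 + ‖j w - x‖ ^ 2) / 2 - ‖j (v - w)‖ ^ 2 / 4 := by
    have e1 : j ((1 / 2 : ℝ) • (v + w)) - x = (1 / 2 : ℝ) • ((j v - x) + (j w - x)) := by
      rw [map_smul, map_add, smul_add, smul_add, smul_sub, smul_sub]
      have : x = (1 / 2 : ℝ) • x + (1 / 2 : ℝ) • x := by rw [← add_smul]; norm_num
      nth_rewrite 1 [this]; abel
    have e2 : j (v - w) = (j v - x) - (j w - x) := by rw [map_sub]; abel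
    rw [e1, e2, norm_smul, mul_pow, norm_add_sq_real, norm_sub_sq_real (j v - x) (j w - x)]
    norm_num; ring
  rw [energyForm_self (v - w)] at hE
  simp only [resolventFunctional, hE, hN]
  have := mul_nonneg (by linarith : 0 ≤ κ - 1 / 2) (sq_nonneg ‖j (v - w)‖)
  nlinarith

/-- Minimising sequences are Cauchy sequences in `V` by uniform convexity, and the functional is
lower semicontinuous by Fatou's lemma. -/
theorem exists_isMinOn_resolventFunctional [CompleteSpace V] [IsFiniteMeasure m]
    (hf : IsNonlinearity f p C) (hj : ∀ v, ‖j v‖ ≤ ‖v‖) {κ : ℝ} (hκ : 1 / 2 ≤ κ) (x : Lp ℝ 2 m) :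
    ∃ v, MemEnergyLp j p v ∧ ∀ w, MemEnergyLp j p w →
      resolventFunctional j f C κ x v ≤ resolventFunctional j f C κ x w := by
  set Ψ := resolventFunctional j f C κ x with hΨ
  set S := {v : V | MemEnergyLp j p v} with hS
  obtain ⟨c, c', hc, hcc⟩ := hf.exists_le_primitive
  have hbdd : BddBelow (Ψ '' S) := by
    refine ⟨m.real univ * -c', ?_⟩
    rintro _ ⟨v, hv, rfl⟩
    have h1 : ∫ _, -c' ∂m ≤ ∫ y, primitive f C (j v y) ∂m := by
      refine integral_mono (integrable_const _) (hf.integrable_primitive hv (Lp.memLp _))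
        fun y => ?_
      have := hcc (j v y)
      have : 0 ≤ c * |j v y| ^ p := by positivity
      simp only
      linarith
    rw [integral_const, smul_eq_mul] at h1
    have h2 := energyForm_self_nonneg hj v
    have h3 : 0 ≤ κ * ‖j v - x‖ ^ 2 := by positivity
    simp only [hΨ, resolventFunctional]
    linarith
  have hne : (Ψ '' S).Nonempty := ⟨Ψ 0, 0, memEnergyLp_zero, rfl⟩
  set I := sInf (Ψ '' S)
  have hI : ∀ v, MemEnergyLp j p v → I ≤ Ψ v := fun v hv => csInf_le hbdd ⟨v, hv, rfl⟩
  have hseq : ∀ n : ℕ, ∃ v, MemEnergyLp j p v ∧ Ψ v < I + 1 / ((n : ℝ) + 1) := by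
    intro n
    obtain ⟨_, ⟨v, hv, rfl⟩, h⟩ := exists_lt_of_csInf_lt hne
      (lt_add_of_pos_right I (Nat.one_div_pos_of_nat (n := n)))
    exact ⟨v, hv, h⟩
  choose v hv hvI using hseq
  have hcau : CauchySeq v := by
    have hl : Tendsto (fun N : ℕ => √(8 * (1 / ((N : ℝ) + 1)))) atTop (𝓝 0) := by
      have := (tendsto_one_div_add_atTop_nhds_zero_nat (𝕜 := ℝ)).const_mul 8
      have h2 := (Real.continuous_sqrt.tendsto _).comp this
      rw [mul_zero, Real.sqrt_zero] at h2
      exact h2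
    refine cauchySeq_of_le_tendsto_0 _ (fun n k N hn hk => ?_) hl
    rw [dist_eq_norm]
    refine Real.le_sqrt_of_sq_le ?_
    have h1 := resolventFunctional_midpoint_le hf hκ x (hv n) (hv k)
    have h2 := hI _ (((hv n).add (hv k)).smul (1 / 2))
    have h3 : 1 / ((n : ℝ) + 1) ≤ 1 / ((N : ℝ) + 1) := Nat.one_div_le_one_div hn
    have h4 : 1 / ((k : ℝ) + 1) ≤ 1 / ((N : ℝ) + 1) := Nat.one_div_le_one_div hk
    have h5 := hvI n
    have h6 := hvI k
    simp only [hΨ] at h2 h5 h6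
    linarith
  obtain ⟨v', hv'⟩ := cauchySeq_tendsto_of_complete hcau
  have hjv : Tendsto (fun n => j (v n)) atTop (𝓝 (j v')) := (j.continuous.tendsto _).comp hv'
  have hQ : Tendsto (fun n => energyForm j (v n) (v n) / 2 + κ * ‖j (v n) - x‖ ^ 2) atTop
      (𝓝 (energyForm j v' v' / 2 + κ * ‖j v' - x‖ ^ 2)) := by
    have h1 : Continuous fun v => energyForm j v v / 2 + κ * ‖j v - x‖ ^ 2 := by
      unfold energyForm; fun_prop
    exact (h1.tendsto v').comp hv'
  have ha : Tendsto (fun n : ℕ => I + 1 / ((n : ℝ) + 1) -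
      (energyForm j (v n) (v n) / 2 + κ * ‖j (v n) - x‖ ^ 2)) atTop
      (𝓝 (I + 0 - (energyForm j v' v' / 2 + κ * ‖j v' - x‖ ^ 2))) :=
    (tendsto_const_nhds.add tendsto_one_div_add_atTop_nhds_zero_nat).sub hQ
  obtain ⟨hm, hle⟩ := memLp_and_integral_primitive_le hf hjv hv ha fun n => by
    have := hvI n
    simp only [hΨ, resolventFunctional] at this
    linarith
  refine ⟨v', hm, fun w hw => le_trans ?_ (hI w hw)⟩
  simp only [hΨ, resolventFunctional]
  linarith

/-- The range condition: the Euler–Lagrange equation of the functional with `κ = 1 / (2ε)` at `x`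
says that `ε⁻¹ • (x - j v)` is the value of the operator at the minimiser `v`. -/
theorem exists_energyRel_add_smul_eq [CompleteSpace V] [IsFiniteMeasure m]
    (hf : IsNonlinearity f p C) (hj : ∀ v, ‖j v‖ ≤ ‖v‖) {ε : ℝ} (hε : 0 < ε) (hε1 : ε ≤ 1)
    (x : Lp ℝ 2 m) : ∃ v b, EnergyRel j f p C v b ∧ j v + ε • b = x := by
  set κ := 1 / (2 * ε) with hκdef
  have hκ : 1 / 2 ≤ κ := by
    rw [hκdef, div_le_div_iff₀ (by norm_num) (by positivity)]; linarith
  obtain ⟨v, hv, hmin⟩ := exists_isMinOn_resolventFunctional hf hj hκ x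
  have hvar : ∀ ξ, MemEnergyLp j p ξ → 0 ≤ energyForm j v ξ + 2 * κ * ⟪j v - x, j ξ⟫ +
      ∫ y, (f (j v y) + C * j v y) * j ξ y ∂m := by
    intro ξ hξ
    have hlim : Tendsto (fun δ : ℝ => energyForm j v ξ + 2 * κ * ⟪j v - x, j ξ⟫ +
        δ * (energyForm j ξ ξ / 2 + κ * ‖j ξ‖ ^ 2) +
        ∫ y, (f (j (v + δ • ξ) y) + C * j (v + δ • ξ) y) * j ξ y ∂m) (𝓝[>] 0)
        (𝓝 (energyForm j v ξ + 2 * κ * ⟪j v - x, j ξ⟫ +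
          0 * (energyForm j ξ ξ / 2 + κ * ‖j ξ‖ ^ 2) +
          ∫ y, (f (j v y) + C * j v y) * j ξ y ∂m)) := by
      refine Tendsto.add (tendsto_const_nhds.add (Tendsto.mul_const _ ?_))
        (tendsto_integral_shift_mul hf hv hξ)
      exact tendsto_id.mono_left nhdsWithin_le_nhds
    rw [zero_mul, add_zero] at hlim
    refine ge_of_tendsto hlim ?_
    filter_upwards [self_mem_nhdsWithin] with δ hδ
    have hδ : 0 < δ := hδ
    have h1 := hmin _ (hv.add (hξ.smul δ))
    have h2 := integral_primitive_add_smul_le hf hv hξ δ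
    have h3 : energyForm j (v + δ • ξ) (v + δ • ξ) = energyForm j v v +
        2 * δ * energyForm j v ξ + δ ^ 2 * energyForm j ξ ξ := by
      simp only [energyForm, map_smul, map_add, inner_smul_left, inner_smul_right,
        inner_add_left, inner_add_right, real_inner_comm v ξ, real_inner_comm (j v) (j ξ),
        RCLike.conj_to_real]
      ring
    have h4 : ‖j (v + δ • ξ) - x‖ ^ 2 = ‖j v - x‖ ^ 2 + 2 * δ * ⟪j v - x, j ξ⟫ +
        δ ^ 2 * ‖j ξ‖ ^ 2 := by
      have : j (v + δ • ξ) - x = (j v - x) + δ • j ξ := by rw [map_add, map_smul]; abel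
      rw [this, norm_add_sq_real, inner_smul_right, norm_smul, mul_pow, Real.norm_eq_abs, sq_abs]
      ring
    simp only [resolventFunctional, h3, h4] at h1
    refine nonneg_of_mul_nonneg_right (a := δ) ?_ hδ
    linarith
  refine ⟨v, (1 / ε) • (x - j v), ⟨hv, fun ξ hξ => ?_⟩, ?_⟩
  · have h1 := hvar ξ hξ
    have h2 := hvar ((-1 : ℝ) • ξ) (hξ.smul _)
    have h3 : ∫ y, (f (j v y) + C * j v y) * j ((-1 : ℝ) • ξ) y ∂m =
        -∫ y, (f (j v y) + C * j v y) * j ξ y ∂m := by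
      rw [← integral_neg, map_smul]
      refine integral_congr_ae ?_
      filter_upwards [Lp.coeFn_smul (-1 : ℝ) (j ξ)] with y hy
      rw [hy, Pi.smul_apply, smul_eq_mul]; ring
    have h4 : energyForm j v ((-1 : ℝ) • ξ) = -energyForm j v ξ := by
      simp only [energyForm, map_smul, inner_smul_right]; ring
    rw [h3, h4, map_smul, inner_smul_right] at h2
    have h5 : 2 * κ = 1 / ε := by rw [hκdef]; field_simp
    rw [h5] at h1 h2
    rw [inner_smul_left, RCLike.conj_to_real, ← neg_sub (j v) x, inner_neg_left]
    linarith
  · rw [smul_smul, mul_one_div_cancel hε.ne', one_smul]; abel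

/-- The hypothesis under which the abstract theory applies: `j` is a contraction, and the bounded
elements of the energy space are dense in `L²`. -/
structure IsEnergyEmbedding (j : V →L[ℝ] Lp ℝ 2 m) : Prop where
  norm_le : ∀ v, ‖j v‖ ≤ ‖v‖
  dense : Dense {x : Lp ℝ 2 m | ∃ ξ, j ξ = x ∧ ∃ M, ∀ᵐ y ∂m, |j ξ y| ≤ M}

theorem memEnergyLp_of_bounded [IsFiniteMeasure m] {ξ : V} {M : ℝ}
    (h : ∀ᵐ y ∂m, |j ξ y| ≤ M) : MemEnergyLp j p ξ :=
  MemLp.of_bound (Lp.aestronglyMeasurable _) M h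

theorem IsEnergyEmbedding.dense_memEnergyLp [IsFiniteMeasure m] (hj : IsEnergyEmbedding j) :
    Dense {x : Lp ℝ 2 m | ∃ ξ, MemEnergyLp j p ξ ∧ j ξ = x} := by
  refine hj.dense.mono ?_
  rintro _ ⟨ξ, rfl, M, hM⟩
  exact ⟨ξ, memEnergyLp_of_bounded hM, rfl⟩

theorem isCoerciveMonotone_energyRel [CompleteSpace V] [IsFiniteMeasure m]
    (hf : IsNonlinearity f p C) (hj : IsEnergyEmbedding j) :
    IsCoerciveMonotone j (EnergyRel j f p C) where
  norm_map_le := hj.norm_le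
  mono h h' := EnergyRel.mono hf h h'
  range _ hε hε1 x := exists_energyRel_add_smul_eq hf hj.norm_le hε hε1 x
  unique h h' := EnergyRel.unique hj.dense_memEnergyLp h h'

/-- The domain of the operator is dense: the resolvents of a bounded element of the energy space
converge to it. -/
theorem exists_energyRel_norm_sub_lt [CompleteSpace V] [IsFiniteMeasure m]
    (hf : IsNonlinearity f p C) (hj : IsEnergyEmbedding j) (x : Lp ℝ 2 m) {δ : ℝ} (hδ : 0 < δ) :
    ∃ v b, EnergyRel j f p C v b ∧ ‖j v - x‖ < δ := by
  obtain ⟨_, hξx, ξ, rfl, M, hM⟩ := Metric.dense_iff.1 hj.dense x (δ / 2) (half_pos hδ)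
  rw [mem_ball_iff_norm] at hξx
  have hξ : MemEnergyLp j p ξ := memEnergyLp_of_bounded hM
  obtain ⟨A, hA⟩ := isCompact_Icc.exists_bound_of_continuousOn
    (hf.continuous_shift.continuousOn (s := Icc (-M) M))
  set L := energyForm j ξ ξ + m.real univ * A ^ 2 with hL
  have hL0 : 0 ≤ L := add_nonneg (energyForm_self_nonneg hj.norm_le ξ)
    (mul_nonneg measureReal_nonneg (sq_nonneg A))
  set ε := min 1 ((δ / 2) ^ 2 / (L + 1)) with hε
  have hε0 : 0 < ε := lt_min one_pos (by positivity)
  have hε1 : ε ≤ 1 := min_le_left _ _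
  obtain ⟨v, b, hvb, hx⟩ := exists_energyRel_add_smul_eq hf hj.norm_le hε0 hε1 (j ξ)
  refine ⟨v, b, hvb, ?_⟩
  have hb : ε • b = j ξ - j v := by rw [← hx]; abel
  have hsub := hξ.sub hvb.1
  have h1 := hvb.2 _ hsub
  -- by monotonicity, the nonlinearity may be evaluated at the bounded function `j ξ`
  have h2 : ∫ y, (f (j v y) + C * j v y) * j (ξ - v) y ∂m ≤
      ∫ y, (A ^ 2 / 2 + 1 / 2 * (j (ξ - v) y * j (ξ - v) y)) ∂m := by
    refine integral_mono_ae (hf.integrable_shift_mul hvb.1 (Lp.memLp _) hsub (Lp.memLp _))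
      ((integrable_const _).add (((Lp.memLp _).integrable_mul (Lp.memLp _)).const_mul _)) ?_
    rw [map_sub]
    filter_upwards [Lp.coeFn_sub (j ξ) (j v), hM] with y hy hMy
    rw [hy, Pi.sub_apply]
    have h3 : (f (j v y) + C * j v y) * (j ξ y - j v y) ≤
        (f (j ξ y) + C * j ξ y) * (j ξ y - j v y) := by
      rcases le_total (j v y) (j ξ y) with h | h
      · have := hf.mono h
        simp only at this
        nlinarith
      · have := hf.mono h
        simp only at this
        nlinarith
    have h4 := hA (j ξ y) (abs_le.1 hMy)
    rw [Real.norm_eq_abs] at h4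
    have h5 := sq_le_sq' (neg_le_of_abs_le h4) (le_of_abs_le h4)
    nlinarith [sq_nonneg ((f (j ξ y) + C * j ξ y) - (j ξ y - j v y))]
  rw [integral_add (integrable_const _)
    (((Lp.memLp _).integrable_mul (Lp.memLp _)).const_mul _), integral_const, smul_eq_mul,
    integral_const_mul, ← L2.norm_sq_eq_integral] at h2
  have h3 : energyForm j v (ξ - v) ≤ energyForm j ξ ξ / 2 := by
    have h4 := energyForm_self_nonneg hj.norm_le (ξ - v)
    have h5 := energyForm_self_nonneg hj.norm_le v
    have h6 : energyForm j (ξ - v) (ξ - v) = energyForm j ξ ξ - 2 * energyForm j v ξ +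
        energyForm j v v := by
      simp only [energyForm, map_sub, inner_sub_left, inner_sub_right, real_inner_comm v ξ,
        real_inner_comm (j v) (j ξ)]
      ring
    rw [energyForm_sub_right]
    linarith
  have h4 : ε * ⟪b, j (ξ - v)⟫ = ‖j (ξ - v)‖ ^ 2 := by
    rw [← real_inner_smul_left, hb, map_sub, real_inner_self_eq_norm_sq]
  have h5 : ‖j (ξ - v)‖ ^ 2 ≤ ε * (L / 2 + 1 / 2 * ‖j (ξ - v)‖ ^ 2) := by
    rw [← h4]
    refine mul_le_mul_of_nonneg_left ?_ hε0.le
    rw [h4, ← h1]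
    simp only [hL]; linarith
  have h6 : ‖j (ξ - v)‖ ^ 2 ≤ ε * L := by
    have := mul_le_mul_of_nonneg_right hε1 (sq_nonneg ‖j (ξ - v)‖)
    linarith
  have h7 : ε * L < (δ / 2) ^ 2 := by
    have h8 : ε ≤ (δ / 2) ^ 2 / (L + 1) := min_le_right _ _
    rw [le_div_iff₀ (by linarith)] at h8
    linarith
  have h8 : ‖j (ξ - v)‖ < δ / 2 := lt_of_pow_lt_pow_left₀ 2 (by linarith) (h6.trans_lt h7)
  have h9 : j v - x = (j ξ - x) - j (ξ - v) := by rw [map_sub]; abel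
  rw [h9]
  refine (norm_sub_le _ _).trans_lt ?_
  linarith

end

section

/-! ### Integral solutions of the evolution equation -/

variable {X : Type*} [MeasurableSpace X] {m : Measure X} {V : Type*} [NormedAddCommGroup V]
  [InnerProductSpace ℝ V] {j : V →L[ℝ] Lp ℝ 2 m} {f : ℝ → ℝ} {p C : ℝ}

/-- Weakly continuous solutions of the equation integrated in time, without any condition on the
energy; `v` is `u` as a function with values in the energy space. -/
structure IsIntegralSolution (j : V →L[ℝ] Lp ℝ 2 m) (f : ℝ → ℝ) (p : ℝ) (u : ℝ → Lp ℝ 2 m)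
    (v : ℝ → V) : Prop where
  wcont : ∀ η, ContinuousOn (fun t => ⟪u t, η⟫) (Ici 0)
  bdd : ∀ T, ∃ M, ∀ t ∈ Icc 0 T, ‖u t‖ ≤ M
  trace : ∀ᵐ t ∂(volume.restrict (Ioi 0)), j (v t) = u t
  memLp : ∀ T, MemLp v 2 (volume.restrict (Ioc 0 T))
  lp : ∀ T, ∫⁻ t in Ioc 0 T, ∫⁻ x, ‖u t x‖ₑ ^ p ∂m < ⊤
  eq : ∀ ξ, MemEnergyLp j p ξ → ∀ t, 0 ≤ t → ⟪u t, j ξ⟫ - ⟪u 0, j ξ⟫ =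
    ∫ σ in (0 : ℝ)..t, -(energyForm j (v σ) ξ + ∫ x, f (u σ x) * j ξ x ∂m)

/-- The energy identity: half the squared norm of `u` decreases by the dissipated energy. -/
def EnergyIdentity (j : V →L[ℝ] Lp ℝ 2 m) (f : ℝ → ℝ) (u : ℝ → Lp ℝ 2 m) (v : ℝ → V) : Prop :=
  ∀ t, 0 ≤ t → (1 / 2) * ‖u t‖ ^ 2 + ∫ σ in (0 : ℝ)..t,
    (energyForm j (v σ) (v σ) + ∫ x, f (u σ x) * u σ x ∂m) = (1 / 2) * ‖u 0‖ ^ 2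

/-- A jointly measurable representative of a curve that is `p`-integrable in space and time. -/
structure IsSpaceTimeRep (p : ℝ) (u : ℝ → Lp ℝ 2 m) (T : ℝ) (U : ℝ → X → ℝ) : Prop where
  meas : Measurable (Function.uncurry U)
  ae_eq : ∀ᵐ t ∂(volume.restrict (Ioc 0 T)), U t =ᵐ[m] u t
  memLp : MemLp (Function.uncurry U) (ENNReal.ofReal p) ((volume.restrict (Ioc 0 T)).prod m)

theorem IsSpaceTimeRep.of_measurable [SFinite m] {u : ℝ → Lp ℝ 2 m} {T : ℝ} {U : ℝ → X → ℝ}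
    (hp : 0 < p) (hUm : Measurable (Function.uncurry U))
    (hUae : ∀ᵐ t ∂(volume.restrict (Ioc 0 T)), U t =ᵐ[m] u t)
    (hlp : ∫⁻ t in Ioc 0 T, ∫⁻ x, ‖u t x‖ₑ ^ p ∂m < ⊤) : IsSpaceTimeRep p u T U := by
  refine ⟨hUm, hUae, hUm.aestronglyMeasurable, ?_⟩
  rw [eLpNorm_lt_top_iff_lintegral_rpow_enorm_lt_top (by simpa using hp) ENNReal.ofReal_ne_top,
    ENNReal.toReal_ofReal hp.le, lintegral_prod _ (hUm.enorm.pow_const p).aemeasurable]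
  refine lt_of_eq_of_lt ?_ hlp
  refine lintegral_congr_ae ?_
  filter_upwards [hUae] with t ht
  refine lintegral_congr_ae ?_
  filter_upwards [ht] with x hx
  simp only [Function.uncurry, hx]

theorem exists_isSpaceTimeRep [SFinite m] [SecondCountableTopology (Lp ℝ 2 m)] {u : ℝ → Lp ℝ 2 m}
    {T : ℝ} (hp : 0 < p) (hu : AEStronglyMeasurable u (volume.restrict (Ioc 0 T)))
    (hlp : ∫⁻ t in Ioc 0 T, ∫⁻ x, ‖u t x‖ₑ ^ p ∂m < ⊤) :
    ∃ U : ℝ → X → ℝ, IsSpaceTimeRep p u T U := by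
  obtain ⟨U, hUm, hUae⟩ := exists_measurable_uncurry_ae_eq hu
  exact ⟨U, .of_measurable hp hUm hUae hlp⟩

namespace IsSpaceTimeRep

variable {u : ℝ → Lp ℝ 2 m} {T : ℝ} {U : ℝ → X → ℝ}

theorem ae_memLp [IsFiniteMeasure m] (hU : IsSpaceTimeRep p u T U) (hf : IsNonlinearity f p C) :
    ∀ᵐ t ∂(volume.restrict (Ioc 0 T)), MemLp (u t) (ENNReal.ofReal p) m := by
  have h1 := ((hf.memLp_iff_integrable hU.memLp.1).1 hU.memLp).prod_right_ae
  filter_upwards [hU.ae_eq, h1] with t ht h2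
  refine (memLp_congr_ae ht).1 ?_
  have hUt : Measurable (U t) := hU.meas.comp (measurable_const.prodMk measurable_id)
  rw [hf.memLp_iff_integrable hUt.aestronglyMeasurable]
  exact h2

/-- Space integrals of a function of the curve, as functions of time. -/
theorem integrable_integral [SFinite m] (hU : IsSpaceTimeRep p u T U) {h : ℝ → X → ℝ}
    (hi : Integrable (fun q : ℝ × X => h (U q.1 q.2) q.2) ((volume.restrict (Ioc 0 T)).prod m)) :
    Integrable (fun t => ∫ x, h (u t x) x ∂m) (volume.restrict (Ioc 0 T)) := by
  refine hi.integral_prod_left.congr ?_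
  filter_upwards [hU.ae_eq] with t ht
  refine integral_congr_ae ?_
  filter_upwards [ht] with x hx
  simp only [hx]

theorem setIntegral_integral [SFinite m] (hU : IsSpaceTimeRep p u T U) {h : ℝ → X → ℝ}
    (hi : Integrable (fun q : ℝ × X => h (U q.1 q.2) q.2) ((volume.restrict (Ioc 0 T)).prod m)) :
    ∫ t in Ioc 0 T, ∫ x, h (u t x) x ∂m =
      ∫ q, h (U q.1 q.2) q.2 ∂((volume.restrict (Ioc 0 T)).prod m) := by
  rw [integral_prod _ hi]
  refine integral_congr_ae ?_
  filter_upwards [hU.ae_eq] with t ht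
  refine integral_congr_ae ?_
  filter_upwards [ht] with x hx
  simp only [hx]

end IsSpaceTimeRep

theorem memLp_comp_snd [IsFiniteMeasure m] {q : ℝ≥0∞} {ζ : X → ℝ} (hζ : MemLp ζ q m) (T : ℝ) :
    MemLp (fun r : ℝ × X => ζ r.2) q ((volume.restrict (Ioc 0 T)).prod m) :=
  MemLp.comp_snd hζ _

namespace IsIntegralSolution

variable {u : ℝ → Lp ℝ 2 m} {v : ℝ → V}

theorem trace_Ioc (hu : IsIntegralSolution j f p u v) (T : ℝ) :
    ∀ᵐ t ∂(volume.restrict (Ioc 0 T)), j (v t) = u t :=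
  ae_restrict_of_ae_restrict_of_subset Ioc_subset_Ioi_self hu.trace

theorem aestronglyMeasurable (hu : IsIntegralSolution j f p u v) (T : ℝ) :
    AEStronglyMeasurable u (volume.restrict (Ioc 0 T)) :=
  (j.continuous.comp_aestronglyMeasurable (hu.memLp T).1).congr (hu.trace_Ioc T)

theorem exists_rep [IsFiniteMeasure m] [SecondCountableTopology (Lp ℝ 2 m)]
    (hu : IsIntegralSolution j f p u v) (hf : IsNonlinearity f p C) (T : ℝ) :
    ∃ U : ℝ → X → ℝ, IsSpaceTimeRep p u T U :=
  exists_isSpaceTimeRep (zero_lt_one.trans hf.one_lt) (hu.aestronglyMeasurable T) (hu.lp T)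

variable [IsFiniteMeasure m] [SecondCountableTopology (Lp ℝ 2 m)]

theorem ae_memLp (hu : IsIntegralSolution j f p u v) (hf : IsNonlinearity f p C) (T : ℝ) :
    ∀ᵐ t ∂(volume.restrict (Ioc 0 T)),
      MemEnergyLp j p (v t) ∧ MemLp (u t) (ENNReal.ofReal p) m := by
  obtain ⟨U, hU⟩ := hu.exists_rep hf T
  filter_upwards [hU.ae_memLp hf, hu.trace_Ioc T] with t h1 h2
  refine ⟨?_, h1⟩
  rw [MemEnergyLp, h2]; exact h1

theorem intervalIntegrable_test (hu : IsIntegralSolution j f p u v) (hf : IsNonlinearity f p C)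
    (hj : ∀ v, ‖j v‖ ≤ ‖v‖) {ξ : V} (hξ : MemEnergyLp j p ξ) {T : ℝ} (hT : 0 ≤ T) :
    IntervalIntegrable (fun σ => -(energyForm j (v σ) ξ + ∫ x, f (u σ x) * j ξ x ∂m))
      volume 0 T := by
  rw [intervalIntegrable_iff_integrableOn_Ioc_of_le hT]
  obtain ⟨U, hU⟩ := hu.exists_rep hf T
  refine (Integrable.add ?_ ?_).neg
  · have hv1 : Integrable v (volume.restrict (Ioc 0 T)) := (hu.memLp T).integrable (by norm_num)
    refine Integrable.mono' ((hv1.norm.mul_const ‖ξ‖).const_mul 2)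
      ((continuous_energyForm (j := j)).comp_aestronglyMeasurable
        (hv1.1.prodMk aestronglyMeasurable_const)) (Eventually.of_forall fun t => ?_)
    exact abs_energyForm_le hj _ _
  · exact hU.integrable_integral (h := fun r x => f r * j ξ x)
      (hf.integrable_mul hU.memLp (memLp_comp_snd hξ T))

theorem integrable_integral_mul_self (hu : IsIntegralSolution j f p u v)
    (hf : IsNonlinearity f p C) (T : ℝ) :
    Integrable (fun t => ∫ x, f (u t x) * u t x ∂m) (volume.restrict (Ioc 0 T)) := by
  obtain ⟨U, hU⟩ := hu.exists_rep hf T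
  exact hU.integrable_integral (h := fun r _ => f r * r) (hf.integrable_mul hU.memLp hU.memLp)

theorem intervalIntegrable_energy (hu : IsIntegralSolution j f p u v) (hf : IsNonlinearity f p C)
    (hj : ∀ v, ‖j v‖ ≤ ‖v‖) {T : ℝ} (hT : 0 ≤ T) :
    IntervalIntegrable (fun σ => energyForm j (v σ) (v σ) + ∫ x, f (u σ x) * u σ x ∂m)
      volume 0 T := by
  rw [intervalIntegrable_iff_integrableOn_Ioc_of_le hT]
  refine Integrable.add ?_ (hu.integrable_integral_mul_self hf T)
  have hv2 := (hu.memLp T).integrable_norm_pow (by norm_num)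
  refine Integrable.mono' (hv2.const_mul 2)
      ((continuous_energyForm (j := j)).comp_aestronglyMeasurable
        ((hu.memLp T).1.prodMk (hu.memLp T).1)) (Eventually.of_forall fun t => ?_)
  refine (abs_energyForm_le hj _ _).trans_eq ?_
  simp [sq]

theorem integrable_integral_rpow_comp (hu : IsIntegralSolution j f p u v)
    (hf : IsNonlinearity f p C) (T : ℝ) :
    Integrable (fun t => ∫ x, |f (u t x)| ^ (p / (p - 1)) ∂m) (volume.restrict (Ioc 0 T)) := by
  obtain ⟨U, hU⟩ := hu.exists_rep hf T
  have hq := hf.holderConjugate.symm.pos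
  have h1 := hf.memLp_comp hU.memLp
  have h2 := (integrable_norm_rpow_iff h1.1 (by simpa using hq) ENNReal.ofReal_ne_top).2 h1
  rw [ENNReal.toReal_ofReal hq.le] at h2
  exact hU.integrable_integral (h := fun r _ => |f r| ^ (p / (p - 1))) h2

end IsIntegralSolution

/-- A crude form of Young's inequality, with a bound that is additive in the two factors. -/
theorem IsNonlinearity.abs_integral_mul_le [IsFiniteMeasure m] (hf : IsNonlinearity f p C)
    {w ζ : X → ℝ} (hw : MemLp w (ENNReal.ofReal p) m) (hζ : MemLp ζ (ENNReal.ofReal p) m) :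
    |∫ x, f (w x) * ζ x ∂m| ≤ ∫ x, |f (w x)| ^ (p / (p - 1)) ∂m + ∫ x, |ζ x| ^ p ∂m := by
  have hq := hf.holderConjugate
  have h1 := hf.memLp_comp hw
  have h2 := (integrable_norm_rpow_iff h1.1 (by simpa using hq.symm.pos)
    ENNReal.ofReal_ne_top).2 h1
  rw [ENNReal.toReal_ofReal hq.symm.pos.le] at h2
  have h3 := (hf.memLp_iff_integrable hζ.1).1 hζ
  have h2' : Integrable (fun x => |f (w x)| ^ (p / (p - 1))) m := h2
  rw [← integral_add h2' h3]
  refine (abs_integral_le_integral_abs).trans (integral_mono (hf.integrable_mul hw hζ).abs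
    (h2'.add h3) fun x => ?_)
  simp only [abs_mul]
  have h4 := Real.young_inequality_of_nonneg (abs_nonneg (f (w x))) (abs_nonneg (ζ x)) hq.symm
  have h5 : |f (w x)| ^ (p / (p - 1)) / (p / (p - 1)) ≤ |f (w x)| ^ (p / (p - 1)) :=
    div_le_self (by positivity) hq.symm.lt.le
  have h6 : |ζ x| ^ p / p ≤ |ζ x| ^ p := div_le_self (by positivity) hq.lt.le
  linarith

/-- Pairing with a fixed element of the dual space is continuous along curves that are continuous
in `L²` and bounded in `L^p`. -/
theorem continuousOn_integral_mul [IsFiniteMeasure m] {q q' : ℝ} (hq : q.HolderConjugate q')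
    {S : Set ℝ} {u : ℝ → Lp ℝ 2 m} (hu : ContinuousOn u S) {K : ℝ≥0∞} (hK : K ≠ ⊤)
    (hb : ∀ t ∈ S, eLpNorm (u t) (ENNReal.ofReal q) m ≤ K) {h : X → ℝ}
    (hh : MemLp h (ENNReal.ofReal q') m) : ContinuousOn (fun t => ∫ x, h x * u t x ∂m) S := by
  intro t ht
  refine tendsto_of_seq_tendsto fun s hs => ?_
  rw [tendsto_nhdsWithin_iff] at hs
  obtain ⟨hs, hsS⟩ := hs
  refine tendsto_of_subseq_tendsto fun ns hns => ?_
  have hs' : Tendsto (fun n => s (ns n)) atTop (𝓝[S] t) :=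
    tendsto_nhdsWithin_iff.2 ⟨hs.comp hns, hns.eventually hsS⟩
  obtain ⟨n0, hn0⟩ := (hns.eventually hsS).exists_forall_of_atTop
  have hs'' := ((hu t ht).tendsto.comp hs').comp (tendsto_add_atTop_nat n0)
  obtain ⟨ms, hms, hae⟩ := exists_subseq_ae_tendsto hs''
  have := (tendsto_integral_mul_of_ae_tendsto hq hK
    (F := fun n x => u (s (ns (ms n + n0))) x) (fun n => Lp.aestronglyMeasurable _)
    (fun n => hb _ (hn0 _ (by omega))) hae hh).2
  refine ⟨fun n => ms n + n0, ?_⟩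
  simp only [Function.comp, mul_comm (h _)]
  exact this

end

section

/-! ### Pairing strong with integral solutions -/

variable {X : Type*} [MeasurableSpace X] {m : Measure X}
  {V : Type*} [NormedAddCommGroup V]
  [InnerProductSpace ℝ V] {j : V →L[ℝ] Lp ℝ 2 m} {f : ℝ → ℝ} {p C : ℝ}

theorem eLpNorm_le_of_integral_rpow_le {q : ℝ} (hq : 0 < q) {w : X → ℝ} {K : ℝ}
    (hw : MemLp w (ENNReal.ofReal q) m) (hK : ∫ x, |w x| ^ q ∂m ≤ K) :
    eLpNorm w (ENNReal.ofReal q) m ≤ ENNReal.ofReal (K ^ (1 / q)) := by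
  rw [hw.eLpNorm_eq_integral_rpow_norm (by simpa using hq) ENNReal.ofReal_ne_top,
    ENNReal.toReal_ofReal hq.le, ← one_div]
  refine ENNReal.ofReal_le_ofReal (Real.rpow_le_rpow (integral_nonneg fun x => by positivity) ?_
    (by positivity))
  simpa only [Real.norm_eq_abs] using hK

/-- The right-hand side `-b + C j v` of the evolution equation, in weak form. -/
theorem EnergyRel.inner_eq [IsFiniteMeasure m] (hf : IsNonlinearity f p C) {v ξ : V} {b : Lp ℝ 2 m}
    (h : EnergyRel j f p C v b) (hξ : MemEnergyLp j p ξ) :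
    -⟪b, j ξ⟫ + C * ⟪j v, j ξ⟫ = -(energyForm j v ξ + ∫ x, f (j v x) * j ξ x ∂m) := by
  rw [← h.2 ξ hξ, L2_inner_eq_integral (j v)]
  have h1 := hf.integrable_mul h.1 hξ
  have h2 : Integrable (fun x => j v x * j ξ x) m := (Lp.memLp _).integrable_mul (Lp.memLp _)
  have : ∫ x, (f (j v x) + C * j v x) * j ξ x ∂m =
      ∫ x, f (j v x) * j ξ x ∂m + C * ∫ x, j v x * j ξ x ∂m := by
    rw [← integral_const_mul, ← integral_add h1 (h2.const_mul C)]
    exact integral_congr_ae (Eventually.of_forall fun x => by simp only; ring)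
  rw [this]; ring

/-- The domain of the operator is bounded in `L^p` by the norms of argument and value, as is seen by
testing with the argument itself. -/
theorem EnergyRel.integral_rpow_le [IsFiniteMeasure m] (hf : IsNonlinearity f p C)
    (hj : ∀ v, ‖j v‖ ≤ ‖v‖) {c c' : ℝ}
    (hcc : ∀ r, c * |r| ^ p - c' ≤ f r * r) {v : V} {b : Lp ℝ 2 m}
    (h : EnergyRel j f p C v b) :
    c * ∫ x, |j v x| ^ p ∂m ≤ ‖b‖ * ‖j v‖ + m.real univ * c' := by
  have h1 := h.inner_eq hf h.1
  have h2 := energyForm_self_nonneg hj v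
  have h3 := real_inner_le_norm b (j v)
  have h4 := mul_nonneg hf.nonneg (real_inner_self_nonneg (x := j v))
  have h5 : ∫ x, (c * |j v x| ^ p - c') ∂m ≤ ∫ x, f (j v x) * j v x ∂m :=
    integral_mono ((((hf.memLp_iff_integrable (Lp.aestronglyMeasurable _)).1 h.1).const_mul c).sub
      (integrable_const _)) (hf.integrable_mul h.1 h.1) fun x => hcc _
  rw [integral_sub (((hf.memLp_iff_integrable (Lp.aestronglyMeasurable _)).1 h.1).const_mul c)
    (integrable_const _), integral_const_mul, integral_const, smul_eq_mul] at h5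
  linarith

variable {v : ℝ → V} {b : ℝ → Lp ℝ 2 m}

namespace IsStrongSolution

theorem continuousOn (hs : IsStrongSolution j (EnergyRel j f p C) C v b) :
    ContinuousOn (fun t => j (v t)) (Ici 0) := j.continuous.comp_continuousOn hs.cont

variable [IsFiniteMeasure m]

/-- Strong solutions are bounded in the energy space, in `L²` and in `L^p`, locally in time. -/
theorem exists_bound (hs : IsStrongSolution j (EnergyRel j f p C) C v b)
    (hf : IsNonlinearity f p C) (hj : ∀ v, ‖j v‖ ≤ ‖v‖) (T : ℝ) :
    ∃ R, 0 ≤ R ∧ ∀ t ∈ Icc 0 T, ‖v t‖ ≤ R ∧ ‖j (v t)‖ ≤ R ∧ ‖b t‖ ≤ R ∧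
      ∫ x, |j (v t) x| ^ p ∂m ≤ R := by
  obtain ⟨M, hM⟩ := hs.bdd T
  obtain ⟨R, hR⟩ := isCompact_Icc.exists_bound_of_continuousOn (hs.cont.mono fun t ht => ht.1 :
    ContinuousOn v (Icc 0 T))
  obtain ⟨c, c', hc, hc', hcc⟩ := hf.coercive
  refine ⟨|R| + |M| + (|M| * |R| + m.real univ * c') / c, by positivity, fun t ht => ?_⟩
  have h1 : ‖v t‖ ≤ |R| := (hR t ht).trans (le_abs_self _)
  have h2 : ‖b t‖ ≤ |M| := (hM t ht).trans (le_abs_self _)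
  have h3 : 0 ≤ (|M| * |R| + m.real univ * c') / c := by positivity
  have h4 := (hj (v t)).trans h1
  refine ⟨by linarith [abs_nonneg M], by linarith [abs_nonneg M], by linarith [abs_nonneg R], ?_⟩
  have h5 := (hs.rel t ht.1).integral_rpow_le hf hj hcc
  have h6 : ∫ x, |j (v t) x| ^ p ∂m ≤ (|M| * |R| + m.real univ * c') / c := by
    rw [le_div_iff₀ hc]
    have := mul_le_mul h2 h4 (norm_nonneg _) (abs_nonneg _)
    linarith
  linarith [abs_nonneg M, abs_nonneg R]

theorem isIntegralSolution (hs : IsStrongSolution j (EnergyRel j f p C) C v b)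
    (hf : IsNonlinearity f p C) (hj : ∀ v, ‖j v‖ ≤ ‖v‖) :
    IsIntegralSolution j f p (fun t => j (v t)) v where
  wcont η := hs.continuousOn.inner continuousOn_const
  bdd T := by
    obtain ⟨R, -, hR⟩ := hs.exists_bound hf hj T
    exact ⟨R, fun t ht => (hR t ht).2.1⟩
  trace := Eventually.of_forall fun t => rfl
  memLp T := by
    obtain ⟨R, -, hR⟩ := hs.exists_bound hf hj T
    refine MemLp.of_bound ((hs.cont.mono fun t ht => ht.1.le).aestronglyMeasurable
      measurableSet_Ioc) R ?_
    exact (ae_restrict_iff' measurableSet_Ioc).2 (Eventually.of_forall fun t ht =>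
      (hR t ⟨ht.1.le, ht.2⟩).1)
  lp T := by
    obtain ⟨R, hR0, hR⟩ := hs.exists_bound hf hj T
    have hp := zero_lt_one.trans hf.one_lt
    have h1 : ∀ t ∈ Ioc 0 T, ∫⁻ x, ‖j (v t) x‖ₑ ^ p ∂m ≤ ENNReal.ofReal R := by
      intro t ht
      have h2 := (hf.memLp_iff_integrable (Lp.aestronglyMeasurable _)).1 (hs.rel t ht.1.le).1
      have h3 := ofReal_integral_eq_lintegral_ofReal h2
        (Eventually.of_forall fun x => by positivity)
      have h4 : ∀ x, ‖j (v t) x‖ₑ ^ p = ENNReal.ofReal (|j (v t) x| ^ p) := by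
        intro x
        rw [← ofReal_norm, Real.norm_eq_abs, ENNReal.ofReal_rpow_of_nonneg (abs_nonneg _) hp.le]
      simp only [h4]
      rw [← h3]
      exact ENNReal.ofReal_le_ofReal (hR t ⟨ht.1.le, ht.2⟩).2.2.2
    refine (setLIntegral_mono measurable_const h1).trans_lt ?_
    rw [setLIntegral_const, Real.volume_Ioc]
    exact ENNReal.mul_lt_top ENNReal.ofReal_lt_top ENNReal.ofReal_lt_top
  eq ξ hξ t ht := by
    rw [hs.eq (j ξ) t ht]
    refine intervalIntegral.integral_congr fun σ hσ => ?_
    rw [uIcc_of_le ht] at hσ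
    exact (hs.rel σ hσ.1).inner_eq hf hξ

variable [SecondCountableTopology (Lp ℝ 2 m)]

/-- Integration by parts in time for the pairing of a strong with an integral solution. With one
argument of `⟪j (v a), w c⟫` frozen, the increments in the other are given by the equations: that of
the strong solution may be tested with `w c ∈ L²`, and `v c` is a test element for the other. -/
theorem inner_integralSolution (hs : IsStrongSolution j (EnergyRel j f p C) C v b)
    (hf : IsNonlinearity f p C) (hj : ∀ v, ‖j v‖ ≤ ‖v‖) {w : ℝ → Lp ℝ 2 m} {z : ℝ → V}
    (hw : IsIntegralSolution j f p w z) {t : ℝ} (ht : 0 ≤ t) :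
    IntervalIntegrable (fun σ => 2 * energyForm j (v σ) (z σ) +
        (∫ x, f (j (v σ) x) * w σ x ∂m + ∫ x, f (w σ x) * j (v σ) x ∂m)) volume 0 t ∧
    ⟪j (v t), w t⟫ - ⟪j (v 0), w 0⟫ = -∫ σ in (0 : ℝ)..t, (2 * energyForm j (v σ) (z σ) +
        (∫ x, f (j (v σ) x) * w σ x ∂m + ∫ x, f (w σ x) * j (v σ) x ∂m)) := by
  obtain ⟨R, hR0, hR⟩ := hs.exists_bound hf hj t
  obtain ⟨M, hM⟩ := hw.bdd t
  have hM0 : 0 ≤ M := (norm_nonneg _).trans (hM 0 ⟨le_rfl, ht⟩)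
  have hae : ∀ᵐ σ, σ ∈ Ioc 0 t → (MemEnergyLp j p (z σ) ∧ MemLp (w σ) (ENNReal.ofReal p) m) ∧
      j (z σ) = w σ := by
    rw [← ae_restrict_iff' measurableSet_Ioc]
    exact (hw.ae_memLp hf t).and (hw.trace_Ioc t)
  -- an integrable bound, uniform in the frozen time: `R` bounds the strong solution in all norms,
  -- and the last summands bound the pairing of `f (w σ)` with it
  set β : ℝ → ℝ := fun σ => (R * M + |C| * (R * M)) + (2 * (‖z σ‖ * R) +
    (∫ x, |f (w σ x)| ^ (p / (p - 1)) ∂m + R)) with hβ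
  have hg0 : ∀ σ, 0 ≤ ∫ x, |f (w σ x)| ^ (p / (p - 1)) ∂m := fun σ =>
    integral_nonneg fun x => by positivity
  obtain ⟨hi, he⟩ := diagonal_integral_eq_sub ht (P := fun a c => ⟪j (v a), w c⟫)
    (D := fun σ c => -⟪b σ, w c⟫ + C * ⟪j (v σ), w c⟫)
    (e := fun σ c => -(energyForm j (z σ) (v c) + ∫ x, f (w σ x) * j (v c) x ∂m)) (β := β)
    (fun a ha c _ => hs.eq _ a ha.1)
    (fun a ha c hc => by
      rw [real_inner_comm, real_inner_comm (w 0)]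
      exact hw.eq (v c) (hs.rel c hc.1).1 a ha.1)
    (fun c _ => hs.intervalIntegrable_inner _ ht)
    (fun c hc => hw.intervalIntegrable_test hf hj (hs.rel c hc.1).1 ht)
    (by
      rw [intervalIntegrable_iff_integrableOn_Ioc_of_le ht]
      have h1 : Integrable z (volume.restrict (Ioc 0 t)) := (hw.memLp t).integrable (by norm_num)
      exact (integrable_const _).add (((h1.norm.mul_const R).const_mul 2).add
        ((hw.integrable_integral_rpow_comp hf t).add (integrable_const _))))
    (Eventually.of_forall fun σ hσ c hc => by
      have hσ' : σ ∈ Icc 0 t := ⟨hσ.1.le, hσ.2⟩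
      have h1 := (abs_real_inner_le_norm (b σ) (w c)).trans
        (mul_le_mul (hR σ hσ').2.2.1 (hM c hc) (norm_nonneg _) hR0)
      have h2 := (abs_real_inner_le_norm (j (v σ)) (w c)).trans
        (mul_le_mul (hR σ hσ').2.1 (hM c hc) (norm_nonneg _) hR0)
      have h3 := mul_le_mul_of_nonneg_left h2 (abs_nonneg C)
      have h4 := hg0 σ
      have h5 : 0 ≤ ‖z σ‖ * R := by positivity
      refine (abs_add_le _ _).trans ?_
      rw [abs_neg, abs_mul]
      simp only [hβ]
      linarith)
    (by
      filter_upwards [hae] with σ hσ0 hσ c hc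
      obtain ⟨⟨-, h1⟩, -⟩ := hσ0 hσ
      have h2 := abs_energyForm_le hj (z σ) (v c)
      have h3 := hf.abs_integral_mul_le h1 (hs.rel c hc.1).1
      have h4 := (hR c hc).2.2.2
      have h5 := mul_le_mul_of_nonneg_left (hR c hc).1 (norm_nonneg (z σ))
      rw [abs_neg]
      refine (abs_add_le _ _).trans ?_
      have h6 : 0 ≤ R * M + |C| * (R * M) := by positivity
      simp only [hβ]
      linarith)
    (Eventually.of_forall fun σ _ => by
      have h1 : ∀ η, ContinuousOn (fun c => ⟪η, w c⟫) (Icc 0 t) := fun η => by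
        have := (hw.wcont η).mono (fun s hs => hs.1 : Icc 0 t ⊆ Ici 0)
        refine this.congr fun s _ => real_inner_comm _ _
      exact (h1 _).neg.add (continuousOn_const.mul (h1 _)))
    (by
      filter_upwards [hae] with σ hσ0 hσ
      obtain ⟨⟨-, h1⟩, -⟩ := hσ0 hσ
      have hvc : ContinuousOn v (Icc 0 t) := hs.cont.mono fun s hs => hs.1
      refine ContinuousOn.neg (ContinuousOn.add ?_ ?_)
      · exact (continuous_energyForm (j := j)).comp_continuousOn (continuousOn_const.prodMk hvc)
      · exact continuousOn_integral_mul hf.holderConjugate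
          (hs.continuousOn.mono fun s hs => hs.1) ENNReal.ofReal_ne_top
          (fun c hc => eLpNorm_le_of_integral_rpow_le (zero_lt_one.trans hf.one_lt)
            (hs.rel c hc.1).1 (hR c hc).2.2.2) (hf.memLp_comp h1))
  have hcongr : ∀ᵐ σ, σ ∈ Ioc 0 t → -⟪b σ, w σ⟫ + C * ⟪j (v σ), w σ⟫ +
      -(energyForm j (z σ) (v σ) + ∫ x, f (w σ x) * j (v σ) x ∂m) =
      -(2 * energyForm j (v σ) (z σ) +
        (∫ x, f (j (v σ) x) * w σ x ∂m + ∫ x, f (w σ x) * j (v σ) x ∂m)) := by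
    filter_upwards [hae] with σ hσ0 hσ
    obtain ⟨⟨h1, -⟩, h2⟩ := hσ0 hσ
    rw [← h2, (hs.rel σ hσ.1.le).inner_eq hf h1, energyForm_comm (z σ)]
    ring
  constructor
  · rw [intervalIntegrable_iff_integrableOn_Ioc_of_le ht] at hi ⊢
    refine hi.neg.congr ?_
    refine (ae_restrict_iff' measurableSet_Ioc).2 ?_
    filter_upwards [hcongr] with σ h hσ
    rw [Pi.neg_apply, h hσ, neg_neg]
  · rw [he, ← intervalIntegral.integral_neg]
    refine intervalIntegral.integral_congr_ae ?_
    rw [uIoc_of_le ht]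
    exact hcongr

/-- The energy identity of a strong solution is its pairing with itself. -/
theorem energy_eq (hs : IsStrongSolution j (EnergyRel j f p C) C v b)
    (hf : IsNonlinearity f p C) (hj : ∀ v, ‖j v‖ ≤ ‖v‖) {t : ℝ} (ht : 0 ≤ t) :
    ‖j (v t)‖ ^ 2 - ‖j (v 0)‖ ^ 2 = -∫ σ in (0 : ℝ)..t, 2 * (energyForm j (v σ) (v σ) +
        ∫ x, f (j (v σ) x) * j (v σ) x ∂m) := by
  have := (hs.inner_integralSolution hf hj (hs.isIntegralSolution hf hj) ht).2
  rw [real_inner_self_eq_norm_sq, real_inner_self_eq_norm_sq] at this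
  rw [this]
  congr 1
  refine intervalIntegral.integral_congr fun σ _ => ?_
  ring

/-- A strong and an integral solution satisfying the energy identity depart from each other at most
exponentially. -/
theorem norm_sub_integralSolution_le (hs : IsStrongSolution j (EnergyRel j f p C) C v b)
    (hf : IsNonlinearity f p C) (hj : ∀ v, ‖j v‖ ≤ ‖v‖) {w : ℝ → Lp ℝ 2 m} {z : ℝ → V}
    (hw : IsIntegralSolution j f p w z)
    (hE : EnergyIdentity j f w z) {t : ℝ} (ht : 0 ≤ t) :
    ‖j (v t) - w t‖ ≤ Real.exp (C * t) * ‖j (v 0) - w 0‖ := by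
  have hv := hs.isIntegralSolution hf hj
  set A : ℝ → ℝ := fun σ => energyForm j (v σ) (v σ) + ∫ x, f (j (v σ) x) * j (v σ) x ∂m
  set A' : ℝ → ℝ := fun σ => energyForm j (z σ) (z σ) + ∫ x, f (w σ x) * w σ x ∂m
  set Q : ℝ → ℝ := fun σ => 2 * energyForm j (v σ) (z σ) +
        (∫ x, f (j (v σ) x) * w σ x ∂m + ∫ x, f (w σ x) * j (v σ) x ∂m)
  have iA : ∀ t, 0 ≤ t → IntervalIntegrable A volume 0 t := fun t ht =>
    hv.intervalIntegrable_energy hf hj ht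
  have iA' : ∀ t, 0 ≤ t → IntervalIntegrable A' volume 0 t := fun t ht =>
    hw.intervalIntegrable_energy hf hj ht
  have iQ : ∀ t, 0 ≤ t → IntervalIntegrable Q volume 0 t := fun t ht =>
    (hs.inner_integralSolution hf hj hw ht).1
  -- the square is expanded: `A` and `A'` come from the energy identities, `Q` from the pairing
  have hφ : ∀ a ∈ Icc 0 t, ‖j (v a) - w a‖ ^ 2 - ‖j (v 0) - w 0‖ ^ 2 =
      ∫ σ in (0 : ℝ)..a, (2 * Q σ - 2 * A σ - 2 * A' σ) := by
    intro a ha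
    rw [intervalIntegral.integral_sub (((iQ a ha.1).const_mul 2).sub ((iA a ha.1).const_mul 2))
      ((iA' a ha.1).const_mul 2), intervalIntegral.integral_sub ((iQ a ha.1).const_mul 2)
      ((iA a ha.1).const_mul 2), intervalIntegral.integral_const_mul,
      intervalIntegral.integral_const_mul, intervalIntegral.integral_const_mul]
    have e1 := hs.energy_eq hf hj ha.1
    rw [intervalIntegral.integral_const_mul] at e1
    have e2 := hE a ha.1
    have e3 := (hs.inner_integralSolution hf hj hw ha.1).2
    rw [norm_sub_sq_real, norm_sub_sq_real]
    linarith
  have hgr := gronwall_dissipation (C := C) (φ := fun t => ‖j (v t) - w t‖ ^ 2) (α := fun _ => 0)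
    ht ((((iQ t ht).const_mul 2).sub ((iA t ht).const_mul 2)).sub ((iA' t ht).const_mul 2))
    (by simp) hφ (by
      have hae : ∀ᵐ σ, σ ∈ Ioc 0 t → (MemEnergyLp j p (z σ) ∧
          MemLp (w σ) (ENNReal.ofReal p) m) ∧ j (z σ) = w σ := by
        rw [← ae_restrict_iff' measurableSet_Ioc]
        exact (hw.ae_memLp hf t).and (hw.trace_Ioc t)
      filter_upwards [hae] with σ hσ0 hσ
      obtain ⟨⟨h1, -⟩, h2⟩ := hσ0 hσ
      have hvσ := (hs.rel σ hσ.1.le).1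
      simp only [A, A', Q, ← h2]
      have e1 : energyForm j (v σ - z σ) (v σ - z σ) = energyForm j (v σ) (v σ) -
          2 * energyForm j (v σ) (z σ) + energyForm j (z σ) (z σ) := by
        simp only [energyForm, map_sub, inner_sub_left, inner_sub_right,
          real_inner_comm (v σ) (z σ), real_inner_comm (j (v σ)) (j (z σ))]
        ring
      have e2 := energyForm_self_nonneg hj (v σ - z σ)
      have i1 := hf.integrable_mul hvσ hvσ
      have i2 := hf.integrable_mul hvσ h1
      have i3 := hf.integrable_mul h1 hvσ
      have i4 := hf.integrable_mul h1 h1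
      have e3 : ∫ x, -(C * (j (v σ - z σ) x * j (v σ - z σ) x)) ∂m ≤
          ∫ x, ((f (j (v σ) x) * j (v σ) x - f (j (v σ) x) * j (z σ) x) -
            (f (j (z σ) x) * j (v σ) x - f (j (z σ) x) * j (z σ) x)) ∂m := by
        refine integral_mono_ae ((((Lp.memLp _).integrable_mul (Lp.memLp _)).const_mul C).neg)
          ((i1.sub i2).sub (i3.sub i4)) ?_
        rw [map_sub]
        filter_upwards [Lp.coeFn_sub (j (v σ)) (j (z σ))] with x hx
        simp only [hx, Pi.sub_apply]
        rcases le_total (j (v σ) x) (j (z σ) x) with h | h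
        · have := hf.mono h
          simp only at this
          nlinarith
        · have := hf.mono h
          simp only at this
          nlinarith
      rw [integral_sub (f := fun x => f (j (v σ) x) * j (v σ) x - f (j (v σ) x) * j (z σ) x)
        (g := fun x => f (j (z σ) x) * j (v σ) x - f (j (z σ) x) * j (z σ) x)
        (i1.sub i2) (i3.sub i4), integral_sub i1 i2, integral_sub i3 i4,
        integral_neg, integral_const_mul, ← L2.norm_sq_eq_integral, map_sub] at e3
      linarith)
  simp only [mul_zero, intervalIntegral.integral_zero, add_zero] at hgr
  refine abs_le_of_sq_le_sq' ?_ (by positivity) |>.2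
  have h4 : Real.exp (2 * C * t) * Real.exp (-(2 * C) * t) = 1 := by
    rw [← Real.exp_add]; simp
  have h5 := mul_le_mul_of_nonneg_left hgr (Real.exp_pos (2 * C * t)).le
  rw [← mul_assoc, h4, one_mul] at h5
  rw [mul_pow, ← Real.exp_nat_mul]
  refine h5.trans_eq ?_
  push_cast; ring_nf

end IsStrongSolution

end

section

/-! ### Limits of strong solutions -/

variable {V H : Type*} [NormedAddCommGroup V] [InnerProductSpace ℝ V]
  [NormedAddCommGroup H] [InnerProductSpace ℝ H] {j : V →L[ℝ] H} {B : V → H → Prop} {C : ℝ}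

/-- The curve `u` is the locally uniform limit, at a geometric rate, of the strong solutions `s n`,
and `v` is their limit in `L²(0,T; V)` for every `T`. -/
structure IsStrongLimit (j : V →L[ℝ] H) (B : V → H → Prop) (C : ℝ) (s : ℕ → ℝ → V)
    (b : ℕ → ℝ → H) (u : ℝ → H) (v : ℝ → V) : Prop where
  strong : ∀ n, IsStrongSolution j B C (s n) (b n)
  rate : ∀ n t, 0 ≤ t → ‖j (s n t) - u t‖ ≤ Real.exp (C * t) * (1 / 2) ^ n
  cont : ContinuousOn u (Ici 0)
  ae_tendsto : ∀ᵐ t ∂(volume.restrict (Ioi 0)), Tendsto (fun n => s n t) atTop (𝓝 (v t))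
  memLp : ∀ T, MemLp v 2 (volume.restrict (Ioc 0 T))
  tendsto : ∀ T, Tendsto (fun n => eLpNorm (s n - v) 2 (volume.restrict (Ioc 0 T))) atTop (𝓝 0)

theorem IsStrongSolution.memLp {v : ℝ → V} {b : ℝ → H} (hv : IsStrongSolution j B C v b) (T : ℝ) :
    MemLp v 2 (volume.restrict (Ioc 0 T)) := by
  obtain ⟨R, hR⟩ := isCompact_Icc.exists_bound_of_continuousOn (hv.cont.mono fun t ht => ht.1 :
    ContinuousOn v (Icc 0 T))
  refine MemLp.of_bound ((hv.cont.mono fun t ht => ht.1.le).aestronglyMeasurable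
    measurableSet_Ioc) R ?_
  exact (ae_restrict_iff' measurableSet_Ioc).2 (Eventually.of_forall fun t ht =>
    hR t ⟨ht.1.le, ht.2⟩)

theorem IsStrongSolution.eLpNorm_sub_le (hB : IsCoerciveMonotone j B) (hC : 0 ≤ C)
    {v w : ℝ → V} {b d : ℝ → H} (hv : IsStrongSolution j B C v b)
    (hw : IsStrongSolution j B C w d) {T : ℝ} (hT : 0 ≤ T) :
    eLpNorm (v - w) 2 (volume.restrict (Ioc 0 T)) ≤
      ENNReal.ofReal (√(2 * Real.exp ((2 * C + 1) * T)) * ‖j (v 0) - j (w 0)‖) := by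
  have h1 := hv.integral_exp_mul_norm_sub_sq_le hB hw hT
  have hm := (hv.memLp T).sub (hw.memLp T)
  have hc : ContinuousOn (fun σ => ‖v σ - w σ‖ ^ 2) (Icc 0 T) :=
    ((hv.cont.mono fun s hs => hs.1).sub (hw.cont.mono fun s hs => hs.1)).norm.pow 2
  have h2 : Real.exp (-(2 * C + 1) * T) * ∫ σ in (0 : ℝ)..T, ‖v σ - w σ‖ ^ 2 ≤
      ∫ σ in (0 : ℝ)..T, Real.exp (-(2 * C + 1) * σ) * ‖v σ - w σ‖ ^ 2 := by
    rw [← intervalIntegral.integral_const_mul]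
    refine intervalIntegral.integral_mono_on hT
      ((hc.intervalIntegrable_of_Icc hT).const_mul _)
      ((ContinuousOn.mul (by fun_prop) hc).intervalIntegrable_of_Icc hT) fun σ hσ => ?_
    have := hσ.2
    gcongr ?_ * _
    exact Real.exp_le_exp.2 (by nlinarith)
  have h3 : ∫ σ in (0 : ℝ)..T, ‖v σ - w σ‖ ^ 2 ≤
      (√(2 * Real.exp ((2 * C + 1) * T)) * ‖j (v 0) - j (w 0)‖) ^ 2 := by
    rw [mul_pow, Real.sq_sqrt (by positivity)]
    have h4 := mul_le_mul_of_nonneg_left (h2.trans h1) (Real.exp_pos ((2 * C + 1) * T)).le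
    rw [← mul_assoc, ← Real.exp_add, show (2 * C + 1) * T + -(2 * C + 1) * T = 0 by ring,
      Real.exp_zero, one_mul] at h4
    linarith
  rw [hm.eLpNorm_eq_integral_rpow_norm (by norm_num) (by norm_num)]
  refine ENNReal.ofReal_le_ofReal ?_
  rw [ENNReal.toReal_ofNat, ← one_div, ← Real.sqrt_eq_rpow]
  refine Real.sqrt_le_iff.2 ⟨by positivity, ?_⟩
  rw [intervalIntegral.integral_of_le hT] at h3
  simpa using h3

/-- Strong solutions whose initial values converge at a geometric rate converge, since they depend
on the initial values continuously in both topologies. -/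
theorem exists_isStrongLimit [CompleteSpace V] [CompleteSpace H] (hB : IsCoerciveMonotone j B)
    (hC : 0 ≤ C) {s : ℕ → ℝ → V} {b : ℕ → ℝ → H} (hs : ∀ n, IsStrongSolution j B C (s n) (b n))
    {u₀ : H} (h0 : ∀ n, ‖j (s n 0) - u₀‖ ≤ (1 / 2) ^ n) :
    ∃ u v, IsStrongLimit j B C s b u v ∧ u 0 = u₀ := by
  have hx : ∀ N n k, N ≤ n → N ≤ k → ‖j (s n 0) - j (s k 0)‖ ≤ 2 * (1 / 2) ^ N := by
    intro N n k hn hk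
    have h1 : ((1 / 2 : ℝ)) ^ n ≤ (1 / 2) ^ N := pow_le_pow_of_le_one (by norm_num) (by norm_num) hn
    have h2 : ((1 / 2 : ℝ)) ^ k ≤ (1 / 2) ^ N := pow_le_pow_of_le_one (by norm_num) (by norm_num) hk
    have h3 := norm_sub_le_norm_sub_add_norm_sub (j (s n 0)) u₀ (j (s k 0))
    rw [norm_sub_rev u₀] at h3
    linarith [h0 n, h0 k]
  have hpow : Tendsto (fun n : ℕ => (1 / 2 : ℝ) ^ n) atTop (𝓝 0) :=
    tendsto_pow_atTop_nhds_zero_of_lt_one (by norm_num) (by norm_num)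
  have h00 : Tendsto (fun n => j (s n 0)) atTop (𝓝 u₀) :=
    tendsto_iff_norm_sub_tendsto_zero.2 (squeeze_zero (fun _ => norm_nonneg _) h0 hpow)
  -- the limit in `H`
  have hu : ∀ t, ∃ y, 0 ≤ t → Tendsto (fun n => j (s n t)) atTop (𝓝 y) := by
    intro t
    by_cases ht : 0 ≤ t
    · have hcau : CauchySeq fun n => j (s n t) := by
        refine cauchySeq_of_le_tendsto_0 (fun N => Real.exp (C * t) * (2 * (1 / 2) ^ N))
          (fun n k N hn hk => ?_) (by simpa using (hpow.const_mul 2).const_mul (Real.exp (C * t)))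
        rw [dist_eq_norm]
        refine ((hs n).norm_sub_le hB (hs k) ht).trans ?_
        gcongr
        exact hx N n k hn hk
      obtain ⟨y, hy⟩ := cauchySeq_tendsto_of_complete hcau
      exact ⟨y, fun _ => hy⟩
    · exact ⟨0, fun h => absurd h ht⟩
  choose u hu using hu
  have hrate : ∀ n t, 0 ≤ t → ‖j (s n t) - u t‖ ≤ Real.exp (C * t) * (1 / 2) ^ n := by
    intro n t ht
    have h1 : ‖j (s n t) - u t‖ ≤ Real.exp (C * t) * ‖j (s n 0) - u₀‖ :=
      le_of_tendsto_of_tendsto (tendsto_const_nhds.sub (hu t ht)).norm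
        ((tendsto_const_nhds.sub h00).norm.const_mul (Real.exp (C * t)))
        (Eventually.of_forall fun k => (hs n).norm_sub_le hB (hs k) ht)
    exact h1.trans (by gcongr; exact h0 n)
  have hcont : ContinuousOn u (Ici 0) := by
    refine continuousOn_Ici_of_Icc fun T _ => ?_
    refine TendstoUniformlyOn.continuousOn (F := fun n t => j (s n t)) (p := atTop) ?_
      (Frequently.of_forall fun n => (j.continuous.comp_continuousOn (hs n).cont).mono
        fun t ht => ht.1)
    refine Metric.tendstoUniformlyOn_iff.2 fun ε hε => ?_
    have h1 : Tendsto (fun n : ℕ => Real.exp (C * T) * (1 / 2 : ℝ) ^ n) atTop (𝓝 0) := by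
      simpa using hpow.const_mul (Real.exp (C * T))
    filter_upwards [h1.eventually (gt_mem_nhds hε)] with n hn t ht
    rw [dist_comm, dist_eq_norm]
    refine ((hrate n t ht.1).trans ?_).trans_lt hn
    gcongr
    exact ht.2
  -- the limit in `V`
  have hbound : ∀ T : ℝ, 0 ≤ T → ∃ K : ℝ, 0 < K ∧ ∀ N n k, N ≤ n → N ≤ k →
      eLpNorm (s n - s k) 2 (volume.restrict (Ioc 0 T)) < ENNReal.ofReal (K * (1 / 2) ^ N) := by
    intro T hT
    have hK : 0 < √(2 * Real.exp ((2 * C + 1) * T)) := Real.sqrt_pos.2 (by positivity)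
    refine ⟨√(2 * Real.exp ((2 * C + 1) * T)) * 3, by positivity, fun N n k hn hk => ?_⟩
    refine ((hs n).eLpNorm_sub_le hB hC (hs k) hT).trans_lt ?_
    refine (ENNReal.ofReal_lt_ofReal_iff (by positivity)).2 ?_
    rw [mul_assoc]
    refine mul_lt_mul_of_pos_left ((hx N n k hn hk).trans_lt ?_) hK
    have : (0 : ℝ) < (1 / 2) ^ N := by positivity
    linarith
  have hsum : ∀ K : ℝ, 0 < K → ∑' N : ℕ, ENNReal.ofReal (K * (1 / 2) ^ N) ≠ ⊤ := by
    intro K hK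
    rw [← ENNReal.ofReal_tsum_of_nonneg (fun n => by positivity)
      ((summable_geometric_of_lt_one (by norm_num) (by norm_num)).mul_left K)]
    exact ENNReal.ofReal_ne_top
  have hae : ∀ᵐ t ∂(volume.restrict (Ioi (0 : ℝ))), ∃ y, Tendsto (fun n => s n t) atTop (𝓝 y) := by
    have hU : Ioi (0 : ℝ) = ⋃ k : ℕ, Ioc 0 (k : ℝ) := by
      ext t
      simp only [mem_Ioi, mem_iUnion, mem_Ioc]
      refine ⟨fun ht => ?_, fun ⟨k, hk⟩ => hk.1⟩
      obtain ⟨k, hk⟩ := exists_nat_ge t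
      exact ⟨k, ht, hk⟩
    rw [hU, ae_restrict_iUnion_eq, eventually_iSup]
    intro k
    obtain ⟨K, hK, hb⟩ := hbound k k.cast_nonneg
    exact Lp.ae_tendsto_of_cauchy_eLpNorm (fun n => ((hs n).memLp k).1) (by norm_num)
      (hsum K hK) hb
  classical
  set v : ℝ → V := fun t => if h : ∃ y, Tendsto (fun n => s n t) atTop (𝓝 y) then h.choose else 0
  have hv : ∀ᵐ t ∂(volume.restrict (Ioi (0 : ℝ))), Tendsto (fun n => s n t) atTop (𝓝 (v t)) := by
    filter_upwards [hae] with t h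
    simp only [v, dif_pos h]
    exact h.choose_spec
  have hvT : ∀ T, ∀ᵐ t ∂(volume.restrict (Ioc 0 T)), Tendsto (fun n => s n t) atTop (𝓝 (v t)) :=
    fun T => ae_restrict_of_ae_restrict_of_subset Ioc_subset_Ioi_self hv
  have hmeas : ∀ T, AEStronglyMeasurable v (volume.restrict (Ioc 0 T)) := fun T =>
    aestronglyMeasurable_of_tendsto_ae atTop (fun n => ((hs n).memLp T).1) (hvT T)
  have hlim : ∀ T, Tendsto (fun n => eLpNorm (s n - v) 2 (volume.restrict (Ioc 0 T))) atTop
      (𝓝 0) := by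
    intro T
    rcases le_total T 0 with hT | hT
    · rw [Ioc_eq_empty (not_lt.2 hT)]; simp
    obtain ⟨K, hK, hb⟩ := hbound T hT
    have h1 : Tendsto (fun n : ℕ => ENNReal.ofReal (K * (1 / 2) ^ n)) atTop (𝓝 0) := by
      have := ENNReal.tendsto_ofReal (hpow.const_mul K)
      simpa using this
    refine tendsto_of_tendsto_of_tendsto_of_le_of_le tendsto_const_nhds h1 (fun _ => bot_le)
      fun n => ?_
    refine Lp.eLpNorm_le_of_ae_tendsto (u := atTop) (f := fun k => s n - s k)
      ((eventually_ge_atTop n).mono fun k hk => (hb n n k le_rfl hk).le)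
      (fun k => (((hs n).memLp T).sub ((hs k).memLp T)).1) ?_
    filter_upwards [hvT T] with t ht
    exact tendsto_const_nhds.sub ht
  refine ⟨u, v, ⟨hs, hrate, hcont, hv, fun T => ?_, hlim⟩, ?_⟩
  · obtain ⟨n, hn⟩ := ((hlim T).eventually (gt_mem_nhds one_pos)).exists
    have h1 : MemLp (s n - v) 2 (volume.restrict (Ioc 0 T)) :=
      ⟨((hs n).memLp T).1.sub (hmeas T), hn.trans ENNReal.one_lt_top⟩
    simpa using ((hs n).memLp T).sub h1
  · exact tendsto_nhds_unique (hu 0 le_rfl) h00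

end

section

/-! ### Solutions for general initial values -/

variable {X : Type*} [MeasurableSpace X] {m : Measure X}
  {V : Type*} [NormedAddCommGroup V]
  [InnerProductSpace ℝ V] {j : V →L[ℝ] Lp ℝ 2 m} {f : ℝ → ℝ} {p C : ℝ}

/-- The time integral of the form is continuous in its first argument for the topology of
`L²(0, T; V)`. -/
theorem tendsto_integral_energyForm (hj : ∀ v, ‖j v‖ ≤ ‖v‖) {S : Type*} [MeasurableSpace S]
    {τ : Measure S} {s : ℕ → S → V} {v z : S → V} (hs : ∀ n, MemLp (s n) 2 τ) (hv : MemLp v 2 τ)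
    (hz : MemLp z 2 τ) (h : Tendsto (fun n => eLpNorm (s n - v) 2 τ) atTop (𝓝 0)) :
    Tendsto (fun n => ∫ t, energyForm j (s n t) (z t) ∂τ) atTop
      (𝓝 (∫ t, energyForm j (v t) (z t) ∂τ)) := by
  have hm : ∀ {w : S → V}, MemLp w 2 τ →
      AEStronglyMeasurable (fun t => energyForm j (w t) (z t)) τ :=
    fun hw => (continuous_energyForm (j := j)).comp_aestronglyMeasurable (hw.1.prodMk hz.1)
  have hle : ∀ {w : S → V}, MemLp w 2 τ →
      eLpNorm (fun t => energyForm j (w t) (z t)) 1 τ ≤ 2 * eLpNorm w 2 τ * eLpNorm z 2 τ := by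
    intro w hw
    refine eLpNorm_le_eLpNorm_mul_eLpNorm_of_nnnorm hw.1 hz.1 (fun a b => energyForm j a b) 2
      (Eventually.of_forall fun t => ?_)
    have := abs_energyForm_le hj (w t) (z t)
    rw [← mul_assoc] at this
    exact this
  have hi : ∀ {w : S → V}, MemLp w 2 τ → Integrable (fun t => energyForm j (w t) (z t)) τ :=
    fun hw => memLp_one_iff_integrable.1 ⟨hm hw, (hle hw).trans_lt (ENNReal.mul_lt_top
      (ENNReal.mul_lt_top (by norm_num) hw.2) hz.2)⟩
  refine tendsto_integral_of_L1' _ (hi hv).1 (Eventually.of_forall fun n => hi (hs n)) ?_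
  have h1 : Tendsto (fun n => 2 * eLpNorm (s n - v) 2 τ * eLpNorm z 2 τ) atTop (𝓝 0) := by
    have := ENNReal.Tendsto.mul_const (ENNReal.Tendsto.const_mul h (a := 2) (Or.inr (by norm_num)))
      (b := eLpNorm z 2 τ) (Or.inr hz.2.ne)
    simpa using this
  refine tendsto_of_tendsto_of_tendsto_of_le_of_le tendsto_const_nhds h1 (fun _ => bot_le)
    fun n => ?_
  refine le_trans (le_of_eq ?_) (hle ((hs n).sub hv))
  congr 1
  ext t
  rw [Pi.sub_apply, Pi.sub_apply, energyForm_comm (s n t - v t), energyForm_sub_right,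
    energyForm_comm (z t), energyForm_comm (z t)]

theorem IsNonlinearity.integral_rpow_comp_le [IsFiniteMeasure m] {K : ℝ}
    (hK : ∀ r, |f r| ^ (p / (p - 1)) ≤ K * (1 + |r| ^ p)) (hf : IsNonlinearity f p C) {w : X → ℝ}
    (hw : MemLp w (ENNReal.ofReal p) m) :
    ∫ x, |f (w x)| ^ (p / (p - 1)) ∂m ≤ K * (m.real univ + ∫ x, |w x| ^ p ∂m) := by
  have h1 := (hf.memLp_iff_integrable hw.1).1 hw
  have hq := hf.holderConjugate.symm.pos
  have h2 := (integrable_norm_rpow_iff (hf.memLp_comp hw).1 (by simpa using hq)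
    ENNReal.ofReal_ne_top).2 (hf.memLp_comp hw)
  rw [ENNReal.toReal_ofReal hq.le] at h2
  have h3 := integral_mono h2 (((integrable_const (1 : ℝ)).add h1).const_mul K)
    (fun x => hK (w x))
  refine h3.trans_eq ?_
  rw [integral_const_mul]
  congr 1
  refine (integral_add (integrable_const (1 : ℝ)) h1).trans ?_
  simp

namespace IsStrongLimit

variable {s : ℕ → ℝ → V} {b : ℕ → ℝ → Lp ℝ 2 m} {u : ℝ → Lp ℝ 2 m} {v : ℝ → V}

theorem tendsto_L2 (h : IsStrongLimit j (EnergyRel j f p C) C s b u v) {t : ℝ} (ht : 0 ≤ t) :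
    Tendsto (fun n => j (s n t)) atTop (𝓝 (u t)) := by
  refine tendsto_iff_norm_sub_tendsto_zero.2 (squeeze_zero (fun _ => norm_nonneg _)
    (fun n => h.rate n t ht) ?_)
  simpa using (tendsto_pow_atTop_nhds_zero_of_lt_one (r := (1 / 2 : ℝ)) (by norm_num)
    (by norm_num)).const_mul (Real.exp (C * t))

/-- The geometric rate makes the approximations converge almost everywhere, at every time. -/
theorem ae_tendsto_apply (h : IsStrongLimit j (EnergyRel j f p C) C s b u v) {t : ℝ}
    (ht : 0 ≤ t) : ∀ᵐ x ∂m, Tendsto (fun n => j (s n t) x) atTop (𝓝 (u t x)) := by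
  refine ae_tendsto_of_sum_norm_sub_sq ?_
  have hle : ∀ n, ‖j (s n t) - u t‖ₑ ^ 2 ≤
      ENNReal.ofReal (Real.exp (C * t) ^ 2 * (1 / 4 : ℝ) ^ n) := by
    intro n
    rw [← ofReal_norm, ← ENNReal.ofReal_pow (norm_nonneg _)]
    refine ENNReal.ofReal_le_ofReal ?_
    refine (pow_le_pow_left₀ (norm_nonneg _) (h.rate n t ht) 2).trans_eq ?_
    rw [mul_pow, ← pow_mul, mul_comm n, pow_mul]; norm_num
  refine ne_top_of_le_ne_top ?_ (ENNReal.tsum_le_tsum hle)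
  rw [← ENNReal.ofReal_tsum_of_nonneg (fun n => by positivity)
    ((summable_geometric_of_lt_one (by norm_num) (by norm_num)).mul_left _)]
  exact ENNReal.ofReal_ne_top

theorem trace (h : IsStrongLimit j (EnergyRel j f p C) C s b u v) :
    ∀ᵐ t ∂(volume.restrict (Ioi 0)), j (v t) = u t := by
  filter_upwards [h.ae_tendsto, ae_restrict_mem measurableSet_Ioi] with t h1 h2
  exact tendsto_nhds_unique ((j.continuous.tendsto _).comp h1) (h.tendsto_L2 (le_of_lt h2))

variable [IsFiniteMeasure m] [SecondCountableTopology (Lp ℝ 2 m)]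

/-- The approximations and the limit have representatives that converge almost everywhere in space
and time and are bounded in `L^p`; the bound comes from the energy identity. -/
theorem exists_rep (h : IsStrongLimit j (EnergyRel j f p C) C s b u v)
    (hf : IsNonlinearity f p C) (hj : ∀ v, ‖j v‖ ≤ ‖v‖) {T : ℝ} (hT : 0 ≤ T) :
    ∃ (U : ℕ → ℝ → X → ℝ) (W : ℝ → X → ℝ) (K : ℝ),
      (∀ n, IsSpaceTimeRep p (fun t => j (s n t)) T (U n)) ∧ IsSpaceTimeRep p u T W ∧
      (∀ n, ∫ q, |U n q.1 q.2| ^ p ∂((volume.restrict (Ioc 0 T)).prod m) ≤ K) ∧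
      ∀ᵐ q ∂((volume.restrict (Ioc 0 T)).prod m),
        Tendsto (fun n => U n q.1 q.2) atTop (𝓝 (W q.1 q.2)) := by
  have hI : ∀ n, IsIntegralSolution j f p (fun t => j (s n t)) (s n) := fun n =>
    (h.strong n).isIntegralSolution hf hj
  choose U hU using fun n => (hI n).exists_rep hf T
  have hum : AEStronglyMeasurable u (volume.restrict (Ioc 0 T)) :=
    (h.cont.mono fun t ht => ht.1.le).aestronglyMeasurable measurableSet_Ioc
  obtain ⟨W, hWm, hWae⟩ := exists_measurable_uncurry_ae_eq hum
  have hae : ∀ᵐ q ∂((volume.restrict (Ioc 0 T)).prod m),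
      Tendsto (fun n => U n q.1 q.2) atTop (𝓝 (W q.1 q.2)) := by
    rw [Measure.ae_prod_iff_ae_ae (p := fun q : ℝ × X => Tendsto (fun n => U n q.1 q.2) atTop
      (𝓝 (W q.1 q.2))) (measurableSet_tendsto_fun (fun n => (hU n).meas) hWm)]
    filter_upwards [ae_all_iff.2 fun n => (hU n).ae_eq, hWae,
      ae_restrict_mem measurableSet_Ioc] with t h1 h2 h3
    filter_upwards [ae_all_iff.2 h1, h2, h.ae_tendsto_apply h3.1.le] with x h4 h5 h6
    simp only [h4, h5]
    exact h6
  obtain ⟨c, c', hc, hc', hcc⟩ := hf.coercive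
  set π := (volume.restrict (Ioc 0 T)).prod m
  set K := (π.real univ * c' + (‖u 0‖ + 1) ^ 2 / 2) / c
  have hK : ∀ n, ∫ q, |U n q.1 q.2| ^ p ∂π ≤ K := by
    intro n
    have h1 := (hI n).intervalIntegrable_energy hf hj hT
    have h2 := (h.strong n).energy_eq hf hj hT
    rw [intervalIntegral.integral_const_mul, intervalIntegral.integral_of_le hT] at h2
    have h3 : ∫ t in Ioc 0 T, ∫ x, f (j (s n t) x) * j (s n t) x ∂m ≤
        ∫ t in Ioc 0 T, (energyForm j (s n t) (s n t) +
          ∫ x, f (j (s n t) x) * j (s n t) x ∂m) := by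
      refine integral_mono ((hI n).integrable_integral_mul_self hf T)
        ((intervalIntegrable_iff_integrableOn_Ioc_of_le hT).1 h1) fun t => ?_
      exact le_add_of_nonneg_left (energyForm_self_nonneg hj _)
    have h4 : Integrable (fun q => f (U n q.1 q.2) * U n q.1 q.2) π :=
      hf.integrable_mul (hU n).memLp (hU n).memLp
    rw [(hU n).setIntegral_integral (h := fun r _ => f r * r) h4] at h3
    have h5 : Integrable (fun q : ℝ × X => |U n q.1 q.2| ^ p) π :=
      (hf.memLp_iff_integrable (hU n).memLp.1).1 (hU n).memLp
    have h6 : ∫ q, (c * |U n q.1 q.2| ^ p - c') ∂π ≤ ∫ q, f (U n q.1 q.2) * U n q.1 q.2 ∂π :=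
      integral_mono ((h5.const_mul c).sub (integrable_const _)) h4 fun q => hcc _
    rw [integral_sub (h5.const_mul c) (integrable_const _), integral_const_mul, integral_const,
      smul_eq_mul] at h6
    have h7 : ‖j (s n 0)‖ ≤ ‖u 0‖ + 1 := by
      have h8 := h.rate n 0 le_rfl
      have h9 : ((1 / 2 : ℝ)) ^ n ≤ 1 := pow_le_one₀ (by norm_num) (by norm_num)
      have h10 := norm_sub_norm_le (j (s n 0)) (u 0)
      simp only [mul_zero, Real.exp_zero, one_mul] at h8
      linarith
    have h8 := pow_le_pow_left₀ (norm_nonneg _) h7 2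
    rw [le_div_iff₀ hc]
    nlinarith [sq_nonneg ‖j (s n T)‖]
  refine ⟨U, W, K, hU, ⟨hWm, hWae, ?_⟩, hK, hae⟩
  have hp := zero_lt_one.trans hf.one_lt
  exact (tendsto_integral_mul_of_ae_tendsto hf.holderConjugate ENNReal.ofReal_ne_top
    (F := fun n (q : ℝ × X) => U n q.1 q.2) (F' := fun (q : ℝ × X) => W q.1 q.2) (Ξ := 0)
    (fun n => (hU n).memLp.1) (fun n => eLpNorm_le_of_integral_rpow_le hp (hU n).memLp (hK n))
    hae MemLp.zero).1

/-- Convergence of the nonlinear terms, tested with a curve that is `p`-integrable in space and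
time. -/
theorem tendsto_integral_comp_mul (h : IsStrongLimit j (EnergyRel j f p C) C s b u v)
    (hf : IsNonlinearity f p C) (hj : ∀ v, ‖j v‖ ≤ ‖v‖) {T : ℝ} (hT : 0 ≤ T) {w : ℝ → Lp ℝ 2 m}
    {Z : ℝ → X → ℝ} (hZ : IsSpaceTimeRep p w T Z) :
    Tendsto (fun n => ∫ t in Ioc 0 T, ∫ x, f (j (s n t) x) * w t x ∂m) atTop
      (𝓝 (∫ t in Ioc 0 T, ∫ x, f (u t x) * w t x ∂m)) := by
  obtain ⟨U, W, K, hU, hW, hK, hae⟩ := h.exists_rep hf hj hT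
  obtain ⟨K', hK', hg⟩ := hf.growth
  have hconv : ∀ {y : ℝ → Lp ℝ 2 m} {Y : ℝ → X → ℝ}, IsSpaceTimeRep p y T Y →
      ∫ t in Ioc 0 T, ∫ x, f (y t x) * w t x ∂m =
        ∫ q, f (Y q.1 q.2) * Z q.1 q.2 ∂((volume.restrict (Ioc 0 T)).prod m) := by
    intro y Y hY
    have hi : Integrable (fun q : ℝ × X => f (Y q.1 q.2) * Z q.1 q.2)
      ((volume.restrict (Ioc 0 T)).prod m) := hf.integrable_mul hY.memLp hZ.memLp
    rw [integral_prod _ hi]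
    refine integral_congr_ae ?_
    filter_upwards [hY.ae_eq, hZ.ae_eq] with t h1 h2
    refine integral_congr_ae ?_
    filter_upwards [h1, h2] with x h3 h4
    simp only [h3, h4]
  simp only [hconv (hU _), hconv hW]
  have hq := hf.holderConjugate.symm
  refine (tendsto_integral_mul_of_ae_tendsto hq ENNReal.ofReal_ne_top
    (F := fun n (q : ℝ × X) => f (U n q.1 q.2)) (F' := fun (q : ℝ × X) => f (W q.1 q.2))
    (Ξ := fun (q : ℝ × X) => Z q.1 q.2)
    (fun n => (hf.memLp_comp (hU n).memLp).1)
    (fun n => eLpNorm_le_of_integral_rpow_le hq.pos (hf.memLp_comp (hU n).memLp)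
      ((hf.integral_rpow_comp_le hg (hU n).memLp).trans
        (mul_le_mul_of_nonneg_left (add_le_add_right (hK n) _) hK'))) ?_ hZ.memLp).2
  filter_upwards [hae] with q hq
  exact (hf.cont.tendsto _).comp hq

/-- The approximations converge weakly in `L^p` in space and time; tested with `f(u)`. -/
theorem tendsto_integral_mul (h : IsStrongLimit j (EnergyRel j f p C) C s b u v)
    (hf : IsNonlinearity f p C) (hj : ∀ v, ‖j v‖ ≤ ‖v‖) {T : ℝ} (hT : 0 ≤ T) :
    Tendsto (fun n => ∫ t in Ioc 0 T, ∫ x, f (u t x) * j (s n t) x ∂m) atTop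
      (𝓝 (∫ t in Ioc 0 T, ∫ x, f (u t x) * u t x ∂m)) := by
  obtain ⟨U, W, K, hU, hW, hK, hae⟩ := h.exists_rep hf hj hT
  have hconv : ∀ {y : ℝ → Lp ℝ 2 m} {Y : ℝ → X → ℝ}, IsSpaceTimeRep p y T Y →
      ∫ t in Ioc 0 T, ∫ x, f (u t x) * y t x ∂m =
        ∫ q, Y q.1 q.2 * f (W q.1 q.2) ∂((volume.restrict (Ioc 0 T)).prod m) := by
    intro y Y hY
    have hi : Integrable (fun q : ℝ × X => f (W q.1 q.2) * Y q.1 q.2)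
      ((volume.restrict (Ioc 0 T)).prod m) := hf.integrable_mul hW.memLp hY.memLp
    simp only [mul_comm (Y _ _)]
    rw [integral_prod _ hi]
    refine integral_congr_ae ?_
    filter_upwards [hY.ae_eq, hW.ae_eq] with t h1 h2
    refine integral_congr_ae ?_
    filter_upwards [h1, h2] with x h3 h4
    simp only [h3, h4]
  simp only [hconv (hU _), hconv hW]
  exact (tendsto_integral_mul_of_ae_tendsto hf.holderConjugate ENNReal.ofReal_ne_top
    (F := fun n (q : ℝ × X) => U n q.1 q.2) (F' := fun (q : ℝ × X) => W q.1 q.2)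
    (Ξ := fun (q : ℝ × X) => f (W q.1 q.2))
    (fun n => (hU n).memLp.1)
    (fun n => eLpNorm_le_of_integral_rpow_le (zero_lt_one.trans hf.one_lt) (hU n).memLp (hK n))
    hae (hf.memLp_comp hW.memLp)).2

theorem isIntegralSolution (h : IsStrongLimit j (EnergyRel j f p C) C s b u v)
    (hf : IsNonlinearity f p C) (hj : ∀ v, ‖j v‖ ≤ ‖v‖) : IsIntegralSolution j f p u v where
  wcont η := h.cont.inner continuousOn_const
  bdd T := isCompact_Icc.exists_bound_of_continuousOn (h.cont.mono fun t ht => ht.1)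
  trace := h.trace
  memLp := h.memLp
  lp T := by
    rcases le_total T 0 with hT | hT
    · rw [Ioc_eq_empty (not_lt.2 hT)]; simp
    obtain ⟨U, W, K, hU, hW, hK, hae⟩ := h.exists_rep hf hj hT
    have hp := zero_lt_one.trans hf.one_lt
    have h1 := hW.memLp.2
    rw [eLpNorm_lt_top_iff_lintegral_rpow_enorm_lt_top (by simpa using hp) ENNReal.ofReal_ne_top,
      ENNReal.toReal_ofReal hp.le, lintegral_prod _ (hW.meas.enorm.pow_const p).aemeasurable] at h1
    refine lt_of_eq_of_lt ?_ h1
    refine lintegral_congr_ae ?_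
    filter_upwards [hW.ae_eq] with t ht
    refine lintegral_congr_ae ?_
    filter_upwards [ht] with x hx
    simp only [Function.uncurry, hx]
  eq ξ hξ t ht := by
    have hI : ∀ n, IsIntegralSolution j f p (fun t => j (s n t)) (s n) := fun n =>
      (h.strong n).isIntegralSolution hf hj
    obtain ⟨Z, hZ⟩ : ∃ Z, IsSpaceTimeRep p (fun _ => j ξ) t Z := by
      refine exists_isSpaceTimeRep (zero_lt_one.trans hf.one_lt) aestronglyMeasurable_const ?_
      have hp := zero_lt_one.trans hf.one_lt
      have h1 := hξ.2
      rw [eLpNorm_lt_top_iff_lintegral_rpow_enorm_lt_top (by simpa using hp)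
        ENNReal.ofReal_ne_top, ENNReal.toReal_ofReal hp.le] at h1
      rw [setLIntegral_const]
      exact ENNReal.mul_lt_top h1 (by simp)
    have hlim1 := h.tendsto_integral_comp_mul hf hj ht hZ
    have hlim2 := tendsto_integral_energyForm hj (fun n => (h.strong n).memLp t) (h.memLp t)
      (memLp_const ξ) (h.tendsto t)
    have hsplit : ∀ {y : ℝ → Lp ℝ 2 m} {z : ℝ → V}, MemLp z 2 (volume.restrict (Ioc 0 t)) →
        (∃ Y, IsSpaceTimeRep p y t Y) →
        ∫ σ in (0 : ℝ)..t, -(energyForm j (z σ) ξ + ∫ x, f (y σ x) * j ξ x ∂m) =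
          -((∫ σ in Ioc 0 t, energyForm j (z σ) ξ) +
            ∫ σ in Ioc 0 t, ∫ x, f (y σ x) * j ξ x ∂m) := by
      rintro y z hz ⟨Y, hY⟩
      rw [intervalIntegral.integral_of_le ht, integral_neg, integral_add]
      · have hv1 := hz.integrable (by norm_num)
        exact Integrable.mono' ((hv1.norm.mul_const ‖ξ‖).const_mul 2)
          ((continuous_energyForm (j := j)).comp_aestronglyMeasurable
          (hv1.1.prodMk aestronglyMeasurable_const)) (Eventually.of_forall fun t =>
            abs_energyForm_le hj _ _)
      · exact hY.integrable_integral (h := fun r x => f r * j ξ x)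
          (hf.integrable_mul hY.memLp (memLp_comp_snd hξ t))
    obtain ⟨U, W, K, hU, hW, hK, hae⟩ := h.exists_rep hf hj ht
    rw [hsplit (h.memLp t) ⟨W, hW⟩]
    refine tendsto_nhds_unique (((h.tendsto_L2 ht).inner tendsto_const_nhds).sub
      ((h.tendsto_L2 le_rfl).inner tendsto_const_nhds)) ?_
    simp only [(hI _).eq ξ hξ t ht, hsplit ((h.strong _).memLp t) ⟨_, hU _⟩]
    exact (hlim2.add hlim1).neg

/-- The energy identity passes to the limit in the pairing of the approximations with the limit. -/
theorem energyIdentity (h : IsStrongLimit j (EnergyRel j f p C) C s b u v)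
    (hf : IsNonlinearity f p C) (hj : ∀ v, ‖j v‖ ≤ ‖v‖) : EnergyIdentity j f u v := by
  intro t ht
  have hu := h.isIntegralSolution hf hj
  obtain ⟨U, W, K, hU, hW, hK, hae⟩ := h.exists_rep hf hj ht
  have hlim1 := h.tendsto_integral_comp_mul hf hj ht hW
  have hlim2 := tendsto_integral_energyForm hj (fun n => (h.strong n).memLp t) (h.memLp t)
    (h.memLp t) (h.tendsto t)
  have hlim3 := h.tendsto_integral_mul hf hj ht
  have hie : ∀ {z : ℝ → V}, MemLp z 2 (volume.restrict (Ioc 0 t)) →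
      Integrable (fun σ => energyForm j (z σ) (v σ)) (volume.restrict (Ioc 0 t)) := by
    intro z hz
    refine Integrable.mono' ((hz.norm.integrable_mul (h.memLp t).norm).const_mul 2)
          ((continuous_energyForm (j := j)).comp_aestronglyMeasurable
          (hz.1.prodMk (h.memLp t).1)) (Eventually.of_forall fun t => ?_)
    exact abs_energyForm_le hj _ _
  have hi : ∀ {y w : ℝ → Lp ℝ 2 m} {Y Z : ℝ → X → ℝ}, IsSpaceTimeRep p y t Y →
      IsSpaceTimeRep p w t Z → Integrable (fun σ => ∫ x, f (y σ x) * w σ x ∂m)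
        (volume.restrict (Ioc 0 t)) := by
    intro y w Y Z hY hZ
    have hi : Integrable (fun q : ℝ × X => f (Y q.1 q.2) * Z q.1 q.2)
      ((volume.restrict (Ioc 0 t)).prod m) := hf.integrable_mul hY.memLp hZ.memLp
    refine hi.integral_prod_left.congr ?_
    filter_upwards [hY.ae_eq, hZ.ae_eq] with t h1 h2
    refine integral_congr_ae ?_
    filter_upwards [h1, h2] with x h3 h4
    simp only [h3, h4]
  have hpair : ∀ n, ⟪j (s n t), u t⟫ - ⟪j (s n 0), u 0⟫ =
      -(2 * (∫ σ in Ioc 0 t, energyForm j (s n σ) (v σ)) +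
        ((∫ σ in Ioc 0 t, ∫ x, f (j (s n σ) x) * u σ x ∂m) +
          ∫ σ in Ioc 0 t, ∫ x, f (u σ x) * j (s n σ) x ∂m)) := by
    intro n
    rw [((h.strong n).inner_integralSolution hf hj hu ht).2, intervalIntegral.integral_of_le ht,
      integral_add (g := fun σ =>
          ∫ x, f (j (s n σ) x) * u σ x ∂m + ∫ x, f (u σ x) * j (s n σ) x ∂m)
        ((hie ((h.strong n).memLp t)).const_mul 2) ((hi (hU n) hW).add (hi hW (hU n))),
      integral_add (hi (hU n) hW) (hi hW (hU n)), integral_const_mul]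
  have e := tendsto_nhds_unique (((h.tendsto_L2 ht).inner tendsto_const_nhds).sub
      ((h.tendsto_L2 le_rfl).inner tendsto_const_nhds))
    (((hlim2.const_mul 2).add (hlim1.add hlim3)).neg.congr fun n => (hpair n).symm)
  rw [real_inner_self_eq_norm_sq, real_inner_self_eq_norm_sq] at e
  rw [intervalIntegral.integral_of_le ht, integral_add (hie (h.memLp t)) (hi hW hW)]
  linarith

end IsStrongLimit

/-- Every initial value is the limit of initial values of strong solutions at a geometric rate. -/
theorem exists_strongSolutions_tendsto [CompleteSpace V] [IsFiniteMeasure m]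
    (hf : IsNonlinearity f p C) (hj : IsEnergyEmbedding j) (u₀ : Lp ℝ 2 m) :
    ∃ (s : ℕ → ℝ → V) (b : ℕ → ℝ → Lp ℝ 2 m),
      (∀ n, IsStrongSolution j (EnergyRel j f p C) C (s n) (b n)) ∧
      ∀ n, ‖j (s n 0) - u₀‖ ≤ (1 / 2) ^ n := by
  have h : ∀ n : ℕ, ∃ s b, IsStrongSolution j (EnergyRel j f p C) C s b ∧
      ‖j (s 0) - u₀‖ ≤ (1 / 2) ^ n := by
    intro n
    obtain ⟨v₀, b₀, h0, hlt⟩ := exists_energyRel_norm_sub_lt hf hj u₀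
      (δ := (1 / 2) ^ n) (by positivity)
    obtain ⟨s, b, hs, h1⟩ :=
      (isCoerciveMonotone_energyRel hf hj).exists_isStrongSolution hf.nonneg h0
    exact ⟨s, b, hs, by rw [h1]; exact hlt.le⟩
  choose s b hs h0 using h
  exact ⟨s, b, hs, h0⟩

variable [CompleteSpace V] [IsFiniteMeasure m] [SecondCountableTopology (Lp ℝ 2 m)]

theorem exists_isIntegralSolution (hf : IsNonlinearity f p C) (hj : IsEnergyEmbedding j)
    (u₀ : Lp ℝ 2 m) :
    ∃ u v, IsIntegralSolution j f p u v ∧ u 0 = u₀ ∧ ContinuousOn u (Ici 0) ∧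
      EnergyIdentity j f u v := by
  obtain ⟨s, b, hs, h0⟩ := exists_strongSolutions_tendsto hf hj u₀
  obtain ⟨u, v, h, hu⟩ := exists_isStrongLimit (isCoerciveMonotone_energyRel hf hj) hf.nonneg hs h0
  exact ⟨u, v, h.isIntegralSolution hf hj.norm_le, hu, h.cont,
    h.energyIdentity hf hj.norm_le⟩

/-- Two integral solutions satisfying the energy identity are compared through strong solutions
whose initial values approximate theirs. -/
theorem IsIntegralSolution.norm_sub_le (hf : IsNonlinearity f p C) (hj : IsEnergyEmbedding j)
    {u w : ℝ → Lp ℝ 2 m} {v z : ℝ → V}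
    (hu : IsIntegralSolution j f p u v)
    (hEu : EnergyIdentity j f u v)
    (hw : IsIntegralSolution j f p w z)
    (hEw : EnergyIdentity j f w z) {t : ℝ} (ht : 0 ≤ t) :
    ‖u t - w t‖ ≤ Real.exp (C * t) * ‖u 0 - w 0‖ := by
  obtain ⟨s, b, hs, h0⟩ := exists_strongSolutions_tendsto hf hj (u 0)
  have hpow : Tendsto (fun n : ℕ => (1 / 2 : ℝ) ^ n) atTop (𝓝 0) :=
    tendsto_pow_atTop_nhds_zero_of_lt_one (by norm_num) (by norm_num)
  have hlim : Tendsto (fun n => j (s n 0)) atTop (𝓝 (u 0)) :=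
    tendsto_iff_norm_sub_tendsto_zero.2 (squeeze_zero (fun _ => norm_nonneg _) h0 hpow)
  have h1 : ∀ n, ‖u t - w t‖ ≤ Real.exp (C * t) * ‖j (s n 0) - u 0‖ +
      Real.exp (C * t) * ‖j (s n 0) - w 0‖ := by
    intro n
    have h2 := (hs n).norm_sub_integralSolution_le hf hj.norm_le hu hEu ht
    have h3 := (hs n).norm_sub_integralSolution_le hf hj.norm_le hw hEw ht
    have h4 := norm_sub_le_norm_sub_add_norm_sub (u t) (j (s n t)) (w t)
    rw [norm_sub_rev (u t) (j (s n t))] at h4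
    linarith
  have h2 := ((hlim.sub_const (u 0)).norm.const_mul (Real.exp (C * t))).add
    ((hlim.sub_const (w 0)).norm.const_mul (Real.exp (C * t)))
  have h3 := le_of_tendsto_of_tendsto' tendsto_const_nhds h2 h1
  simpa using h3

end

section

/-! ### The energy space of a rough boundary -/

section EnergySpace

variable {N : ℕ} {Ω : Set (E N)} {μ : Measure (E N)} {s : ℝ}

theorem isFiniteMeasure_restrict_of_isBounded (hΩ : Bornology.IsBounded Ω) :
    IsFiniteMeasure (volume.restrict Ω) :=
  ⟨by rw [Measure.restrict_apply_univ]; exact hΩ.measure_lt_top⟩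

instance secondCountableTopology_L2 : SecondCountableTopology (L2 Ω) := by
  have : Fact ((2 : ℝ≥0∞) ≠ ⊤) := ⟨by norm_num⟩
  infer_instance

instance completeSpace_V : CompleteSpace (V Ω μ s) :=
  (Submodule.isClosed_topologicalClosure _).completeSpace_coe

/-- The map from the energy space to `L²(Ω)`, as a bounded operator. -/
def toL2L (Ω : Set (E N)) (μ : Measure (E N)) (s : ℝ) : V Ω μ s →L[ℝ] L2 Ω :=
  (WithLp.fstL 2 ℝ _ _).comp (V Ω μ s).subtypeL

theorem toL2L_apply (v : V Ω μ s) : toL2L Ω μ s v = toL2 v := rfl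

theorem energyForm_toL2L (v w : V Ω μ s) : energyForm (toL2L Ω μ s) v w = form v w := by
  rw [energyForm, toL2L_apply, toL2L_apply, Submodule.coe_inner, WithLp.prod_inner_apply,
    WithLp.prod_inner_apply, WithLp.prod_inner_apply]
  simp only [form, toL2, WithLp.ofLp_fst, WithLp.ofLp_snd]
  ring

theorem norm_toL2L_le (v : V Ω μ s) : ‖toL2L Ω μ s v‖ ≤ ‖v‖ :=
  WithLp.norm_fst_le (p := 2) (x := (v : Ambient Ω μ s))

/-- No finiteness is needed: a product with a measure which is not s-finite is either given by the
iterated integral or zero. -/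
theorem ae_prod_of_ae {Y : Type*} [MeasurableSpace Y] {τ : Measure Y} {P : Y → Prop}
    (hP : MeasurableSet {y | P y}) (h : ∀ᵐ y ∂τ, P y) : ∀ᵐ z ∂(τ.prod τ), P z.1 ∧ P z.2 := by
  have hm : MeasurableSet {z : Y × Y | ¬(P z.1 ∧ P z.2)} :=
    ((hP.preimage measurable_fst).inter (hP.preimage measurable_snd)).compl
  rw [ae_iff, Measure.prod]
  by_cases hf : AEMeasurable (fun y => Measure.map (Prod.mk y) τ) τ
  · rw [Measure.bind_apply hm hf]
    refine lintegral_eq_zero_of_ae_eq_zero ?_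
    filter_upwards [h] with y hy
    rw [Measure.map_apply measurable_prodMk_left hm]
    refine measure_mono_null (fun y' hy' => ?_) (ae_iff.1 h)
    simp only [mem_preimage, mem_ofPred_eq, hy, true_and] at hy'
    exact hy'
  · rw [Measure.bind, Measure.map_of_not_aemeasurable hf]; simp

/-- A test function is an element of the energy space without trace. -/
theorem exists_toL2_eq_of_testFunction (hΩ : IsOpen Ω) {φ : E N → ℝ} (hφ : ContDiff ℝ ∞ φ)
    (hc : HasCompactSupport φ) (hs : tsupport φ ⊆ Ω) :
    ∃ v : V Ω μ s, toL2 v =ᵐ[volume.restrict Ω] φ := by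
  have hφ2 : MemLp φ 2 (volume.restrict Ω) := hφ.continuous.memLp_of_hasCompactSupport hc
  have hgc : Continuous (gradient φ) :=
    (InnerProductSpace.toDual ℝ (E N)).symm.continuous.comp (hφ.continuous_fderiv (by simp))
  have hgs : HasCompactSupport (gradient φ) :=
    (hc.fderiv ℝ).comp_left (g := (InnerProductSpace.toDual ℝ (E N)).symm) (map_zero _)
  have hg2 : MemLp (gradient φ) 2 (volume.restrict Ω) := hgc.memLp_of_hasCompactSupport hgs
  have hfr : ∀ x ∈ frontier Ω, φ x = 0 := fun x hx =>
    image_eq_zero_of_notMem_tsupport fun h => (hΩ.frontier_eq ▸ hx).2 (hs h)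
  have hm : MeasurableSet {x | φ x = 0} :=
    (isClosed_eq hφ.continuous continuous_const).measurableSet
  have hb : ∀ᵐ x ∂(bdry Ω μ), φ x = 0 :=
    (ae_restrict_iff hm).2 (Eventually.of_forall fun x hx => hfr x hx.1)
  set w : Ambient Ω μ s := WithLp.toLp 2 (hφ2.toLp φ, WithLp.toLp 2 (hg2.toLp (gradient φ),
    WithLp.toLp 2 (0, 0)))
  have hw : IsCore Ω μ s w := by
    refine ⟨?_, φ, hφ.continuous.continuousOn, hφ2.coeFn_toLp, ?_, ?_, ?_⟩
    · intro ψ hψ hψc hψs v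
      have hd : ∀ x ∉ Ω, ψ x = 0 := fun x hx =>
        image_eq_zero_of_notMem_tsupport fun h => hx (hψs h)
      have hd' : ∀ x ∉ Ω, fderiv ℝ ψ x = 0 := fun x hx => by
        by_contra hne
        exact hx (hψs (support_fderiv_subset ℝ hne))
      have e1 : ∫ x in Ω, w.fst x * fderiv ℝ ψ x v = ∫ x, φ x * fderiv ℝ ψ x v := by
        refine Eq.trans (integral_congr_ae ?_) (setIntegral_eq_integral_of_forall_compl_eq_zero
          fun x hx => by rw [hd' x hx]; simp)
        filter_upwards [hφ2.coeFn_toLp] with x hx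
        change (hφ2.toLp φ) x * _ = _
        rw [hx]
      have e2 : ∫ x in Ω, ⟪w.snd.fst x, v⟫ * ψ x = ∫ x, fderiv ℝ φ x v * ψ x := by
        refine Eq.trans (integral_congr_ae ?_) (setIntegral_eq_integral_of_forall_compl_eq_zero
          fun x hx => by rw [hd x hx, mul_zero])
        filter_upwards [hg2.coeFn_toLp] with x hx
        change ⟪(hg2.toLp (gradient φ)) x, v⟫ * _ = _
        rw [hx, gradient, InnerProductSpace.toDual_symm_apply]
      rw [e1, e2]
      have c1 : Continuous fun x => fderiv ℝ φ x v :=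
        (hφ.continuous_fderiv (by simp)).clm_apply continuous_const
      have c2 : Continuous fun x => fderiv ℝ ψ x v :=
        (hψ.continuous_fderiv (by simp)).clm_apply continuous_const
      exact integral_mul_fderiv_eq_neg_fderiv_mul_of_integrable
        ((c1.mul hψ.continuous).integrable_of_hasCompactSupport hψc.mul_left)
        ((hφ.continuous.mul c2).integrable_of_hasCompactSupport hc.mul_right)
        ((hφ.continuous.mul hψ.continuous).integrable_of_hasCompactSupport hc.mul_right)
        (fun x _ => hφ.differentiable (by simp) x) (fun x _ => hψ.differentiable (by simp) x)
    · have : ∫⁻ x in frontier Ω, ‖φ x‖ₑ ^ 2 ∂μ = 0 := by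
        rw [setLIntegral_congr_fun isClosed_frontier.measurableSet (g := fun _ => 0)
          fun x hx => by simp [hfr x hx]]
        simp
      rw [this]; exact ENNReal.zero_lt_top
    · filter_upwards [hb, Lp.coeFn_zero ℝ 2 (bdry Ω μ)] with x h1 h2
      rw [h1]; exact h2
    · have h1 : ∀ᵐ z ∂(bdryPair Ω μ s), φ z.1 = 0 ∧ φ z.2 = 0 :=
        (withDensity_absolutelyContinuous _ _).ae_le (ae_prod_of_ae hm hb)
      filter_upwards [h1, Lp.coeFn_zero ℝ 2 (bdryPair Ω μ s)] with z h1 h2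
      rw [h1.1, h1.2, sub_zero]; exact h2
  exact ⟨⟨w, (coreSpace Ω μ s).le_topologicalClosure hw⟩, hφ2.coeFn_toLp⟩

/-- The functions underlying the elements of the energy space are dense in `L²(Ω)`, since they
comprise the test functions. -/
theorem isEnergyEmbedding_toL2L (hΩ : IsOpen Ω) (hΩb : Bornology.IsBounded Ω) :
    IsEnergyEmbedding (V := V Ω μ s) (toL2L Ω μ s) := by
  have := isFiniteMeasure_restrict_of_isBounded hΩb
  refine ⟨norm_toL2L_le, ?_⟩
  set K : Submodule ℝ (L2 Ω) :=
    { carrier := {x | ∃ ξ, toL2L Ω μ s ξ = x ∧ ∃ M : ℝ, ∀ᵐ y ∂(volume.restrict Ω),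
        |toL2L Ω μ s ξ y| ≤ M}
      zero_mem' := ⟨0, map_zero _, 0, by
        rw [map_zero]
        filter_upwards [Lp.coeFn_zero ℝ 2 (volume.restrict Ω)] with y hy
        rw [hy]; simp⟩
      add_mem' := by
        rintro _ _ ⟨ξ, rfl, M, hM⟩ ⟨ζ, rfl, L, hL⟩
        refine ⟨ξ + ζ, map_add _ _ _, M + L, ?_⟩
        rw [map_add]
        filter_upwards [hM, hL, Lp.coeFn_add (toL2L Ω μ s ξ) (toL2L Ω μ s ζ)] with y h1 h2 h3
        rw [h3]
        exact (abs_add_le _ _).trans (add_le_add h1 h2)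
      smul_mem' := by
        rintro c _ ⟨ξ, rfl, M, hM⟩
        refine ⟨c • ξ, map_smul _ _ _, |c| * M, ?_⟩
        rw [map_smul]
        filter_upwards [hM, Lp.coeFn_smul c (toL2L Ω μ s ξ)] with y h1 h3
        rw [h3, Pi.smul_apply, smul_eq_mul, abs_mul]
        exact mul_le_mul_of_nonneg_left h1 (abs_nonneg c) } with hK
  change Dense (K : Set (L2 Ω))
  rw [Submodule.dense_iff_topologicalClosure_eq_top, Submodule.topologicalClosure_eq_top_iff,
    Submodule.eq_bot_iff]
  intro x hx
  have hint : IntegrableOn x Ω volume := (Lp.memLp x).integrable (by norm_num)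
  have hloc : LocallyIntegrableOn x Ω volume := hint.locallyIntegrableOn
  have h0 := hΩ.ae_eq_zero_of_integral_contDiff_smul_eq_zero hloc (fun φ hφ hc hs => by
    obtain ⟨v, hv⟩ := exists_toL2_eq_of_testFunction (μ := μ) (s := s) hΩ hφ hc hs
    obtain ⟨M, hM⟩ := hc.exists_bound_of_continuous hφ.continuous
    have hmem : toL2L Ω μ s v ∈ K := ⟨v, rfl, M, by
      filter_upwards [hv] with y hy
      rw [toL2L_apply, hy]; exact hM y⟩
    have h1 := (Submodule.mem_orthogonal K x).1 hx _ hmem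
    rw [L2_inner_eq_integral] at h1
    rw [← setIntegral_eq_integral_of_forall_compl_eq_zero (s := Ω) fun y hy => by
      rw [image_eq_zero_of_notMem_tsupport fun h => hy (hs h), zero_smul], ← h1]
    refine integral_congr_ae ?_
    filter_upwards [hv] with y hy
    rw [toL2L_apply, hy, smul_eq_mul])
  refine Lp.ext ?_
  filter_upwards [(ae_restrict_iff' hΩ.measurableSet).2 h0, Lp.coeFn_zero ℝ 2 (volume.restrict Ω)]
    with y h1 h2
  rw [h1, h2, Pi.zero_apply]

end EnergySpace

end

section

/-! ### Weak solutions and integral solutions -/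

/-- Weakly continuous curves are locally bounded, by the principle of uniform boundedness. -/
theorem exists_norm_le_of_continuousOn_inner {H : Type*} [NormedAddCommGroup H]
    [InnerProductSpace ℝ H] [CompleteSpace H] {u : ℝ → H} {K : Set ℝ} (hK : IsCompact K)
    (hu : ∀ η, ContinuousOn (fun t => ⟪u t, η⟫) K) : ∃ M, ∀ t ∈ K, ‖u t‖ ≤ M := by
  obtain ⟨M, hM⟩ := banach_steinhaus (g := fun t : K => innerSL ℝ (u t)) fun η => by
    obtain ⟨M, hM⟩ := hK.exists_bound_of_continuousOn (hu η)
    exact ⟨M, fun t => hM t t.2⟩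
  exact ⟨M, fun t ht => by simpa using hM ⟨t, ht⟩⟩

theorem restrict_Ioc_eq_restrict_Ioo (T : ℝ) :
    (volume : Measure ℝ).restrict (Ioc 0 T) = volume.restrict (Ioo 0 T) :=
  (Measure.restrict_congr_set Ioo_ae_eq_Ioc).symm

section Abstract

variable {X : Type*} [MeasurableSpace X] {m : Measure X} {V : Type*} [NormedAddCommGroup V]
  [InnerProductSpace ℝ V] {j : V →L[ℝ] Lp ℝ 2 m} {f : ℝ → ℝ} {p C : ℝ}

/-- The conditions of the definition of a weak solution except the initial condition, for an
abstract energy space; the time derivative of `u` is `z₁ + z₂`. -/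
structure IsVariationalSolution (j : V →L[ℝ] Lp ℝ 2 m) (f : ℝ → ℝ) (p : ℝ) (u : ℝ → Lp ℝ 2 m)
    (v : ℝ → V) (z₁ : ℝ → StrongDual ℝ V) (z₂ : ℝ → X → ℝ) : Prop where
  wcont : ∀ ξ, ContinuousOn (fun t => ⟪u t, ξ⟫) (Ici 0)
  bdd : ∀ T : ℝ, 0 < T → MemLp u ⊤ (volume.restrict (Ioo 0 T))
  lp : ∀ T : ℝ, 0 < T → ∫⁻ t in Ioo 0 T, ∫⁻ x, ‖u t x‖ₑ ^ p ∂m < ⊤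
  trace : ∀ᵐ t ∂(volume.restrict (Ioi 0)), j (v t) = u t
  memLp : ∀ T : ℝ, 0 < T → MemLp v 2 (volume.restrict (Ioo 0 T))
  memLp_fst : ∀ T : ℝ, 0 < T → MemLp z₁ 2 (volume.restrict (Ioo 0 T))
  memLp_snd : ∀ T : ℝ, 0 < T → MemLp (fun q : ℝ × X => z₂ q.1 q.2) (ENNReal.ofReal (p / (p - 1)))
    ((volume.restrict (Ioo 0 T)).prod m)
  deriv_eq : ∀ ξ, MemLp (j ξ) (ENNReal.ofReal p) m →
    ∀ ψ : ℝ → ℝ, ContDiff ℝ ∞ ψ → HasCompactSupport ψ → tsupport ψ ⊆ Ioi 0 →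
      ∫ t in Ioi 0, deriv ψ t * ⟪u t, j ξ⟫
        = - ∫ t in Ioi 0, ψ t * (z₁ t ξ + ∫ x, z₂ t x * j ξ x ∂m)
  eq : ∀ᵐ t ∂(volume.restrict (Ioi 0)), ∀ ξ, MemLp (j ξ) (ENNReal.ofReal p) m →
    (z₁ t ξ + ∫ x, z₂ t x * j ξ x ∂m) + energyForm j (v t) ξ + ∫ x, f (u t x) * j ξ x ∂m = 0
  energy : EnergyIdentity j f u v

variable [IsFiniteMeasure m] {u : ℝ → Lp ℝ 2 m} {v : ℝ → V}

/-- The variational identity can be integrated in time, by the lemma of du Bois-Reymond. -/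
theorem IsVariationalSolution.isIntegralSolution {z₁ : ℝ → StrongDual ℝ V} {z₂ : ℝ → X → ℝ}
    (hf : IsNonlinearity f p C) (h : IsVariationalSolution j f p u v z₁ z₂) :
    IsIntegralSolution j f p u v := by
  have hneg : ∀ T : ℝ, T ≤ 0 → (volume : Measure ℝ).restrict (Ioc 0 T) = 0 := fun T hT => by
    rw [Ioc_eq_empty (not_lt.2 hT), Measure.restrict_empty]
  refine ⟨h.wcont, fun T => ?_, h.trace, fun T => ?_, fun T => ?_, fun ξ hξ => ?_⟩
  · exact exists_norm_le_of_continuousOn_inner isCompact_Icc fun η =>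
      (h.wcont η).mono fun t ht => ht.1
  · rcases le_or_gt T 0 with hT | hT
    · rw [hneg T hT]
      exact ⟨aestronglyMeasurable_zero_measure _, by rw [eLpNorm_measure_zero]; simp⟩
    · rw [restrict_Ioc_eq_restrict_Ioo]; exact h.memLp T hT
  · rcases le_or_gt T 0 with hT | hT
    · rw [hneg T hT]; simp
    · rw [restrict_Ioc_eq_restrict_Ioo]; exact h.lp T hT
  · have hae : ∀ᵐ t ∂(volume.restrict (Ioi (0 : ℝ))), z₁ t ξ + ∫ x, z₂ t x * j ξ x ∂m =
          -(energyForm j (v t) ξ + ∫ x, f (u t x) * j ξ x ∂m) := by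
      filter_upwards [h.eq] with t ht
      have := ht ξ hξ
      linarith
    refine sub_eq_integral_of_integral_deriv_mul (h.wcont _) (fun T hT => ?_)
      fun ψ hψ hc hs => ?_
    · rw [intervalIntegrable_iff_integrableOn_Ioc_of_le hT]
      refine Integrable.congr ?_ (ae_restrict_of_ae_restrict_of_subset Ioc_subset_Ioi_self hae)
      rcases hT.eq_or_lt with rfl | hT
      · rw [hneg 0 le_rfl]; exact integrable_zero_measure
      rw [restrict_Ioc_eq_restrict_Ioo]
      refine Integrable.add ?_ ?_
      · exact (ContinuousLinearMap.apply ℝ ℝ ξ).integrable_comp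
          ((h.memLp_fst T hT).integrable (by norm_num))
      · have : ENNReal.HolderConjugate (ENNReal.ofReal (p / (p - 1))) (ENNReal.ofReal p) :=
          hf.holderConjugate.symm.ennrealOfReal
        have hξ' : MemLp (fun q : ℝ × X => j ξ q.2) (ENNReal.ofReal p)
            ((volume.restrict (Ioo 0 T)).prod m) := MemLp.comp_snd hξ _
        have hi : Integrable (fun q : ℝ × X => z₂ q.1 q.2 * j ξ q.2)
            ((volume.restrict (Ioo 0 T)).prod m) := (h.memLp_snd T hT).integrable_mul hξ'
        exact hi.integral_prod_left
    · refine (h.deriv_eq ξ hξ ψ hψ hc hs).trans ?_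
      congr 1
      refine integral_congr_ae ?_
      filter_upwards [hae] with t ht
      rw [ht]

/-- For an integral solution which is continuous and satisfies the energy identity, the functional
`ξ ↦ -energyForm j (v t) ξ` and the function `-f(u)` are the two parts of the time derivative. -/
theorem IsIntegralSolution.exists_isVariationalSolution [CompleteSpace V]
    [SecondCountableTopology (Lp ℝ 2 m)] (hf : IsNonlinearity f p C) (hj : ∀ v, ‖j v‖ ≤ ‖v‖)
    (h : IsIntegralSolution j f p u v) (hc : ContinuousOn u (Ici 0))
    (hE : EnergyIdentity j f u v) : ∃ z₁ z₂, IsVariationalSolution j f p u v z₁ z₂ := by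
  have hum : AEStronglyMeasurable u (volume.restrict (Ioi (0 : ℝ))) :=
    (hc.mono fun t ht => le_of_lt ht).aestronglyMeasurable measurableSet_Ioi
  obtain ⟨U, hUm, hUae⟩ := exists_measurable_uncurry_ae_eq hum
  have hU : ∀ T, IsSpaceTimeRep p u T U := fun T =>
    IsSpaceTimeRep.of_measurable (zero_lt_one.trans hf.one_lt) hUm
      (ae_restrict_of_ae_restrict_of_subset Ioc_subset_Ioi_self hUae) (h.lp T)
  -- `v - j* j v` represents the functional `energyForm j v` in `V`
  set z₁ : ℝ → StrongDual ℝ V := fun t => -innerSL ℝ (v t - j.adjoint (j (v t)))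
  have hval : ∀ {t : ℝ} {ξ : V}, U t =ᵐ[m] u t → z₁ t ξ + ∫ x, -f (U t x) * j ξ x ∂m =
        -(energyForm j (v t) ξ + ∫ x, f (u t x) * j ξ x ∂m) := by
    intro t ξ ht
    have h1 : ∫ x, -f (U t x) * j ξ x ∂m = -∫ x, f (u t x) * j ξ x ∂m := by
      rw [← integral_neg]
      refine integral_congr_ae ?_
      filter_upwards [ht] with x hx
      rw [hx, neg_mul]
    have h2 : z₁ t ξ = -energyForm j (v t) ξ := by
      simp only [z₁, energyForm, neg_apply, innerSL_apply_apply,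
        inner_sub_left, ContinuousLinearMap.adjoint_inner_left]
    rw [h1, h2, neg_add]
  refine ⟨z₁, fun t x => -f (U t x), h.wcont, fun T hT => ?_, fun T hT => ?_, h.trace,
    fun T hT => ?_, fun T hT => ?_, fun T hT => ?_, fun ξ hξ ψ hψ hψc hψs => ?_, ?_, hE⟩
  · obtain ⟨M, hM⟩ := h.bdd T
    refine MemLp.of_bound (hum.mono_measure (Measure.restrict_mono Ioo_subset_Ioi_self le_rfl)) M ?_
    exact (ae_restrict_iff' measurableSet_Ioo).2 (Eventually.of_forall fun t ht =>
      hM t ⟨ht.1.le, ht.2.le⟩)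
  · rw [← restrict_Ioc_eq_restrict_Ioo]; exact h.lp T
  · rw [← restrict_Ioc_eq_restrict_Ioo]; exact h.memLp T
  · rw [← restrict_Ioc_eq_restrict_Ioo]
    have h1 : MemLp (fun t => v t - j.adjoint (j (v t))) 2 (volume.restrict (Ioc 0 T)) :=
      (h.memLp T).sub ((j.adjoint.comp j).comp_memLp' (h.memLp T))
    refine h1.congr_norm ?_ (Eventually.of_forall fun t => ?_)
    · exact ((innerSL ℝ).continuous.comp_aestronglyMeasurable h1.1).neg
    · simp only [z₁, norm_neg, innerSL_apply_norm]
  · rw [← restrict_Ioc_eq_restrict_Ioo]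
    exact (hf.memLp_comp (hU T).memLp).neg
  · refine (integral_deriv_mul_of_sub_eq_integral (fun T hT =>
      h.intervalIntegrable_test hf hj hξ hT) (h.eq ξ hξ) hψ hψc hψs).trans ?_
    congr 1
    refine integral_congr_ae ?_
    filter_upwards [hUae] with t ht
    rw [hval ht]
  · filter_upwards [hUae] with t ht ξ hξ
    rw [hval ht]
    ring

theorem exists_isVariationalSolution [CompleteSpace V] [SecondCountableTopology (Lp ℝ 2 m)]
    (hf : IsNonlinearity f p C) (hj : IsEnergyEmbedding j) (u₀ : Lp ℝ 2 m) :
    ∃ u, (u 0 = u₀ ∧ ∃ v z₁ z₂, IsVariationalSolution j f p u v z₁ z₂) ∧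
      ContinuousOn u (Ici 0) := by
  obtain ⟨u, v, hu, h0, hc, hE⟩ := exists_isIntegralSolution hf hj u₀
  obtain ⟨z₁, z₂, hz⟩ := hu.exists_isVariationalSolution hf hj.norm_le hc hE
  exact ⟨u, ⟨h0, v, z₁, z₂, hz⟩, hc⟩

end Abstract

/-- Weak solutions are variational solutions for the energy space of the rough boundary; the two
definitions differ only in the notation for the form and the embedding. -/
theorem isWeakSolution_iff {N : ℕ} {Ω : Set (E N)} {μ : Measure (E N)} {s : ℝ} {f : ℝ → ℝ} {p : ℝ}
    {u₀ : L2 Ω} {u : ℝ → L2 Ω} : IsWeakSolution Ω μ s f p u₀ u ↔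
      u 0 = u₀ ∧ ∃ v z₁ z₂, IsVariationalSolution (V := V Ω μ s) (toL2L Ω μ s) f p u v z₁ z₂ := by
  constructor
  · rintro ⟨h1, h0, h2, h3, v, z₁, z₂, h4, h5, h6, h7, h8, h9, h10⟩
    refine ⟨h0, v, z₁, z₂, h1, h2, h3, h4, h5, h6, h7, h8, ?_, ?_⟩
    · simpa only [energyForm_toL2L, toL2L_apply] using h9
    · simpa only [EnergyIdentity, energyForm_toL2L] using h10
  · rintro ⟨h0, v, z₁, z₂, h1, h2, h3, h4, h5, h6, h7, h8, h9, h10⟩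
    refine ⟨h1, h0, h2, h3, v, z₁, z₂, h4, h5, h6, h7, h8, ?_, ?_⟩
    · simpa only [energyForm_toL2L, toL2L_apply] using h9
    · simpa only [EnergyIdentity, energyForm_toL2L] using h10

end

section

/-! ### Existence and continuous dependence -/

section WellPosedness

variable {N : ℕ} {Ω : Set (E N)} {μ : Measure (E N)} {s : ℝ} {f : ℝ → ℝ} {p C : ℝ}

theorem IsWeakSolution.norm_sub_le (hΩ : IsOpen Ω) (hΩb : Bornology.IsBounded Ω)
    (hf : IsNonlinearity f p C) {u₀ w₀ : L2 Ω} {u w : ℝ → L2 Ω}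
    (hu : IsWeakSolution Ω μ s f p u₀ u) (hw : IsWeakSolution Ω μ s f p w₀ w) {t : ℝ}
    (ht : 0 ≤ t) : ‖u t - w t‖ ≤ Real.exp (C * t) * ‖u₀ - w₀‖ := by
  have := isFiniteMeasure_restrict_of_isBounded hΩb
  have hj := isEnergyEmbedding_toL2L (μ := μ) (s := s) hΩ hΩb
  obtain ⟨h0, v, z₁, z₂, hv⟩ := isWeakSolution_iff.1 hu
  obtain ⟨h0', v', z₁', z₂', hv'⟩ := isWeakSolution_iff.1 hw
  rw [← h0, ← h0']
  exact IsIntegralSolution.norm_sub_le (V := V Ω μ s) hf hj (hv.isIntegralSolution hf) hv.energy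
    (hv'.isIntegralSolution hf) hv'.energy ht

theorem exists_isWeakSolution (hΩ : IsOpen Ω) (hΩb : Bornology.IsBounded Ω)
    (hf : IsNonlinearity f p C) (u₀ : L2 Ω) :
    ∃ u : ℝ → L2 Ω, IsWeakSolution Ω μ s f p u₀ u ∧ ContinuousOn u (Ici 0) := by
  have := isFiniteMeasure_restrict_of_isBounded hΩb
  have hj := isEnergyEmbedding_toL2L (μ := μ) (s := s) hΩ hΩb
  obtain ⟨u, hu, hc⟩ := exists_isVariationalSolution (V := V Ω μ s) hf hj u₀
  exact ⟨u, isWeakSolution_iff.2 hu, hc⟩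

end WellPosedness

end

end RoughRobin

end

theorem mainTheorem10
    (N : ℕ) (hN : 2 ≤ N) (s : ℝ) (hs : s ∈ Set.Ioo (0 : ℝ) 1)
    (Ω : Set (RoughRobin.E N)) (hΩ : IsOpen Ω) (hΩb : Bornology.IsBounded Ω)
    (μ : Measure (RoughRobin.E N)) (hμ : μ (frontier Ω)ᶜ = 0) (hHμ : RoughRobin.Hmu Ω μ)
    (f : ℝ → ℝ) (p : ℝ) (hp : 1 < p) (hf2 : RoughRobin.H2 f p)
    (C : ℝ) (hf3 : RoughRobin.H3 f C) :
    (∀ u₀ : RoughRobin.L2 Ω, ∃ u : ℝ → RoughRobin.L2 Ω,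
      RoughRobin.IsWeakSolution Ω μ s f p u₀ u ∧ ContinuousOn u (Set.Ici 0) ∧
      ∀ w : ℝ → RoughRobin.L2 Ω, RoughRobin.IsWeakSolution Ω μ s f p u₀ w →
        Set.EqOn w u (Set.Ici 0)) ∧
    (∀ (u₀ w₀ : RoughRobin.L2 Ω) (u w : ℝ → RoughRobin.L2 Ω),
      RoughRobin.IsWeakSolution Ω μ s f p u₀ u → RoughRobin.IsWeakSolution Ω μ s f p w₀ w →
      ∀ t : ℝ, 0 ≤ t → ‖u t - w t‖ ≤ Real.exp (C * t) * ‖u₀ - w₀‖) := by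
  have hf := RoughRobin.isNonlinearity_of_H2_H3 hp hf2 hf3
  refine ⟨fun u₀ => ?_, fun u₀ w₀ u w hu hw t ht => hu.norm_sub_le hΩ hΩb hf hw ht⟩
  obtain ⟨u, hu, hc⟩ := RoughRobin.exists_isWeakSolution (μ := μ) (s := s) hΩ hΩb hf u₀
  refine ⟨u, hu, hc, fun w hw t ht => ?_⟩
  have h := hw.norm_sub_le hΩ hΩb hf hu ht
  rw [sub_self, norm_zero, mul_zero] at h
  exact sub_eq_zero.1 (norm_le_zero_iff.1 h)
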